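/- **Model.** A labeled graph is a finite simple graph $G$ with $n$ vertices and maximum degree $\Delta$, with distinct natural numbers as vertex identifiers, and with the neighbors of every vertex $v$ numbered by $\deg(v)$ ports. A probe $(v,i)$ returns the neighbor $u$ of $v$ at its $i$th port and the number of the port of $u$ that leads back to $v$, or "null" if there is no such port. A deterministic centralized local algorithm for edge queries is given $n$ and $\Delta$ and answers a sequence of queries, each an edge of $G$, online by (adaptive) probes; it is stateless if it stores nothing between queries. It is an algorithm for $(1-\varepsilon)$-approximate maximum cardinality matching if there is one matching $M$ of $G$, with $|M|\ge(1-\varepsilon)|M^*|$ for a maximum matching $M^*$, such that for every sequence of queries every query $e$ is answered by whether $e\in M$. Its probe radius on $G$ is at most $r$ if for every query $e$ all probes are made at vertices at distance at most $r$ from an endpoint of $e$. $\log^*n$ is the least $i$ such that the $i$-fold iterated base-2 logarithm of $n$ is at most $1$. **Coloring.** For $\kappa\in\mathbb N$, call a stateless deterministic coloring algorithm $C$ a $\kappa$-coloring algorithm if, given $N$ and $D$, on every labeled graph with identifiers in $\{0,\dots,N-1\}$ and maximum degree at most $D$, it answers every vertex query by the color of that vertex in a fixed proper coloring with colors in $\{0,\dots,\kappa(D+1)^\kappa-1\}$,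 with all probes at distance at most $\kappa(\log^*N+(D+1)^\kappa)$ from the queried vertex. **Oracle.** Fix $C$ and $a\in\mathbb N$; identifiers of $G$ are at most $a\,n^a$. The oracles $\mathcal O_i$ are defined recursively. $\mathcal O_0$ answers "no" to every query. For $i\ge1$, let $M_{i-1}$ be the set of edges on which $\mathcal O_{i-1}$ answers "yes", and let $H_i$ be the intersection graph whose nodes are the $M_{i-1}$-augmenting paths of length $2i-1$ in $G$, two being adjacent if they share a vertex; a node is identified by the number below $(a\,n^a+1)^{2i}$ whose base-$(a\,n^a+1)$ digits are the identifiers along the path, listed from the endpoint with the smaller identifier. On query $e$, $\mathcal O_i$ computes $\tau$, the answer of $\mathcal O_{i-1}$ to $e$, and $\rho$, which tells whether some path containing $e$ lies in the maximal independent set of $H_i$ computed as follows, and it returns $\tau\oplus\rho$. The nodes of $H_i$ are colored by $C$ with $N=(a\,n^a+1)^{2i}$ and $D=(2i)^2\Delta^{2i-1}$, edges are directed from the higher to the lower color, and a directed depth first search puts a node into the set iff none of its out-neighbors is in the set. The augmenting paths through $e$, and the answers to probes of $H_i$, are computed by breadth first search in $G$ to depth $2i-1$ from the endpoints of $e$,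 respectively from the vertices of the probed path, and by calling $\mathcal O_{i-1}$ on all edges incident to the vertices found. **Statement.** (1) There are $\kappa\in\mathbb N$ and a $\kappa$-coloring algorithm. (2) For all $\kappa,a\in\mathbb N$ there is a constant $c>0$ such that for every $\kappa$-coloring algorithm $C$ and every $\varepsilon\in(0,1)$ the oracle $\mathcal O_{1+\lceil1/\varepsilon\rceil}$ built from $C$ is a stateless deterministic centralized local algorithm which, on every labeled graph $G$ with identifiers at most $a\,n^a$, is an algorithm for $(1-\varepsilon)$-approximate maximum cardinality matching and has probe radius at most $$\Delta^{c/\varepsilon}+\frac{c}{\varepsilon^2}\,\log^*(n).$$ In particular its probe radius is $\Delta^{O(1/\varepsilon)}+O(1/\varepsilon^2)\cdot\log^*(n)$. -/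

import Mathlib

/-- The iterated logarithm (base two): the least `i` such that the `i`-th iterate of `log₂`,
applied to `n`, is at most one. -/
noncomputable def logStar (n : ℕ) : ℕ :=
  sInf {i : ℕ | (Real.logb 2)^[i] (n : ℝ) ≤ 1}

/-! ### Labeled graphs -/

/-- A finite labeled graph: every vertex has a distinct identifier, and the neighbors of each
vertex `v` are numbered by the ports `0, …, deg v - 1` of `v`. -/
structure LabeledGraph where
  V : Type
  [fintypeV : Fintype V]
  [decEqV : DecidableEq V]
  graph : SimpleGraph V
  [decAdj : DecidableRel graph.Adj]
  id : V → ℕ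
  id_injective : Function.Injective id
  port : ∀ v : V, Fin (graph.degree v) ≃ graph.neighborSet v

namespace LabeledGraph

attribute [instance] LabeledGraph.fintypeV LabeledGraph.decEqV LabeledGraph.decAdj

/-- The number of vertices. -/
def n (G : LabeledGraph) : ℕ := Fintype.card G.V

/-- The maximum degree. -/
def maxDeg (G : LabeledGraph) : ℕ := G.graph.maxDegree

/-- The answer to the probe at port `i` of the vertex `v`: null if `v` has at most `i` neighbors;
otherwise the identifier of the neighbor `u` at that port, with the number of the port of `u`
that points back to `v`. -/
def answerAt (G : LabeledGraph) (v : G.V) (i : ℕ) : Option (ℕ × ℕ) :=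
  if h : i < G.graph.degree v then
    let u := G.port v ⟨i, h⟩
    some (G.id u, ((G.port u).symm ⟨v, u.2.symm⟩ : Fin _))
  else none

open Classical in
/-- The answer to the probe `(x, i)`, where `x` is an identifier. (An identifier that does not
occur in the graph gets the answer null; a bound on the probe radius excludes such probes.) -/
noncomputable def answer (G : LabeledGraph) (x i : ℕ) : Option (ℕ × ℕ) :=
  if h : ∃ v, G.id v = x then G.answerAt h.choose i else none

/-- A query for an edge is the pair of the identifiers of its endpoints. -/
def IsEdgeQuery (G : LabeledGraph) (q : Sym2 ℕ) : Prop :=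
  ∃ e ∈ G.graph.edgeSet, Sym2.map G.id e = q

/-- The ball of radius `r` around a vertex. The extended distance is used, so vertices of other
components belong to no ball. -/
def vertexBall (G : LabeledGraph) (v : G.V) (r : ℕ) : Set G.V :=
  {w | G.graph.edist v w ≤ r}

/-- The ball of radius `r` around an edge: the vertices at distance at most `r` from one of its
endpoints. -/
def edgeBall (G : LabeledGraph) (q : Sym2 ℕ) (r : ℕ) : Set G.V :=
  {w | ∃ v, G.id v ∈ q ∧ w ∈ G.vertexBall v r}

/-- A matching: a set of edges no two of which share an endpoint. -/
def IsMatching (G : LabeledGraph) (M : Finset (Sym2 G.V)) : Prop :=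
  M ⊆ G.graph.edgeFinset ∧ ∀ e ∈ M, ∀ f ∈ M, ∀ v, v ∈ e → v ∈ f → e = f

/-- The solutions of the `(1 - ε)`-approximate maximum cardinality matching problem: the
characteristic functions of the matchings `M` of `G` with `|M| ≥ (1 - ε) |M'|` for every
matching `M'`. -/
def approxMCM (G : LabeledGraph) (ε : ℝ) : Set (Sym2 ℕ → Bool) :=
  {f | ∃ M : Finset (Sym2 G.V), G.IsMatching M ∧
      (∀ M' : Finset (Sym2 G.V), G.IsMatching M' → (1 - ε) * (M'.card : ℝ) ≤ (M.card : ℝ)) ∧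
      ∀ e ∈ G.graph.edgeSet, (f (Sym2.map G.id e) = true ↔ e ∈ M)}

end LabeledGraph

/-! ### Deterministic programs with probes -/

/-- A deterministic computation that may probe a graph adaptively and returns a value in `α`:
either it stops, or it asks for the neighbor at port `i` of the vertex with identifier `x` and
continues according to the answer. -/
inductive ProbeTree (α : Type) : Type
  | done (a : α) : ProbeTree α
  | ask (x i : ℕ) (k : Option (ℕ × ℕ) → ProbeTree α) : ProbeTree α

namespace ProbeTree

/-- Sequential composition. -/
def bind {α β : Type} : ProbeTree α → (α → ProbeTree β) → ProbeTree β
  | done a, f => f a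
  | ask x i k, f => ask x i fun r => (k r).bind f

instance : Monad ProbeTree where
  pure := done
  bind := bind

/-- The value returned if the probes are answered by `ans`. -/
def eval {α : Type} (ans : ℕ → ℕ → Option (ℕ × ℕ)) : ProbeTree α → α
  | done a => a
  | ask x i k => (k (ans x i)).eval ans

/-- The list of the probes performed if the probes are answered by `ans`. -/
def probes {α : Type} (ans : ℕ → ℕ → Option (ℕ × ℕ)) : ProbeTree α → List (ℕ × ℕ)
  | done _ => []
  | ask x i k => (x, i) :: (k (ans x i)).probes ans

/-- Replace every probe by the program `h` that computes its answer. -/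
def simulate {α : Type} (h : ℕ → ℕ → ProbeTree (Option (ℕ × ℕ))) : ProbeTree α → ProbeTree α
  | done a => done a
  | ask x i k => (h x i).bind fun r => (k r).simulate h

/-- Run a program for every member of a list and collect the results. -/
def forEach {α β : Type} (f : β → ProbeTree α) : List β → ProbeTree (List α)
  | [] => pure []
  | b :: l => do
      let a ← f b
      let as ← forEach f l
      pure (a :: as)

/-- Probing a labeled graph `G`, the program only probes vertices that belong to `S`. -/
def ProbesWithin {α : Type} (G : LabeledGraph) (S : Set G.V) (p : ProbeTree α) : Prop :=
  ∀ y ∈ p.probes G.answer, ∃ w ∈ S, G.id w = y.1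

end ProbeTree

/-! ### Centralized local algorithms with edge queries -/

/-- A deterministic centralized local algorithm for edge queries with yes/no answers. The answer
to a query is computed from the number `n` of vertices, the maximum degree `Δ`, the stored state
and the query, by probing the graph; the state is then updated. -/
structure CentLocalAlgorithm where
  State : Type
  init : State
  step : (n Δ : ℕ) → State → Sym2 ℕ → ProbeTree (Bool × State)

namespace CentLocalAlgorithm

/-- No information is stored between queries. -/
def Stateless (A : CentLocalAlgorithm) : Prop := Subsingleton A.State

/-- The stateless algorithm given by a program for every query. -/
def ofStateless (p : (n Δ : ℕ) → Sym2 ℕ → ProbeTree Bool) : CentLocalAlgorithm where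
  State := Unit
  init := ()
  step n Δ _ q := do
    let b ← p n Δ q
    pure (b, ())

/-- The answers given online to a sequence of queries, starting in the state `s`, with the final
state. -/
noncomputable def run (A : CentLocalAlgorithm) (G : LabeledGraph) :
    A.State → List (Sym2 ℕ) → List Bool × A.State
  | s, [] => ([], s)
  | s, q :: l =>
      let r := (A.step G.n G.maxDeg s q).eval G.answer
      let t := A.run G r.2 l
      (r.1 :: t.1, t.2)

/-- Consistency: one solution `f` explains the answers to all sequences of queries. -/
def Solves (A : CentLocalAlgorithm) (G : LabeledGraph) (sol : Set (Sym2 ℕ → Bool)) : Prop :=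
  ∃ f ∈ sol, ∀ l : List (Sym2 ℕ), (∀ q ∈ l, G.IsEdgeQuery q) → (A.run G A.init l).1 = l.map f

/-- For every query `q` (after any sequence of earlier queries), all probes are contained in the
ball of radius `r` around `q`. -/
def HasProbeRadius (A : CentLocalAlgorithm) (G : LabeledGraph) (r : ℕ) : Prop :=
  ∀ l : List (Sym2 ℕ), (∀ q ∈ l, G.IsEdgeQuery q) → ∀ q, G.IsEdgeQuery q →
    (A.step G.n G.maxDeg (A.run G A.init l).2 q).ProbesWithin G (G.edgeBall q r)

end CentLocalAlgorithm

/-! ### Vertex coloring and maximal independent sets -/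

/-- A stateless deterministic algorithm for vertex coloring: given a bound `N` such that all
identifiers are less than `N`, a bound `D` on the degrees and a vertex, compute its color. -/
abbrev ColoringAlgorithm : Type := (N D : ℕ) → ℕ → ProbeTree ℕ

/-- The algorithm computes a proper coloring with at most `κ (D + 1) ^ κ` colors, and its probe
radius is at most `κ (log* N + (D + 1) ^ κ)`. -/
def ColoringAlgorithm.IsPolyColoring (C : ColoringAlgorithm) (κ : ℕ) : Prop :=
  ∀ (N D : ℕ) (G : LabeledGraph), (∀ v, G.id v < N) → (∀ v, G.graph.degree v ≤ D) →
    (∀ v, (C N D (G.id v)).eval G.answer < κ * (D + 1) ^ κ) ∧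
    (∀ u v, G.graph.Adj u v →
      (C N D (G.id u)).eval G.answer ≠ (C N D (G.id v)).eval G.answer) ∧
    (∀ v, (C N D (G.id v)).ProbesWithin G (G.vertexBall v (κ * (logStar N + (D + 1) ^ κ))))

/-- The neighbors of the vertex `x` in a graph with degrees at most `D`. -/
def neighbors (D x : ℕ) : ProbeTree (List ℕ) := do
  let rs ← ProbeTree.forEach (fun i => ProbeTree.ask x i ProbeTree.done) (List.range D)
  pure (rs.filterMap fun r => r.map Prod.fst)

/-- Is `x` in the greedy maximal independent set of the orientation that directs every edge from
the higher to the lower color? Directed depth first search: `x` is in the set if and only if none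
of its out-neighbors is. The first argument bounds the depth and is at least the color of `x`. -/
def greedyMIS (color : ℕ → ProbeTree ℕ) (D : ℕ) : ℕ → ℕ → ProbeTree Bool
  | 0, _ => pure true
  | t + 1, x => do
      let c ← color x
      let ys ← neighbors D x
      let bs ← ProbeTree.forEach (fun y => do
        let d ← color y
        if d < c then greedyMIS color D t y else pure false) ys
      pure (bs.all fun b => !b)

/-- The maximal independent set algorithm based on the coloring algorithm `C`. -/
def lmis (C : ColoringAlgorithm) (N D x : ℕ) : ProbeTree Bool := do
  let c ← C N D x
  greedyMIS (C N D) D c x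

/-! ### Augmenting paths -/

/-- The edges of the path that visits the given vertices. -/
def pathEdges (p : List ℕ) : List (Sym2 ℕ) := List.zipWith (fun x y => s(x, y)) p p.tail

/-- `p` lists the vertices of a simple path with edges in `E` that is `M`-augmenting, i.e., its
edges are alternately in `M` and not in `M`, and its endpoints are `M`-free. Of the two directions
of a path, the one that starts at the endpoint with the smaller identifier is listed. -/
def IsAugmenting (E M : Finset (Sym2 ℕ)) (p : List ℕ) : Prop :=
  p.Nodup ∧ (∀ e ∈ pathEdges p, e ∈ E) ∧
  (pathEdges p).IsChain (fun e f => e ∈ M ↔ f ∉ M) ∧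
  (∀ x ∈ p.head?.toList, ∀ e ∈ M, x ∉ e) ∧ (∀ x ∈ p.getLast?.toList, ∀ e ∈ M, x ∉ e) ∧
  ∀ x ∈ p.head?.toList, ∀ y ∈ p.getLast?.toList, x < y

instance (E M : Finset (Sym2 ℕ)) (p : List ℕ) : Decidable (IsAugmenting E M p) := by
  unfold IsAugmenting
  infer_instance

/-- The list of `L` numbers less than `B` that is encoded by a number less than `B ^ L` (its
digits to the base `B`). These codes are the identifiers of the paths with `L` vertices. -/
def decodePath (B L x : ℕ) : List ℕ := (List.range L).map fun j => x / B ^ j % B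

/-- The codes of all `M`-augmenting paths with `L` vertices and edges in `E`. -/
def augmentingCodes (B L : ℕ) (E M : Finset (Sym2 ℕ)) : Finset ℕ :=
  (Finset.range (B ^ L)).filter fun x => IsAugmenting E M (decodePath B L x)

/-! ### The recursive oracle -/

/-- Breadth first search: the vertices at distance at most `d` from `x`. -/
def bfs (Δ : ℕ) : ℕ → ℕ → ProbeTree (Finset ℕ)
  | 0, x => pure {x}
  | d + 1, x => do
      let S ← bfs Δ d x
      let ys ← ProbeTree.forEach (neighbors Δ) (S.sort (· ≤ ·))
      pure (S ∪ ys.flatten.toFinset)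

/-- The edges that are incident to vertices of the ball of radius `d` around `x`, and those among
them that belong to the matching decided by `prev`. -/
def localView (Δ : ℕ) (prev : Sym2 ℕ → ProbeTree Bool) (d x : ℕ) :
    ProbeTree (Finset (Sym2 ℕ) × Finset (Sym2 ℕ)) := do
  let S ← bfs Δ d x
  let es ← ProbeTree.forEach (fun y => do
    let zs ← neighbors Δ y
    pure (zs.map fun z => s(y, z))) (S.sort (· ≤ ·))
  let χ ← ProbeTree.forEach (fun e => do
    let b ← prev e
    pure (e, b)) es.flatten
  pure (es.flatten.toFinset, ((χ.filter Prod.snd).map Prod.fst).toFinset)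

/-- The (sorted) neighbors of the path `x` in the intersection graph `H_i`, whose nodes are the
augmenting paths of length `2i-1` with respect to the matching `M_{i-1}` decided by `prev`, two
of them being adjacent if they share a vertex. -/
def intersectionNeighbors (B Δ i : ℕ) (prev : Sym2 ℕ → ProbeTree Bool) (x : ℕ) :
    ProbeTree (List ℕ) := do
  let Ps ← ProbeTree.forEach (fun v => do
    let w ← localView Δ prev (2 * i - 1) v
    pure (((augmentingCodes B (2 * i) w.1 w.2).filter fun y =>
      v ∈ decodePath B (2 * i) y).sort (· ≤ ·))) (decodePath B (2 * i) x)
  pure ((Ps.flatten.toFinset.erase x).sort (· ≤ ·))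

/-- The answer to a probe at port `j` of the path `x` in the intersection graph `H_i`. -/
def intersectionProbe (B Δ i : ℕ) (prev : Sym2 ℕ → ProbeTree Bool) (x j : ℕ) :
    ProbeTree (Option (ℕ × ℕ)) := do
  let ys ← intersectionNeighbors B Δ i prev x
  match ys[j]? with
  | none => pure none
  | some y => do
      let zs ← intersectionNeighbors B Δ i prev y
      pure (some (y, zs.idxOf x))

/-- Does the edge `e` belong to a path in the maximal independent set of `H_i`? First all
augmenting paths of length `2i-1` that contain `e` are listed; then the maximal independent set
algorithm is run on `H_i` for each of them. The identifiers in `H_i` are less than `B ^ (2i)` and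
the degrees in `H_i` are at most `(2i)² Δ ^ (2i-1)`. -/
def procA (C : ColoringAlgorithm) (B Δ i : ℕ) (prev : Sym2 ℕ → ProbeTree Bool) (e : Sym2 ℕ) :
    ProbeTree Bool := do
  let w₁ ← localView Δ prev (2 * i - 1) e.inf
  let w₂ ← localView Δ prev (2 * i - 1) e.sup
  let P := (augmentingCodes B (2 * i) (w₁.1 ∪ w₂.1) (w₁.2 ∪ w₂.2)).filter fun x =>
    e ∈ pathEdges (decodePath B (2 * i) x)
  let bs ← ProbeTree.forEach (fun x =>
    (lmis C (B ^ (2 * i)) ((2 * i) ^ 2 * Δ ^ (2 * i - 1)) x).simulate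
      (intersectionProbe B Δ i prev)) (P.sort (· ≤ ·))
  pure (bs.any fun b => b)

/-- The recursive oracle: does the edge `e` belong to the matching `M_i`, where `M_0` is empty and
`M_i` is the symmetric difference of `M_{i-1}` and the edges of the paths in the maximal
independent set of `H_i`? Here all identifiers are less than `B`. -/
def oracle (C : ColoringAlgorithm) (B Δ : ℕ) : ℕ → Sym2 ℕ → ProbeTree Bool
  | 0, _ => pure false
  | i + 1, e => do
      let τ ← oracle C B Δ i e
      let ρ ← procA C B Δ (i + 1) (oracle C B Δ i) e
      pure (xor τ ρ)

/-- The oracle `O_i` as a stateless centralized local algorithm for graphs on `n` vertices whose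
identifiers are at most `a * n ^ a`. -/
def oracleAlgorithm (C : ColoringAlgorithm) (a i : ℕ) : CentLocalAlgorithm :=
  CentLocalAlgorithm.ofStateless fun n Δ => oracle C (a * n ^ a + 1) Δ i

/-! ### Evaluation and probes of programs -/

namespace ProbeTree

variable {α β : Type}

/-! Correctness is the analysis of Hopcroft and Karp. The invariant (`oracle_matching`) is that
`M_i` is a matching all of whose augmenting paths have at least `2(i+1)` vertices. Both the
induction step and the final approximation ratio rest on one inequality
(`card_symmDiff_lower_bound`): if every `M`-augmenting path has at least `l` edges, then `l (|N| -
|M|) ≤ |M Δ N|` for every matching `N`. It is proved by regarding the two matchings as involutions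
on vertices and following alternating walks from `M`-free vertices (`involution_count`). For the
induction step let `F` be the edges of a maximal family `S` of disjoint shortest augmenting paths
and `P` an augmenting path of `M Δ F` that is too short. The inequality for `N = M Δ F Δ P` leaves
no room for a common edge of `F` and `P`. Then they share no vertex either, so `P` augments `M`
itself and contradicts the maximality of `S` (`hopcroft_karp`). For the ratio, `l = 2k+1` and `|M Δ
N| ≤ |M| + |N|` give `k |N| ≤ (k+1) |M|`.

Locality: whether a list of `2i` vertices is a node of `H_i` depends only on edges at these
vertices, so views of radius `2i-1` suffice to answer probes of `H_i` exactly as the labeled graph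
`intersectionGraph` would (`eval_intersectionProbe`). A program for `H_i` may therefore be simulated
on `G`. A node of `H_i` enters the set iff no neighbor of smaller color does. Properness of the
coloring makes this set independent, and it is maximal by construction.

Radius: colors decrease along the depth first search, so its depth is at most the number of colors,
which is polynomial in `D = (2i)² Δ^(2i-1)`. One step in `H_i` costs `O(i)` steps in `G`, and the
previous oracle is called only on edges found there, so the radii of the rounds add up. With `k =
O(1/ε)` rounds the `log*` terms sum to `O(k²) log* n`, since `log*` of the identifiers of `H_i` is
`log* n` plus a term independent of `n`. If `Δ ≥ 2`, everything else is absorbed into `Δ^(O(k))`. If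
`Δ ≤ 1`, an edge is a whole component.

The coloring algorithm is Linial's. A color below `m` is read as a polynomial of degree at most `log
m` over a prime field with more than `D log m` elements. Some point separates it from the
polynomials of all neighbors, and the point with the value there is the new color. After `log* N`
rounds `O((D+1)^4)` colors are left. -/

@[simp] theorem eval_pure (ans : ℕ → ℕ → Option (ℕ × ℕ)) (a : α) :
    (pure a : ProbeTree α).eval ans = a := rfl

@[simp] theorem eval_bind (ans : ℕ → ℕ → Option (ℕ × ℕ)) (p : ProbeTree α)
    (f : α → ProbeTree β) : (p >>= f).eval ans = (f (p.eval ans)).eval ans := by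
  change (p.bind f).eval ans = _
  induction p with
  | done a => rfl
  | ask x i k ih => exact ih _

@[simp] theorem probes_pure (ans : ℕ → ℕ → Option (ℕ × ℕ)) (a : α) :
    (pure a : ProbeTree α).probes ans = [] := rfl

@[simp] theorem probes_bind (ans : ℕ → ℕ → Option (ℕ × ℕ)) (p : ProbeTree α)
    (f : α → ProbeTree β) :
    (p >>= f).probes ans = p.probes ans ++ (f (p.eval ans)).probes ans := by
  change (p.bind f).probes ans = _
  induction p with
  | done a => rfl
  | ask x i k ih => exact congrArg _ (ih _)

@[simp] theorem eval_forEach (ans : ℕ → ℕ → Option (ℕ × ℕ)) (f : β → ProbeTree α)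
    (l : List β) : (forEach f l).eval ans = l.map fun b => (f b).eval ans := by
  induction l with
  | nil => rfl
  | cons b l ih => simp [forEach, ih]

theorem probes_forEach (ans : ℕ → ℕ → Option (ℕ × ℕ)) (f : β → ProbeTree α) (l : List β) :
    (forEach f l).probes ans = l.flatMap fun b => (f b).probes ans := by
  induction l with
  | nil => rfl
  | cons b l ih => simp [forEach, ih]

theorem eval_simulate (ans : ℕ → ℕ → Option (ℕ × ℕ))
    (h : ℕ → ℕ → ProbeTree (Option (ℕ × ℕ))) (p : ProbeTree α) :
    (p.simulate h).eval ans = p.eval fun x i => (h x i).eval ans := by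
  induction p with
  | done a => rfl
  | ask x i k ih => exact (eval_bind ans (h x i) _).trans (ih _)

theorem probes_simulate (ans : ℕ → ℕ → Option (ℕ × ℕ))
    (h : ℕ → ℕ → ProbeTree (Option (ℕ × ℕ))) (p : ProbeTree α) :
    (p.simulate h).probes ans =
      (p.probes fun x i => (h x i).eval ans).flatMap fun y => (h y.1 y.2).probes ans := by
  induction p with
  | done a => rfl
  | ask x i k ih =>
    refine (probes_bind ans (h x i) _).trans ?_
    rw [ih]
    rfl

/-- A program does not distinguish two answer functions that agree on its probes. -/
theorem eval_probes_congr {ans ans' : ℕ → ℕ → Option (ℕ × ℕ)} (p : ProbeTree α)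
    (h : ∀ y ∈ p.probes ans, ans y.1 y.2 = ans' y.1 y.2) :
    p.eval ans' = p.eval ans ∧ p.probes ans' = p.probes ans := by
  induction p with
  | done a => exact ⟨rfl, rfl⟩
  | ask x i k ih =>
    have h0 : ans x i = ans' x i := h (x, i) (by simp [probes])
    have := ih (ans x i) fun y hy => h y (by simp [probes, hy])
    simp only [eval, probes, ← h0]
    exact ⟨this.1, congrArg _ this.2⟩

variable {G : LabeledGraph} {S T : Set G.V}

theorem ProbesWithin.mono {p : ProbeTree α} (h : p.ProbesWithin G S) (hST : S ⊆ T) :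
    p.ProbesWithin G T := fun y hy =>
  let ⟨w, hw, e⟩ := h y hy
  ⟨w, hST hw, e⟩

theorem probesWithin_pure (a : α) : (pure a : ProbeTree α).ProbesWithin G S := by
  simp [ProbesWithin]

theorem ProbesWithin.bind {p : ProbeTree α} {f : α → ProbeTree β} (hp : p.ProbesWithin G S)
    (hf : (f (p.eval G.answer)).ProbesWithin G S) : (p >>= f).ProbesWithin G S := by
  intro y hy
  rw [probes_bind, List.mem_append] at hy
  exact hy.elim (hp y) (hf y)

theorem ProbesWithin.forEach {f : β → ProbeTree α} {l : List β}
    (h : ∀ b ∈ l, (f b).ProbesWithin G S) : (forEach f l).ProbesWithin G S := by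
  intro y hy
  rw [probes_forEach, List.mem_flatMap] at hy
  obtain ⟨b, hb, hy⟩ := hy
  exact h b hb y hy

end ProbeTree

namespace LabeledGraph

variable {G : LabeledGraph}

theorem answer_id (v : G.V) (i : ℕ) : G.answer (G.id v) i = G.answerAt v i := by
  have h : ∃ w, G.id w = G.id v := ⟨v, rfl⟩
  rw [answer, dif_pos h, G.id_injective h.choose_spec]

/-! ### Balls -/

theorem mem_vertexBall_iff {v w : G.V} {r : ℕ} :
    w ∈ G.vertexBall v r ↔ ∃ p : G.graph.Walk v w, p.length ≤ r := by
  constructor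
  · intro h
    have h : G.graph.edist v w ≤ r := h
    have hr : G.graph.edist v w ≠ ⊤ := ne_top_of_le_ne_top (ENat.natCast_ne_top r) h
    obtain ⟨p, hp⟩ := SimpleGraph.exists_walk_of_edist_ne_top hr
    exact ⟨p, by rw [← hp] at h; exact_mod_cast h⟩
  · rintro ⟨p, hp⟩
    exact (SimpleGraph.Walk.edist_le p).trans (by exact_mod_cast hp)

theorem mem_vertexBall_self (v : G.V) (r : ℕ) : v ∈ G.vertexBall v r :=
  mem_vertexBall_iff.2 ⟨.nil, Nat.zero_le _⟩

theorem mem_vertexBall_of_adj {v w : G.V} (h : G.graph.Adj v w) : w ∈ G.vertexBall v 1 :=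
  mem_vertexBall_iff.2 ⟨.cons h .nil, le_rfl⟩

theorem mem_vertexBall_trans {u v w : G.V} {r s t : ℕ} (h : v ∈ G.vertexBall u r)
    (h' : w ∈ G.vertexBall v s) (hrs : r + s ≤ t) : w ∈ G.vertexBall u t := by
  rw [mem_vertexBall_iff] at *
  obtain ⟨p, hp⟩ := h
  obtain ⟨q, hq⟩ := h'
  exact ⟨p.append q, by rw [SimpleGraph.Walk.length_append]; omega⟩

theorem mem_vertexBall_comm {u v : G.V} {r : ℕ} :
    v ∈ G.vertexBall u r ↔ u ∈ G.vertexBall v r := by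
  change G.graph.edist u v ≤ r ↔ G.graph.edist v u ≤ r
  rw [SimpleGraph.edist_comm]

theorem vertexBall_subset {u v : G.V} {r s t : ℕ} (h : v ∈ G.vertexBall u r) (hrs : r + s ≤ t) :
    G.vertexBall v s ⊆ G.vertexBall u t := fun _ hw => mem_vertexBall_trans h hw hrs

theorem vertexBall_mono {u : G.V} {r s : ℕ} (h : r ≤ s) :
    G.vertexBall u r ⊆ G.vertexBall u s :=
  vertexBall_subset (mem_vertexBall_self u 0) (by omega)

theorem mem_vertexBall_zero {v w : G.V} : w ∈ G.vertexBall v 0 ↔ w = v := by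
  rw [mem_vertexBall_iff]
  constructor
  · rintro ⟨p, hp⟩
    exact (SimpleGraph.Walk.eq_of_length_eq_zero (Nat.le_zero.1 hp)).symm
  · rintro rfl
    exact ⟨.nil, le_rfl⟩

theorem mem_vertexBall_succ {v w : G.V} {r : ℕ} :
    w ∈ G.vertexBall v (r + 1) ↔
      w ∈ G.vertexBall v r ∨ ∃ u ∈ G.vertexBall v r, G.graph.Adj u w := by
  constructor
  · intro h
    obtain ⟨p, hp⟩ := mem_vertexBall_iff.1 h
    rcases Nat.lt_or_ge p.length (r + 1) with h1 | h1
    · exact .inl (mem_vertexBall_iff.2 ⟨p, by omega⟩)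
    · have hn : ¬ p.Nil := by
        rw [← SimpleGraph.Walk.length_eq_zero_iff]
        omega
      refine .inr ⟨p.penultimate, mem_vertexBall_iff.2 ⟨p.dropLast, ?_⟩, p.adj_penultimate hn⟩
      have := p.length_dropLast_add_one hn
      omega
  · rintro (h | ⟨u, hu, h⟩)
    · exact vertexBall_mono (Nat.le_succ r) h
    · exact mem_vertexBall_trans hu (mem_vertexBall_of_adj h) le_rfl

theorem vertexBall_subset_edgeBall {q : Sym2 ℕ} {v : G.V} {r s t : ℕ} (h : v ∈ G.edgeBall q r)
    (hrs : r + s ≤ t) : G.vertexBall v s ⊆ G.edgeBall q t := fun _ hw =>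
  let ⟨u, hu, hv⟩ := h
  ⟨u, hu, mem_vertexBall_trans hv hw hrs⟩

/-! ### Elementary programs on a labeled graph -/

/-- The identifiers of the neighbors of a vertex, in the order of the ports. -/
theorem eval_neighbors (v : G.V) (D : ℕ) (hD : G.graph.degree v ≤ D) :
    (neighbors D (G.id v)).eval G.answer =
      List.ofFn fun j : Fin (G.graph.degree v) => G.id (G.port v j) := by
  have h1 : (neighbors D (G.id v)).eval G.answer =
      ((List.range D).map fun i => G.answerAt v i).filterMap fun r => r.map Prod.fst := by
    simp [neighbors, ProbeTree.eval, answer_id]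
  rw [h1, List.filterMap_map]
  -- Ports from `degree v` on answer null and are dropped by `filterMap`, so probing all `D` ports
  -- is harmless.
  obtain ⟨k, rfl⟩ := Nat.exists_eq_add_of_le hD
  rw [List.range_add, List.filterMap_append]
  have h2 : (List.map (fun x => G.graph.degree v + x) (List.range k)).filterMap
      ((fun r => r.map Prod.fst) ∘ fun i => G.answerAt v i) = [] := by
    rw [List.filterMap_eq_nil_iff]
    intro a ha
    obtain ⟨b, -, rfl⟩ := List.mem_map.1 ha
    simp [answerAt]
  rw [h2, List.append_nil, ← List.map_coe_finRange_eq_range, List.filterMap_map,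
    List.ofFn_eq_map, ← List.filterMap_eq_map]
  refine List.filterMap_congr fun j _ => ?_
  simp [answerAt]

theorem mem_eval_neighbors {v : G.V} {D : ℕ} (hD : G.graph.degree v ≤ D) {y : ℕ} :
    y ∈ (neighbors D (G.id v)).eval G.answer ↔ ∃ u, G.graph.Adj v u ∧ G.id u = y := by
  rw [eval_neighbors v D hD, List.mem_ofFn]
  constructor
  · rintro ⟨j, rfl⟩
    exact ⟨_, (G.port v j).2, rfl⟩
  · rintro ⟨u, hu, rfl⟩
    exact ⟨(G.port v).symm ⟨u, hu⟩, by simp⟩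

theorem neighbors_probesWithin {v : G.V} {D : ℕ} {S : Set G.V} (hv : v ∈ S) :
    (neighbors D (G.id v)).ProbesWithin G S := by
  refine ProbeTree.ProbesWithin.bind (.forEach fun i _ => ?_) (ProbeTree.probesWithin_pure _)
  intro y hy
  simp only [ProbeTree.probes, List.mem_singleton] at hy
  exact ⟨v, hv, by rw [hy]⟩

theorem mem_eval_bfs {Δ : ℕ} (hΔ : ∀ v, G.graph.degree v ≤ Δ) (v : G.V) (d : ℕ) {x : ℕ} :
    x ∈ (bfs Δ d (G.id v)).eval G.answer ↔ ∃ u ∈ G.vertexBall v d, G.id u = x := by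
  induction d generalizing x with
  | zero => simp [bfs, mem_vertexBall_zero, eq_comm]
  | succ d ih =>
    simp only [bfs, ProbeTree.eval_bind, ProbeTree.eval_pure, ProbeTree.eval_forEach,
      Finset.mem_union, List.mem_toFinset, List.mem_flatten, List.mem_map, Finset.mem_sort, ih,
      mem_vertexBall_succ]
    constructor
    · rintro (⟨u, hu, rfl⟩ | ⟨l, ⟨y, ⟨u, hu, rfl⟩, rfl⟩, hx⟩)
      · exact ⟨u, .inl hu, rfl⟩
      · obtain ⟨w, hw, rfl⟩ := (mem_eval_neighbors (hΔ u)).1 hx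
        exact ⟨w, .inr ⟨u, hu, hw⟩, rfl⟩
    · rintro ⟨w, hw | ⟨u, hu, hw⟩, rfl⟩
      · exact .inl ⟨w, hw, rfl⟩
      · exact .inr ⟨_, ⟨_, ⟨u, hu, rfl⟩, rfl⟩, (mem_eval_neighbors (hΔ u)).2 ⟨w, hw, rfl⟩⟩

theorem bfs_probesWithin {Δ : ℕ} (hΔ : ∀ v, G.graph.degree v ≤ Δ) (v : G.V) (d : ℕ) :
    (bfs Δ d (G.id v)).ProbesWithin G (G.vertexBall v d) := by
  induction d with
  | zero => exact ProbeTree.probesWithin_pure _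
  | succ d ih =>
    refine .bind (ih.mono (vertexBall_mono (Nat.le_succ d)))
      (.bind (.forEach fun x hx => ?_) (ProbeTree.probesWithin_pure _))
    rw [Finset.mem_sort, mem_eval_bfs hΔ] at hx
    obtain ⟨u, hu, rfl⟩ := hx
    exact neighbors_probesWithin (vertexBall_mono (Nat.le_succ d) hu)

end LabeledGraph

set_option linter.unusedSectionVars false

/-! ### Matchings and augmenting paths -/

section Matchings

variable {α : Type*} [DecidableEq α]

/-- A matching: a set of proper edges no two of which share an endpoint. -/
def IsEdgeMatching (M : Finset (Sym2 α)) : Prop :=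
  (∀ e ∈ M, ¬ e.IsDiag) ∧ ∀ e ∈ M, ∀ f ∈ M, ∀ v, v ∈ e → v ∈ f → e = f

/-- The vertices that are covered by a set of edges. -/
def covered (M : Finset (Sym2 α)) : Finset α := M.biUnion Sym2.toFinset

theorem mem_covered {M : Finset (Sym2 α)} {v : α} : v ∈ covered M ↔ ∃ e ∈ M, v ∈ e := by
  simp [covered]

theorem IsEdgeMatching.subset {M N : Finset (Sym2 α)} (hM : IsEdgeMatching M) (h : N ⊆ M) :
    IsEdgeMatching N :=
  ⟨fun e he => hM.1 e (h he), fun e he f hf => hM.2 e (h he) f (h hf)⟩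

theorem IsEdgeMatching.card_covered {M : Finset (Sym2 α)} (hM : IsEdgeMatching M) :
    (covered M).card = 2 * M.card := by
  rw [covered, Finset.card_biUnion, Finset.sum_congr rfl fun e he =>
    Sym2.card_toFinset_of_not_isDiag e (hM.1 e he), Finset.sum_const, smul_eq_mul, mul_comm]
  intro e he f hf hne
  rw [Function.onFun, Finset.disjoint_left]
  intro v hv hv'
  exact hne (hM.2 e he f hf v (Sym2.mem_toFinset.1 hv) (Sym2.mem_toFinset.1 hv'))

open Classical in
/-- The other endpoint of the edge of `M` at `v`, or `v` itself if there is no such edge. -/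
noncomputable def partner (M : Finset (Sym2 α)) (v : α) : α :=
  if h : ∃ w, s(v, w) ∈ M then h.choose else v

theorem IsEdgeMatching.partner_eq {M : Finset (Sym2 α)} (hM : IsEdgeMatching M) {v w : α}
    (h : s(v, w) ∈ M) : partner M v = w := by
  have h' : ∃ w, s(v, w) ∈ M := ⟨w, h⟩
  rw [partner, dif_pos h']
  have := hM.2 _ h'.choose_spec _ h v (Sym2.mem_mk_left _ _) (Sym2.mem_mk_left _ _)
  exact Sym2.congr_right.1 this

theorem partner_ne_iff_mem {M : Finset (Sym2 α)} (hM : IsEdgeMatching M) {v : α} :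
    partner M v ≠ v ↔ s(v, partner M v) ∈ M := by
  constructor
  · intro h
    by_cases h' : ∃ w, s(v, w) ∈ M
    · rw [partner, dif_pos h']
      exact h'.choose_spec
    · exact absurd (dif_neg h') h
  · intro h h'
    exact hM.1 _ h (Sym2.mk_isDiag_iff.2 h'.symm)

theorem partner_ne_iff {M : Finset (Sym2 α)} (hM : IsEdgeMatching M) {v : α} :
    partner M v ≠ v ↔ v ∈ covered M := by
  rw [mem_covered]
  constructor
  · intro h
    exact ⟨_, (partner_ne_iff_mem hM).1 h, Sym2.mem_mk_left _ _⟩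
  · rintro ⟨e, he, w, rfl⟩
    rw [hM.partner_eq he]
    rintro rfl
    exact hM.1 _ he (Sym2.mk_isDiag_iff.2 rfl)

theorem partner_involutive {M : Finset (Sym2 α)} (hM : IsEdgeMatching M) :
    Function.Involutive (partner M) := by
  intro v
  by_cases h : partner M v = v
  · rw [h, h]
  · refine hM.partner_eq ?_
    rw [Sym2.eq_swap]
    exact (partner_ne_iff_mem hM).1 h

/-- This expresses the two halves of the symmetric difference through the involutions `partner M`
and `partner N` alone, in the form counted by `involution_count`. -/
theorem mem_covered_sdiff {M N : Finset (Sym2 α)} (hM : IsEdgeMatching M)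
    (hN : IsEdgeMatching N) {v : α} :
    v ∈ covered (N \ M) ↔ partner N v ≠ v ∧ partner M v ≠ partner N v := by
  rw [mem_covered]
  constructor
  · rintro ⟨e, he, w, rfl⟩
    rw [Finset.mem_sdiff] at he
    rw [hN.partner_eq he.1]
    refine ⟨?_, ?_⟩
    · rintro rfl
      exact hN.1 _ he.1 (Sym2.mk_isDiag_iff.2 rfl)
    · rintro rfl
      refine he.2 ((partner_ne_iff_mem hM).1 fun h => ?_)
      rw [h] at he
      exact hN.1 _ he.1 (Sym2.mk_isDiag_iff.2 rfl)
  · rintro ⟨h1, h2⟩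
    refine ⟨_, Finset.mem_sdiff.2 ⟨(partner_ne_iff_mem hN).1 h1, fun h => ?_⟩,
      Sym2.mem_mk_left _ _⟩
    exact h2 (hM.partner_eq h)

/-! #### Alternating orbits of two involutions -/

/-- The walk that starts in `x` and alternately applies `n` and `m`. -/
def altWalk (m n : α → α) (x : α) : ℕ → α
  | 0 => x
  | j + 1 => if Even j then n (altWalk m n x j) else m (altWalk m n x j)

section AltWalk

variable {m n : α → α} {x : α} {t : ℕ}

theorem altWalk_succ_even {j : ℕ} (h : Even j) :
    altWalk m n x (j + 1) = n (altWalk m n x j) := if_pos h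

theorem altWalk_succ_odd {j : ℕ} (h : ¬ Even j) :
    altWalk m n x (j + 1) = m (altWalk m n x j) := if_neg h

/-- A coincidence of two positions can be pulled back. If both were reached by the same involution,
it cancels and both indices drop by one; otherwise applying the last involution to the earlier
position moves the two indices towards each other. The process ends in a stationary step, or at the
start, where `m x = x` again makes a step stationary. -/
theorem altWalk_injOn (hm : Function.Involutive m) (hn : Function.Involutive n) (hx : m x = x) (ht : ∀ j < t, altWalk m n x (j + 1) ≠ altWalk m n x j) :
    ∀ a b, a < b → b ≤ t → altWalk m n x a ≠ altWalk m n x b := by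
  intro a b
  induction b generalizing a with
  | zero => intro h; omega
  | succ b ih =>
    intro hab hbt heq
    have hbt' : b < t := hbt
    have hstep := ht b hbt'
    by_cases hb : Even b
    · rw [altWalk_succ_even hb] at heq hstep
      by_cases ha : Even a
      · have h1 : altWalk m n x (a + 1) = altWalk m n x b := by
          rw [altWalk_succ_even ha, heq, hn]
        rcases Nat.lt_trichotomy (a + 1) b with h | h | h
        · exact ih _ h (by omega) h1
        · rw [← h] at hb
          exact (Nat.even_add_one.1 hb) ha
        · have : a = b := by omega
          subst this
          exact hstep heq.symm
      · obtain ⟨c, rfl⟩ : ∃ c, a = c + 1 := ⟨a - 1, by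
          have : a ≠ 0 := by rintro rfl; exact ha Even.zero
          omega⟩
        have hc : Even c := by
          by_contra hc
          exact ha (Nat.even_add_one.2 hc)
        rw [altWalk_succ_even hc] at heq
        exact ih c (by omega) (by omega) (hn.injective heq)
    · rw [altWalk_succ_odd hb] at heq hstep
      by_cases ha : Even a
      · rcases Nat.eq_zero_or_pos a with rfl | h0
        · have h1 : altWalk m n x b = x := by
            have : x = m (altWalk m n x b) := heq
            rw [← hm (altWalk m n x b), ← this, hx]
          rw [h1, hx] at hstep
          exact hstep rfl
        · obtain ⟨c, rfl⟩ : ∃ c, a = c + 1 := ⟨a - 1, by omega⟩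
          have hc : ¬ Even c := Nat.even_add_one.1 ha
          rw [altWalk_succ_odd hc] at heq
          exact ih c (by omega) (by omega) (hm.injective heq)
      · have h1 : altWalk m n x (a + 1) = altWalk m n x b := by
          rw [altWalk_succ_odd ha, heq, hm]
        rcases Nat.lt_trichotomy (a + 1) b with h | h | h
        · exact ih _ h (by omega) h1
        · rw [← h] at hb
          exact hb (Nat.even_add_one.2 ha)
        · have : a = b := by omega
          subst this
          exact hstep heq.symm

/-- Inside a finite invariant set, an alternating walk from a fixed point of `m` comes to an
end. -/
theorem exists_altWalk_end (W : Finset α) (hmW : ∀ v ∈ W, m v ∈ W) (hnW : ∀ v ∈ W, n v ∈ W)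
    (hm : Function.Involutive m) (hn : Function.Involutive n) (hxW : x ∈ W) (hx : m x = x) :
    ∃ t, altWalk m n x (t + 1) = altWalk m n x t ∧
      ∀ j < t, altWalk m n x (j + 1) ≠ altWalk m n x j := by
  classical
  have hW : ∀ j, altWalk m n x j ∈ W := by
    intro j
    induction j with
    | zero => exact hxW
    | succ j ih =>
      rw [altWalk]
      split_ifs
      exacts [hnW _ ih, hmW _ ih]
  have hex : ∃ t, altWalk m n x (t + 1) = altWalk m n x t := by
    by_contra! h
    have hinj : Function.Injective fun j : ℕ => (⟨altWalk m n x j, hW j⟩ : W) := by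
      intro a b hab
      have hab : altWalk m n x a = altWalk m n x b := congrArg Subtype.val hab
      rcases Nat.lt_trichotomy a b with h1 | h1 | h1
      · exact absurd hab (altWalk_injOn hm hn hx (t := b) (fun j _ => h j) a b h1 le_rfl)
      · exact h1
      · exact absurd hab.symm (altWalk_injOn hm hn hx (t := a) (fun j _ => h j) b a h1 le_rfl)
    exact not_injective_infinite_finite _ hinj
  exact ⟨Nat.find hex, Nat.find_spec hex, fun j hj => Nat.find_min hex hj⟩

end AltWalk

/-- The weighted count behind the lower bound for the symmetric difference of two matchings. -/
theorem involution_count (m n : α → α) (hm : Function.Involutive m) (hn : Function.Involutive n)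
    (l : ℕ)
    (hl : ∀ x t, m x = x → Odd t → m (altWalk m n x t) = altWalk m n x t →
      (∀ a b, a < b → b ≤ t → altWalk m n x a ≠ altWalk m n x b) → l ≤ t)
    (W : Finset α) (hmW : ∀ v ∈ W, m v ∈ W) (hnW : ∀ v ∈ W, n v ∈ W) :
    (l : ℤ) * ∑ v ∈ W, ((if n v ≠ v then 1 else 0) - (if m v ≠ v then 1 else 0)) ≤
      ∑ v ∈ W, ((if n v ≠ v ∧ m v ≠ n v then 1 else 0) +
        (if m v ≠ v ∧ n v ≠ m v then 1 else 0)) := by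
  induction W using Finset.strongInduction with
  | H W ih =>
    by_cases hx : ∃ x ∈ W, m x = x ∧ n x ≠ x
    swap
    · push Not at hx
      -- Without such an `x`, every vertex moved by `n` is moved by `m`, so no summand on the left
      -- is positive.
      refine le_trans (b := 0) (mul_nonpos_of_nonneg_of_nonpos (by positivity)
        (Finset.sum_nonpos fun v hv => ?_)) (Finset.sum_nonneg fun v _ => by positivity)
      have := hx v hv
      by_cases h1 : m v = v
      · simp [this h1, h1]
      · simp only [ne_eq, h1, not_false_eq_true, if_true]
        split_ifs <;> simp
    obtain ⟨x, hxW, hx, hnx⟩ := hx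
    -- The alternating walk from `x`, followed until it stops, is cut off. Its vertex set `U` is
    -- invariant under both involutions, so the induction hypothesis applies to `W \ U`, and only
    -- the contribution of `U` remains.
    obtain ⟨t, hend, hne⟩ := exists_altWalk_end W hmW hnW hm hn hxW hx
    have hinj := altWalk_injOn hm hn hx hne
    set y := altWalk m n x with hy
    have ht0 : 0 < t := by
      rcases Nat.eq_zero_or_pos t with rfl | h
      · exact absurd hend hnx
      · exact h
    -- values of the involutions on the walk
    have hyn : ∀ j, Even j → n (y j) = y (j + 1) := fun j h => (altWalk_succ_even h).symm
    have hym : ∀ j, ¬ Even j → m (y j) = y (j + 1) := fun j h => (altWalk_succ_odd h).symm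
    have hyn' : ∀ j, Even j → n (y (j + 1)) = y j := fun j h => by rw [← hyn j h, hn]
    have hym' : ∀ j, ¬ Even j → m (y (j + 1)) = y j := fun j h => by rw [← hym j h, hm]
    let U : Finset α := (Finset.range (t + 1)).image y
    have hUinj : Set.InjOn y (Finset.range (t + 1)) := by
      intro a ha b hb hab
      have ha' := Finset.mem_range.1 ha
      have hb' := Finset.mem_range.1 hb
      rcases Nat.lt_trichotomy a b with h1 | h1 | h1
      · exact absurd hab (hinj a b h1 (by omega))
      · exact h1
      · exact absurd hab.symm (hinj b a h1 (by omega))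
    have hyW : ∀ j, y j ∈ W := by
      intro j
      induction j with
      | zero => exact hxW
      | succ j ih =>
        rw [hy, altWalk]
        split_ifs
        exacts [hnW _ ih, hmW _ ih]
    have hmemU : ∀ j, j ≤ t + 1 → y j ∈ U := by
      intro j hj
      rcases Nat.lt_or_ge j (t + 1) with h | h
      · exact Finset.mem_image_of_mem _ (Finset.mem_range.2 h)
      · have : j = t + 1 := by omega
        rw [this, hend]
        exact Finset.mem_image_of_mem _ (Finset.mem_range.2 (by omega))
    have hUW : U ⊆ W := by
      intro v hv
      obtain ⟨j, -, rfl⟩ := Finset.mem_image.1 hv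
      exact hyW j
    have hmU : ∀ v ∈ U, m v ∈ U := by
      intro v hv
      obtain ⟨j, hj, rfl⟩ := Finset.mem_image.1 hv
      have hj := Finset.mem_range.1 hj
      by_cases h : Even j
      · rcases Nat.eq_zero_or_pos j with rfl | h0
        · rw [show m (y 0) = y 0 from hx]
          exact hmemU 0 (by omega)
        · obtain ⟨c, rfl⟩ : ∃ c, j = c + 1 := ⟨j - 1, by omega⟩
          rw [hym' c (Nat.even_add_one.1 h)]
          exact hmemU c (by omega)
      · rw [hym j h]
        exact hmemU _ (by omega)
    have hnU : ∀ v ∈ U, n v ∈ U := by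
      intro v hv
      obtain ⟨j, hj, rfl⟩ := Finset.mem_image.1 hv
      have hj := Finset.mem_range.1 hj
      by_cases h : Even j
      · rw [hyn j h]
        exact hmemU _ (by omega)
      · obtain ⟨c, rfl⟩ : ∃ c, j = c + 1 := ⟨j - 1, by
          have : j ≠ 0 := by rintro rfl; exact h Even.zero
          omega⟩
        have hc : Even c := by
          by_contra hc
          exact h (Nat.even_add_one.2 hc)
        rw [hyn' c hc]
        exact hmemU c (by omega)
    have hxU : x ∈ U := hmemU 0 (by omega)
    have hind := ih (W \ U) ⟨Finset.sdiff_subset, fun h => by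
        have := h hxW
        simp [hxU] at this⟩
      (fun v hv => by
        rw [Finset.mem_sdiff] at hv ⊢
        exact ⟨hmW v hv.1, fun h => hv.2 (by simpa [hm v] using hmU _ h)⟩)
      (fun v hv => by
        rw [Finset.mem_sdiff] at hv ⊢
        exact ⟨hnW v hv.1, fun h => hv.2 (by simpa [hn v] using hnU _ h)⟩)
    rw [← Finset.sum_sdiff hUW, ← Finset.sum_sdiff hUW, mul_add]
    refine add_le_add hind ?_
    rw [Finset.sum_image hUinj, Finset.sum_image hUinj]
    obtain ⟨s, rfl⟩ : ∃ s, t = s + 1 := ⟨t - 1, by omega⟩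
    rw [Finset.sum_range_succ, Finset.sum_range_succ', Finset.sum_range_succ,
      Finset.sum_range_succ']
    have h01 : y 0 ≠ y 1 := hinj 0 1 (by omega) (by omega)
    have hn0 : n (y 0) = y 1 := hyn 0 Even.zero
    have hm0 : m (y 0) = y 0 := hx
    have hss : y s ≠ y (s + 1) := hinj _ _ (by omega) le_rfl
    -- An interior vertex of the walk is moved by both involutions, to different places: it
    -- contributes 0 on the left and 2 on the right.
    have hint1 : ∀ j ∈ Finset.range s, ((if n (y (j + 1)) ≠ y (j + 1) then (1 : ℤ) else 0) -
        (if m (y (j + 1)) ≠ y (j + 1) then 1 else 0)) = 0 := by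
      intro j hj
      have hj := Finset.mem_range.1 hj
      have e1 := hinj j (j + 1) (by omega) (by omega)
      have e2 := hinj (j + 1) (j + 1 + 1) (by omega) (by omega)
      by_cases h : Even j
      · rw [hyn' j h, hym (j + 1) (fun h' => (Nat.even_add_one.1 h') h)]
        simp [e1, e2.symm]
      · rw [hym' j h, hyn (j + 1) (Nat.even_add_one.2 h)]
        simp [e1, e2.symm]
    have hint2 : ∀ j ∈ Finset.range s,
        ((if n (y (j + 1)) ≠ y (j + 1) ∧ m (y (j + 1)) ≠ n (y (j + 1)) then (1 : ℤ) else 0) +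
        (if m (y (j + 1)) ≠ y (j + 1) ∧ n (y (j + 1)) ≠ m (y (j + 1)) then 1 else 0)) = 2 := by
      intro j hj
      have hj := Finset.mem_range.1 hj
      have e1 := hinj j (j + 1) (by omega) (by omega)
      have e2 := hinj (j + 1) (j + 1 + 1) (by omega) (by omega)
      have e3 := hinj j (j + 1 + 1) (by omega) (by omega)
      by_cases h : Even j
      · rw [hyn' j h, hym (j + 1) (fun h' => (Nat.even_add_one.1 h') h)]
        simp [e1, e2.symm, e3, e3.symm]
      · rw [hym' j h, hyn (j + 1) (Nat.even_add_one.2 h)]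
        simp [e1, e2.symm, e3, e3.symm]
    rw [Finset.sum_congr rfl hint1, Finset.sum_congr rfl hint2]
    rw [hn0, hm0]
    -- For even `s` the last move was by `n` and the walk ends in a fixed point of `m`: the sums are
    -- `2` and `2 (s + 1)`, and `hl` bounds `l` by the length. For odd `s` the end is moved by `m`
    -- only, so the two ends cancel on the left.
    by_cases h : Even s
    · have hmt : m (y (s + 1)) = y (s + 1) := by
        rw [hym (s + 1) (fun h' => (Nat.even_add_one.1 h') h)]
        exact hend
      have := hl x (s + 1) hx h.add_one hmt hinj
      rw [hmt, hyn' s h]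
      simp only [Finset.sum_const, ne_eq, h01.symm, h01, hss, hss.symm, not_false_eq_true]
      simp
      zify at this
      linarith
    · have hnt : n (y (s + 1)) = y (s + 1) := by
        rw [hyn (s + 1) (Nat.even_add_one.2 h)]
        exact hend
      rw [hnt, hym' s h]
      simp only [Finset.sum_const, ne_eq, h01.symm, h01, hss, hss.symm, not_false_eq_true]
      simp
      positivity

end Matchings

/-! ### Augmenting paths as lists of vertices -/

theorem pathEdges_cons_cons (x y : ℕ) (l : List ℕ) :
    pathEdges (x :: y :: l) = s(x, y) :: pathEdges (y :: l) := rfl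

theorem length_pathEdges (p : List ℕ) : (pathEdges p).length = p.length - 1 := by
  simp [pathEdges]

theorem mem_of_mem_pathEdges {p : List ℕ} {e : Sym2 ℕ} (he : e ∈ pathEdges p) {v : ℕ}
    (hv : v ∈ e) : v ∈ p := by
  induction p with
  | nil => simp [pathEdges] at he
  | cons x l ih =>
    cases l with
    | nil => simp [pathEdges] at he
    | cons y l =>
      rw [pathEdges_cons_cons, List.mem_cons] at he
      rcases he with rfl | he
      · rcases Sym2.mem_iff.1 hv with rfl | rfl <;> simp
      · exact List.mem_cons_of_mem _ (ih he)

/-- The alternation condition on consecutive edges. -/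
def Alternates (M : Finset (Sym2 ℕ)) (p : List ℕ) : Prop :=
  (pathEdges p).IsChain fun e f => e ∈ M ↔ f ∉ M

theorem Alternates.congr {M M' : Finset (Sym2 ℕ)} {p : List ℕ} (h : Alternates M p)
    (hMM' : ∀ e ∈ pathEdges p, (e ∈ M ↔ e ∈ M')) : Alternates M' p :=
  List.IsChain.imp_of_mem_imp (fun a b ha hb hab => by
    rw [← hMM' a ha, ← hMM' b hb]; exact hab) h

/-- The interior vertices of an alternating path are covered by edges of the path. -/
theorem Alternates.exists_mem {M : Finset (Sym2 ℕ)} {p : List ℕ} (h : Alternates M p) {v : ℕ}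
    (hv : v ∈ p) (hh : v ∉ p.head?) (hl : v ∉ p.getLast?) : ∃ e ∈ pathEdges p, e ∈ M ∧ v ∈ e := by
  induction p with
  | nil => simp at hv
  | cons x l ih =>
    cases l with
    | nil => simp_all
    | cons y l =>
      rcases List.mem_cons.1 hv with rfl | hv
      · simp at hh
      cases l with
      | nil => simp_all
      | cons z l =>
        rw [Alternates, pathEdges_cons_cons, pathEdges_cons_cons, List.isChain_cons_cons] at h
        by_cases hvy : v = y
        · subst hvy
          by_cases h1 : s(x, v) ∈ M
          · exact ⟨_, List.mem_cons_self, h1, Sym2.mem_mk_right _ _⟩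
          · exact ⟨s(v, z), by simp [pathEdges_cons_cons], by tauto, Sym2.mem_mk_left _ _⟩
        · obtain ⟨e, he, h2⟩ := ih h.2 hv (by simpa using Ne.symm hvy) (by simpa using hl)
          exact ⟨e, List.mem_cons_of_mem _ he, h2⟩

/-- An augmenting path that is listed in either direction. -/
structure IsAugPath (E M : Finset (Sym2 ℕ)) (p : List ℕ) : Prop where
  two_le : 2 ≤ p.length
  nodup : p.Nodup
  edges : ∀ e ∈ pathEdges p, e ∈ E
  alternates : Alternates M p
  head : ∀ x ∈ p.head?, ∀ e ∈ M, x ∉ e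
  last : ∀ x ∈ p.getLast?, ∀ e ∈ M, x ∉ e

/-- All conditions on the matching concern edges at vertices of the path. This transfers a path
between matchings that differ only away from it. -/
theorem IsAugPath.congr {E M M' : Finset (Sym2 ℕ)} {p : List ℕ} (h : IsAugPath E M p)
    (hMM' : ∀ v ∈ p, ∀ e, v ∈ e → (e ∈ M ↔ e ∈ M')) : IsAugPath E M' p where
  two_le := h.two_le
  nodup := h.nodup
  edges := h.edges
  alternates := h.alternates.congr fun e he => by
    induction e with
    | h x y => exact hMM' x (mem_of_mem_pathEdges he (Sym2.mem_mk_left _ _)) _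
                (Sym2.mem_mk_left _ _)
  head := fun x hx e he hxe =>
    h.head x hx e ((hMM' x (List.mem_of_mem_head? hx) e hxe).2 he) hxe
  last := fun x hx e he hxe =>
    h.last x hx e ((hMM' x (List.mem_of_mem_getLast? hx) e hxe).2 he) hxe

theorem pathEdges_reverse (p : List ℕ) : pathEdges p.reverse = (pathEdges p).reverse := by
  have h : ∀ (q : List ℕ) (x y : ℕ),
      pathEdges (q ++ [x, y]) = pathEdges (q ++ [x]) ++ [s(x, y)] := by
    intro q x y
    induction q with
    | nil => rfl
    | cons z q ih =>
      cases q with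
      | nil => rfl
      | cons w q => exact congrArg (s(z, w) :: ·) ih
  induction p with
  | nil => rfl
  | cons x l ih =>
    cases l with
    | nil => rfl
    | cons y l =>
      have : (x :: y :: l).reverse = l.reverse ++ [y, x] := by simp
      rw [this, h, ← List.reverse_cons, ih, Sym2.eq_swap, pathEdges_cons_cons, List.reverse_cons]

theorem IsAugPath.reverse {E M : Finset (Sym2 ℕ)} {p : List ℕ} (h : IsAugPath E M p) :
    IsAugPath E M p.reverse where
  two_le := by simpa using h.two_le
  nodup := List.nodup_reverse.2 h.nodup
  edges := fun e he => h.edges e (by simpa [pathEdges_reverse] using he)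
  alternates := by
    rw [Alternates, pathEdges_reverse, List.isChain_reverse]
    exact h.alternates.imp fun a b hab => by tauto
  head := fun x hx => h.last x (by simpa using hx)
  last := fun x hx => h.head x (by simpa using hx)

/-- Augmenting a matching along a single path. -/
theorem IsAugPath.augment {E M : Finset (Sym2 ℕ)} (hM : IsEdgeMatching M) {p : List ℕ}
    (hp : IsAugPath E M p) :
    IsEdgeMatching (symmDiff M (pathEdges p).toFinset) ∧
      (symmDiff M (pathEdges p).toFinset).card = M.card + 1 ∧
      (∀ v ∈ p, ∃ f ∈ pathEdges p, f ∉ M ∧ v ∈ f) ∧ Even p.length := by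
  induction hk : p.length using Nat.strong_induction_on generalizing M p with
  | h k ih =>
    subst hk
    match p, hp with
    | [], hp => exact absurd hp.two_le (by simp)
    | [x], hp => exact absurd hp.two_le (by simp)
    | [x, y], hp =>
      have hx := hp.head x (by simp)
      have hy := hp.last y (by simp)
      have hxy : x ≠ y := by simpa using hp.nodup
      have hxyM : s(x, y) ∉ M := fun h => hx _ h (Sym2.mem_mk_left _ _)
      have he : symmDiff M (pathEdges [x, y]).toFinset = insert s(x, y) M := by
        ext e
        simp only [pathEdges, List.tail_cons, List.zipWith_cons_cons, List.zipWith_nil_right,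
          List.toFinset_cons, List.toFinset_nil, insert_empty_eq, Finset.mem_symmDiff,
          Finset.mem_singleton, Finset.mem_insert]
        constructor
        · tauto
        · rintro (rfl | h)
          · exact .inr ⟨rfl, hxyM⟩
          · exact .inl ⟨h, fun h' => hxyM (h' ▸ h)⟩
      rw [he]
      refine ⟨⟨?_, ?_⟩, Finset.card_insert_of_notMem hxyM, ?_, by simp⟩
      · intro e he
        rcases Finset.mem_insert.1 he with rfl | he
        · simpa using hxy
        · exact hM.1 e he
      · intro e he f hf v hve hvf
        rcases Finset.mem_insert.1 he with rfl | he' <;>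
          rcases Finset.mem_insert.1 hf with rfl | hf'
        · rfl
        · rcases Sym2.mem_iff.1 hve with rfl | rfl
          exacts [absurd hvf (hx f hf'), absurd hvf (hy f hf')]
        · rcases Sym2.mem_iff.1 hvf with rfl | rfl
          exacts [absurd hve (hx e he'), absurd hve (hy e he')]
        · exact hM.2 e he' f hf' v hve hvf
      · intro v hv
        exact ⟨s(x, y), by simp [pathEdges], hxyM, by simpa using hv⟩
    | x :: y :: z :: rest, hp =>
      have hx := hp.head x (by simp)
      have halt := hp.alternates
      rw [Alternates, pathEdges_cons_cons, pathEdges_cons_cons, List.isChain_cons_cons] at halt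
      have hxyM : s(x, y) ∉ M := fun h => hx _ h (Sym2.mem_mk_left _ _)
      have hyzM : s(y, z) ∈ M := by
        by_contra h
        exact hxyM (halt.1.2 h)
      have hnd := hp.nodup
      simp only [List.nodup_cons, List.mem_cons, not_or] at hnd
      obtain ⟨⟨hxy, hxz, hxr⟩, ⟨hyz, hyr⟩, hzr, hr⟩ := hnd
      set E' := pathEdges (z :: rest) with hE'
      have hxE' : ∀ e ∈ E', x ∉ e := fun e he hxe => by
        have := mem_of_mem_pathEdges he hxe
        simp_all
      have hyE' : ∀ e ∈ E', y ∉ e := fun e he hxe => by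
        have := mem_of_mem_pathEdges he hxe
        simp_all
      -- Exchanging `s(y, z)` for `s(x, y)` gives a matching of the same size in which `z` is free.
      -- Then `z :: rest` is augmenting for it, has two vertices fewer, and leads to the same
      -- symmetric difference.
      set M2 := insert s(x, y) (M.erase s(y, z)) with hM2
      have hyM : ∀ e ∈ M, y ∈ e → e = s(y, z) := fun e he hye =>
        hM.2 e he _ hyzM y hye (Sym2.mem_mk_left _ _)
      have hzM : ∀ e ∈ M, z ∈ e → e = s(y, z) := fun e he hye =>
        hM.2 e he _ hyzM z hye (Sym2.mem_mk_right _ _)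
      have hM2m : IsEdgeMatching M2 := by
        have hcross : ∀ e ∈ M.erase s(y, z), ∀ v ∈ e, v ∉ s(x, y) := by
          intro e he v hve hv
          rw [Finset.mem_erase] at he
          rcases Sym2.mem_iff.1 hv with rfl | rfl
          · exact hx e he.2 hve
          · exact he.1 (hyM e he.2 hve)
        refine ⟨?_, ?_⟩
        · intro e he
          rcases Finset.mem_insert.1 he with rfl | he
          · simpa using hxy
          · exact hM.1 e (Finset.mem_of_mem_erase he)
        · intro e he f hf v hve hvf
          rcases Finset.mem_insert.1 he with rfl | he <;>
            rcases Finset.mem_insert.1 hf with rfl | hf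
          · rfl
          · exact absurd hve (hcross f hf v hvf)
          · exact absurd hvf (hcross e he v hve)
          · exact hM.2 e (Finset.mem_of_mem_erase he) f (Finset.mem_of_mem_erase hf) v hve hvf
      have hM2c : M2.card = M.card := by
        rw [hM2, Finset.card_insert_of_notMem (fun h => hxyM (Finset.mem_of_mem_erase h)),
          Finset.card_erase_add_one hyzM]
      have hE'M : ∀ e ∈ E', (e ∈ M ↔ e ∈ M2) := by
        intro e he
        have h1 : e ≠ s(x, y) := fun h => hxE' e he (h ▸ Sym2.mem_mk_left _ _)
        have h2 : e ≠ s(y, z) := fun h => hyE' e he (h ▸ Sym2.mem_mk_left _ _)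
        simp [hM2, h1, h2]
      have hrest : rest ≠ [] := by
        rintro rfl
        exact hp.last z (by simp) _ hyzM (Sym2.mem_mk_right _ _)
      have hp2 : IsAugPath E M2 (z :: rest) := by
        refine ⟨?_, ?_, ?_, ?_, ?_, ?_⟩
        · have := List.length_pos_iff.2 hrest
          simp only [List.length_cons]
          omega
        · exact List.nodup_cons.2 ⟨hzr, hr⟩
        · intro e he
          exact hp.edges e (List.mem_cons_of_mem _ (List.mem_cons_of_mem _ he))
        · exact Alternates.congr halt.2.tail hE'M
        · intro v hv e he hve
          obtain rfl : z = v := by simpa using hv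
          rcases Finset.mem_insert.1 he with rfl | he
          · rcases Sym2.mem_iff.1 hve with h | h
            exacts [hxz h.symm, hyz h.symm]
          · rw [Finset.mem_erase] at he
            exact he.1 (hzM e he.2 hve)
        · intro v hv e he hve
          have hv' : v ∈ z :: rest := List.mem_of_mem_getLast? hv
          rcases Finset.mem_insert.1 he with rfl | he
          · rcases Sym2.mem_iff.1 hve with rfl | rfl
            · exact (List.mem_cons.1 hv').elim hxz hxr
            · exact (List.mem_cons.1 hv').elim hyz hyr
          · exact hp.last v (by simpa using hv) e (Finset.mem_of_mem_erase he) hve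
      obtain ⟨h1, h2, h3, h4⟩ := ih (z :: rest).length (by simp) hM2m hp2 rfl
      have hsd : symmDiff M (pathEdges (x :: y :: z :: rest)).toFinset =
          symmDiff M2 (pathEdges (z :: rest)).toFinset := by
        ext e
        rw [pathEdges_cons_cons, pathEdges_cons_cons, ← hE']
        simp only [Finset.mem_symmDiff, List.mem_toFinset, List.mem_cons, hM2, Finset.mem_insert,
          Finset.mem_erase]
        have a1 : s(x, y) ∉ E' := fun h => hxE' _ h (Sym2.mem_mk_left _ _)
        have a2 : s(y, z) ∉ E' := fun h => hyE' _ h (Sym2.mem_mk_left _ _)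
        have a3 : s(x, y) ≠ s(y, z) := fun h => hxyM (h ▸ hyzM)
        by_cases e1 : e = s(x, y)
        · subst e1
          simp [a1, hxyM]
        · by_cases e2 : e = s(y, z)
          · subst e2
            simp [a2, hyzM, e1]
          · simp [e1, e2]
      rw [hsd]
      refine ⟨h1, by rw [h2, hM2c], ?_, ?_⟩
      · intro v hv
        by_cases hvz : v ∈ z :: rest
        · obtain ⟨f, hf, hfM, hvf⟩ := h3 v hvz
          exact ⟨f, List.mem_cons_of_mem _ (List.mem_cons_of_mem _ hf),
            fun h => hfM ((hE'M f hf).1 h), hvf⟩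
        · refine ⟨s(x, y), by simp [pathEdges_cons_cons], hxyM, ?_⟩
          rw [List.mem_cons, List.mem_cons] at hv
          rw [Sym2.mem_iff]
          tauto
      · simp only [List.length_cons] at h4 ⊢
        rw [Nat.even_add_one, Nat.even_add_one, not_not]
        exact h4

theorem IsAugPath.symmDiff_subset {E M : Finset (Sym2 ℕ)} {p : List ℕ} (hp : IsAugPath E M p)
    (hME : M ⊆ E) : symmDiff M (pathEdges p).toFinset ⊆ E := by
  intro e he
  rw [Finset.mem_symmDiff, List.mem_toFinset] at he
  exact he.elim (fun h => hME h.1) fun h => hp.edges e h.1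

/-- If all paths that are `M`-augmenting have more than `l` vertices, then the symmetric
difference of `M` with a larger matching `N` is large. -/
theorem card_symmDiff_lower_bound {E M N : Finset (Sym2 ℕ)} (hM : IsEdgeMatching M)
    (hN : IsEdgeMatching N) (hME : M ⊆ E) (hNE : N ⊆ E) {l : ℕ}
    (hl : ∀ p, IsAugPath E M p → l + 1 ≤ p.length) :
    l * N.card ≤ l * M.card + ((M \ N).card + (N \ M).card) := by
  have hm := partner_involutive hM
  have hn := partner_involutive hN
  -- Summed over all covered vertices, each indicator counts the endpoints of a matching, i.e. twice
  -- its edges, so the factor 2 cancels.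
  have key := involution_count (partner M) (partner N) hm hn l ?_ (covered M ∪ covered N) ?_ ?_
  · rw [Finset.sum_sub_distrib, Finset.sum_add_distrib] at key
    simp only [Finset.sum_boole] at key
    have e1 : (covered M ∪ covered N).filter (fun v => partner N v ≠ v) = covered N := by
      ext v
      simp only [Finset.mem_filter, Finset.mem_union, partner_ne_iff hN]
      tauto
    have e2 : (covered M ∪ covered N).filter (fun v => partner M v ≠ v) = covered M := by
      ext v
      simp only [Finset.mem_filter, Finset.mem_union, partner_ne_iff hM]
      tauto
    have e3 : (covered M ∪ covered N).filter
        (fun v => partner N v ≠ v ∧ partner M v ≠ partner N v) = covered (N \ M) := by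
      ext v
      simp only [Finset.mem_filter, Finset.mem_union, ← mem_covered_sdiff hM hN,
        and_iff_right_iff_imp]
      intro h
      exact .inr ((partner_ne_iff hN).1 ((mem_covered_sdiff hM hN).1 h).1)
    have e4 : (covered M ∪ covered N).filter
        (fun v => partner M v ≠ v ∧ partner N v ≠ partner M v) = covered (M \ N) := by
      ext v
      simp only [Finset.mem_filter, Finset.mem_union, ← mem_covered_sdiff hN hM,
        and_iff_right_iff_imp]
      intro h
      exact .inl ((partner_ne_iff hM).1 ((mem_covered_sdiff hN hM).1 h).1)
    rw [e1, e2, e3, e4, hM.card_covered, hN.card_covered,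
      (hM.subset Finset.sdiff_subset).card_covered,
      (hN.subset Finset.sdiff_subset).card_covered] at key
    push_cast at key
    zify
    linarith
  -- An alternating walk of odd length `t` between `M`-free vertices is an augmenting path with `t +
  -- 1` vertices: even steps use edges of `N` outside `M`, odd steps edges of `M`.
  · intro x t hx htodd hxt hinj
    set y := altWalk (partner M) (partner N) x with hy
    have hyn : ∀ j, Even j → partner N (y j) = y (j + 1) := fun j h => (altWalk_succ_even h).symm
    have hym : ∀ j, ¬ Even j → partner M (y j) = y (j + 1) := fun j h => (altWalk_succ_odd h).symm
    have hym' : ∀ j, ¬ Even j → partner M (y (j + 1)) = y j := fun j h => by rw [← hym j h, hm]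
    have hedges : pathEdges ((List.range (t + 1)).map y) =
        (List.range t).map fun j => s(y j, y (j + 1)) := by
      apply List.ext_getElem
      · simp [length_pathEdges]
      · intro i h1 h2
        simp [pathEdges]
    have hEven : ∀ j < t, Even j → s(y j, y (j + 1)) ∈ N ∧ s(y j, y (j + 1)) ∉ M := by
      intro j hj h
      have hne := hinj j (j + 1) (by omega) (by omega)
      refine ⟨?_, fun h' => ?_⟩
      · rw [← hyn j h, ← partner_ne_iff_mem hN, hyn j h]
        exact hne.symm
      · have h1 := hM.partner_eq h'
        rcases Nat.eq_zero_or_pos j with rfl | h0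
        · exact hne (h1 ▸ hx.symm)
        · obtain ⟨c, rfl⟩ : ∃ c, j = c + 1 := ⟨j - 1, by omega⟩
          rw [hym' c (Nat.even_add_one.1 h)] at h1
          exact hinj c (c + 1 + 1) (by omega) (by omega) h1
    have hOdd : ∀ j < t, ¬ Even j → s(y j, y (j + 1)) ∈ M := by
      intro j hj h
      have hne := hinj j (j + 1) (by omega) (by omega)
      rw [← hym j h, ← partner_ne_iff_mem hM, hym j h]
      exact hne.symm
    have hfree : ∀ v, partner M v = v → ∀ e ∈ M, v ∉ e := by
      intro v hv e he hve
      exact (partner_ne_iff hM).2 (mem_covered.2 ⟨e, he, hve⟩) hv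
    have ht0 : t ≠ 0 := by rintro rfl; simp at htodd
    have hp : IsAugPath E M ((List.range (t + 1)).map y) := by
      refine ⟨?_, ?_, ?_, ?_, ?_, ?_⟩
      · simp only [List.length_map, List.length_range]
        omega
      · refine List.Nodup.map_on (fun a ha b hb hab => ?_) List.nodup_range
        rw [List.mem_range] at ha hb
        rcases Nat.lt_trichotomy a b with h1 | h1 | h1
        · exact absurd hab (hinj a b h1 (by omega))
        · exact h1
        · exact absurd hab.symm (hinj b a h1 (by omega))
      · intro e he
        rw [hedges, List.mem_map] at he
        obtain ⟨j, hj, rfl⟩ := he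
        rw [List.mem_range] at hj
        by_cases h : Even j
        · exact hNE (hEven j hj h).1
        · exact hME (hOdd j hj h)
      · rw [Alternates, hedges, List.isChain_map, List.isChain_range]
        intro j hj
        rw [Nat.succ_eq_add_one]
        by_cases h : Even j
        · have h1 := (hEven j (by omega) h).2
          have h2 := hOdd (j + 1) (by omega) fun h' => (Nat.even_add_one.1 h') h
          tauto
        · have h1 := hOdd j (by omega) h
          have h2 := (hEven (j + 1) (by omega) (Nat.even_add_one.2 h)).2
          tauto
      · intro v hv
        have : v = x := by
          rw [List.range_succ_eq_map] at hv
          exact (Option.mem_some_iff.1 hv).symm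
        exact this ▸ hfree x hx
      · intro v hv
        have : v = y t := by
          rw [List.range_succ] at hv
          simpa [eq_comm] using hv
        exact this ▸ hfree _ hxt
    simpa using hl _ hp
  · intro v hv
    by_cases h : partner M v = v
    · rwa [h]
    · exact Finset.mem_union_left _ (mem_covered.2
        ⟨_, (partner_ne_iff_mem hM).1 h, Sym2.mem_mk_right _ _⟩)
  · intro v hv
    by_cases h : partner N v = v
    · rwa [h]
    · exact Finset.mem_union_right _ (mem_covered.2
        ⟨_, (partner_ne_iff_mem hN).1 h, Sym2.mem_mk_right _ _⟩)

/-- Without short augmenting paths, a matching is almost maximum. -/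
theorem card_le_of_no_short_augPath {E M N : Finset (Sym2 ℕ)} (hM : IsEdgeMatching M)
    (hN : IsEdgeMatching N) (hME : M ⊆ E) (hNE : N ⊆ E) {k : ℕ}
    (hk : ∀ p, IsAugPath E M p → 2 * (k + 1) ≤ p.length) :
    k * N.card ≤ (k + 1) * M.card := by
  -- Bounding the differences by `|M|` and `|N|` turns the inequality for `l = 2k + 1` into `2k |N|
  -- ≤ (2k + 2) |M|`.
  have h := card_symmDiff_lower_bound hM hN hME hNE (l := 2 * k + 1) fun p hp => by
    have := hk p hp
    omega
  have h1 := Finset.card_le_card (Finset.sdiff_subset (s := M) (t := N))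
  have h2 := Finset.card_le_card (Finset.sdiff_subset (s := N) (t := M))
  nlinarith

/-- Augmenting a matching along a set of vertex-disjoint paths. -/
theorem augment_disjoint {E M : Finset (Sym2 ℕ)} (hM : IsEdgeMatching M) (hME : M ⊆ E)
    (S : Finset (List ℕ)) (hS : ∀ p ∈ S, IsAugPath E M p)
    (hdisj : ∀ p ∈ S, ∀ q ∈ S, p ≠ q → ∀ v ∈ p, v ∉ q) :
    IsEdgeMatching (symmDiff M (S.biUnion fun p => (pathEdges p).toFinset)) ∧
      symmDiff M (S.biUnion fun p => (pathEdges p).toFinset) ⊆ E ∧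
      (symmDiff M (S.biUnion fun p => (pathEdges p).toFinset)).card = M.card + S.card := by
  induction S using Finset.induction_on with
  | empty =>
    rw [Finset.biUnion_empty, ← Finset.bot_eq_empty, symmDiff_bot]
    exact ⟨hM, hME, by simp⟩
  | insert p S hpS ih =>
    obtain ⟨h1, h2, h3⟩ := ih (fun q hq => hS q (Finset.mem_insert_of_mem hq))
      fun q hq r hr => hdisj q (Finset.mem_insert_of_mem hq) r (Finset.mem_insert_of_mem hr)
    set F := S.biUnion fun p => (pathEdges p).toFinset with hF
    have hpF : ∀ v ∈ p, ∀ e, v ∈ e → e ∉ F := by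
      intro v hv e hve heF
      obtain ⟨q, hq, heq⟩ := Finset.mem_biUnion.1 heF
      rw [List.mem_toFinset] at heq
      exact hdisj p (Finset.mem_insert_self _ _) q (Finset.mem_insert_of_mem hq)
        (fun h => hpS (h ▸ hq)) v hv (mem_of_mem_pathEdges heq hve)
    -- The other paths do not touch `p`, so it is still augmenting after they have been used.
    have hp : IsAugPath E (symmDiff M F) p :=
      (hS p (Finset.mem_insert_self _ _)).congr fun v hv e hve => by
        rw [Finset.mem_symmDiff]
        have := hpF v hv e hve
        tauto
    have hunion : symmDiff M ((insert p S).biUnion fun p => (pathEdges p).toFinset) =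
        symmDiff (symmDiff M F) (pathEdges p).toFinset := by
      rw [Finset.biUnion_insert, symmDiff_assoc, ← hF]
      congr 1
      have hd : Disjoint F (pathEdges p).toFinset := by
        rw [Finset.disjoint_right]
        intro e he
        rw [List.mem_toFinset] at he
        induction e with
        | h x y => exact hpF x (mem_of_mem_pathEdges he (Sym2.mem_mk_left _ _)) _
                    (Sym2.mem_mk_left _ _)
      rw [hd.symmDiff_eq_sup, Finset.sup_eq_union, Finset.union_comm]
    rw [hunion]
    obtain ⟨h4, h5, -, -⟩ := hp.augment h1
    refine ⟨h4, hp.symmDiff_subset h2, ?_⟩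
    rw [h5, h3, Finset.card_insert_of_notMem hpS, add_assoc]

/-- The lemma of Hopcroft and Karp: augmenting along a maximal set of vertex-disjoint shortest
augmenting paths increases the length of the shortest augmenting paths. -/
theorem hopcroft_karp {E M : Finset (Sym2 ℕ)} (hM : IsEdgeMatching M) (hME : M ⊆ E) {i : ℕ}
    (hmin : ∀ p, IsAugPath E M p → 2 * i ≤ p.length) (S : Finset (List ℕ))
    (hS : ∀ p ∈ S, IsAugPath E M p ∧ p.length = 2 * i)
    (hdisj : ∀ p ∈ S, ∀ q ∈ S, p ≠ q → ∀ v ∈ p, v ∉ q)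
    (hmax : ∀ p, IsAugPath E M p → p.length = 2 * i → ∃ q ∈ S, ∃ v ∈ p, v ∈ q) {P : List ℕ}
    (hP : IsAugPath E (symmDiff M (S.biUnion fun p => (pathEdges p).toFinset)) P) :
    2 * (i + 1) ≤ P.length := by
  obtain ⟨h1, h2, h3⟩ := augment_disjoint hM hME S (fun p hp => (hS p hp).1) hdisj
  set F := S.biUnion fun p => (pathEdges p).toFinset with hF
  obtain ⟨h4, h5, -, ⟨c, hc⟩⟩ := hP.augment h1
  have h6 := hP.symmDiff_subset h2
  by_contra hlt
  have hPi : P.length ≤ 2 * i := by omega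
  have hi : 1 ≤ i := by
    have := hP.two_le
    omega
  -- the edges of `P` do not occur in `F`
  have hlow := card_symmDiff_lower_bound hM h4 hME h6 (l := 2 * i - 1) fun p hp => by
    have := hmin p hp
    omega
  have hcard : ∀ A B : Finset (Sym2 ℕ), (A \ B).card + (B \ A).card = (symmDiff A B).card := by
    intro A B
    rw [symmDiff_def, Finset.sup_eq_union, Finset.card_union_of_disjoint disjoint_sdiff_sdiff]
  rw [h5, h3, hcard, symmDiff_assoc, symmDiff_symmDiff_cancel_left, ← hcard] at hlow
  have hFcard : F.card ≤ S.card * (2 * i - 1) := by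
    refine Finset.card_biUnion_le_card_mul _ _ _ fun p hp => ?_
    refine (List.toFinset_card_le _).trans ?_
    rw [length_pathEdges, (hS p hp).2]
  have hPcard : (pathEdges P).toFinset.card ≤ 2 * i - 1 := by
    refine (List.toFinset_card_le _).trans ?_
    rw [length_pathEdges]
    omega
  have e1 := Finset.card_sdiff_add_card_inter F (pathEdges P).toFinset
  have e2 := Finset.card_sdiff_add_card_inter (pathEdges P).toFinset F
  rw [Finset.inter_comm] at e2
  -- By now `(2i-1)(|S|+1) ≤ |F \ P| + |P \ F|`, whereas `|F| ≤ (2i-1)|S|` and `|P| ≤ 2i-1`; any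
  -- common edge would be lost twice.
  have hinter : (F ∩ (pathEdges P).toFinset).card = 0 := by
    rw [mul_add, mul_add, mul_comm (2 * i - 1) S.card, mul_one] at hlow
    omega
  rw [Finset.card_eq_zero] at hinter
  have hPF : ∀ e ∈ pathEdges P, e ∉ F := by
    intro e he heF
    have : e ∈ F ∩ (pathEdges P).toFinset := by simp [heF, he]
    rw [hinter] at this
    simp at this
  -- hence `P` avoids the paths in `S`
  have hPS : ∀ v ∈ P, ∀ q ∈ S, v ∉ q := by
    intro v hv q hq hvq
    -- Every vertex of `q` is covered by an edge `f` of `q` that belongs to the new matching. So a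
    -- common vertex `v` is not an endpoint of `P`, and as an interior vertex it lies on an edge of
    -- `P` in the new matching. This edge must be `f`, a common edge of `P` and `F`.
    obtain ⟨-, -, hcov, -⟩ := (hS q hq).1.augment hM
    obtain ⟨f, hf, hfM, hvf⟩ := hcov v hvq
    have hfF : f ∈ F := Finset.mem_biUnion.2 ⟨q, hq, List.mem_toFinset.2 hf⟩
    have hfM' : f ∈ symmDiff M F := Finset.mem_symmDiff.2 (.inr ⟨hfF, hfM⟩)
    obtain ⟨e, he, heM', hve⟩ := hP.alternates.exists_mem hv
      (fun h => hP.head v h f hfM' hvf) (fun h => hP.last v h f hfM' hvf)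
    have := h1.2 e heM' f hfM' v hve hvf
    exact hPF e he (this ▸ hfF)
  -- The old and the new matching agree at all vertices of `P`, so `P` is a shortest `M`-augmenting
  -- path disjoint from all of `S`.
  have hPM : IsAugPath E M P := hP.congr fun v hv e hve => by
    have : e ∉ F := by
      intro heF
      obtain ⟨q, hq, heq⟩ := Finset.mem_biUnion.1 heF
      exact hPS v hv q hq (mem_of_mem_pathEdges (List.mem_toFinset.1 heq) hve)
    rw [Finset.mem_symmDiff]
    tauto
  obtain ⟨q, hq, v, hvP, hvq⟩ := hmax P hPM (le_antisymm hPi (hmin P hPM))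
  exact hPS v hvP q hq hvq

/-! ### The iterated logarithm -/

/-- The iterated logarithm of a real number. -/
noncomputable def realLogStar (y : ℝ) : ℕ := sInf {i : ℕ | (Real.logb 2)^[i] y ≤ 1}

/-- Since `k + 2 ≤ 2 ^ (k + 1)`, one logarithm takes the bound `k + 2` to `k + 1`. So the set in the
definition of `log*` is nonempty, and its infimum is a genuine minimum rather than the default 0. -/
theorem exists_iterate_logb_le_one (k : ℕ) (y : ℝ) (h : y ≤ k + 1) :
    ∃ i, (Real.logb 2)^[i] y ≤ 1 := by
  induction k generalizing y with
  | zero => exact ⟨0, by simpa using h⟩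
  | succ k ih =>
    rcases le_or_gt y 1 with h1 | h1
    · exact ⟨0, h1⟩
    · obtain ⟨i, hi⟩ := ih (Real.logb 2 y) (by
        rw [Real.logb_le_iff_le_rpow (by norm_num) (by linarith)]
        refine h.trans ?_
        have : (k + 1 : ℕ) + 1 ≤ 2 ^ (k + 1) := Nat.lt_two_pow_self
        have : ((k + 1 : ℕ) : ℝ) + 1 ≤ 2 ^ (k + 1) := by exact_mod_cast this
        refine this.trans (le_of_eq ?_)
        rw [← Real.rpow_natCast]
        push_cast
        rfl)
      exact ⟨i + 1, hi⟩

theorem iterate_realLogStar_le (y : ℝ) : (Real.logb 2)^[realLogStar y] y ≤ 1 := by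
  obtain ⟨k, hk⟩ := exists_nat_ge y
  exact Nat.sInf_mem (s := {i : ℕ | (Real.logb 2)^[i] y ≤ 1})
    (exists_iterate_logb_le_one k y (by linarith))

theorem one_lt_iterate_of_lt_realLogStar {y : ℝ} {i : ℕ} (h : i < realLogStar y) :
    1 < (Real.logb 2)^[i] y :=
  not_le.1 (Nat.notMem_of_lt_sInf h)

theorem realLogStar_le {y : ℝ} {i : ℕ} (h : (Real.logb 2)^[i] y ≤ 1) : realLogStar y ≤ i :=
  Nat.sInf_le h

theorem realLogStar_of_le_one {y : ℝ} (h : y ≤ 1) : realLogStar y = 0 :=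
  Nat.le_zero.1 (realLogStar_le (i := 0) h)

theorem realLogStar_of_one_lt {y : ℝ} (h : 1 < y) :
    realLogStar y = realLogStar (Real.logb 2 y) + 1 := by
  apply le_antisymm
  · exact realLogStar_le (i := realLogStar (Real.logb 2 y) + 1) (iterate_realLogStar_le _)
  · have h1 := iterate_realLogStar_le y
    rcases hk : realLogStar y with _ | k
    · rw [hk] at h1
      exact absurd h (not_lt.2 h1)
    · rw [hk] at h1
      exact Nat.succ_le_succ (realLogStar_le h1)

/-- The iterates themselves are not monotone, because `Real.logb` of a negative number is that of
its absolute value. The recursion stops at arguments at most 1, before this matters. -/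
theorem realLogStar_mono {y z : ℝ} (h : y ≤ z) : realLogStar y ≤ realLogStar z := by
  induction hk : realLogStar z generalizing y z with
  | zero =>
    have := iterate_realLogStar_le z
    rw [hk] at this
    exact (realLogStar_of_le_one (h.trans this)).le
  | succ k ih =>
    rcases le_or_gt y 1 with h1 | h1
    · rw [realLogStar_of_le_one h1]
      exact Nat.zero_le _
    · rw [realLogStar_of_one_lt (h1.trans_le h)] at hk
      rw [realLogStar_of_one_lt h1]
      exact Nat.succ_le_succ (ih (Real.logb_le_logb_of_le (by norm_num) (by linarith) h)
        (Nat.succ_injective hk))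

theorem realLogStar_natCast_le (k : ℕ) : realLogStar k ≤ k := by
  have key : ∀ (k : ℕ) (y : ℝ), y ≤ k + 1 → realLogStar y ≤ k := by
    intro k
    induction k with
    | zero => intro y h; exact (realLogStar_of_le_one (by simpa using h)).le
    | succ k ih =>
      intro y h
      rcases le_or_gt y 1 with h1 | h1
      · rw [realLogStar_of_le_one h1]
        exact Nat.zero_le _
      · rw [realLogStar_of_one_lt h1]
        refine Nat.succ_le_succ (ih _ ?_)
        rw [Real.logb_le_iff_le_rpow (by norm_num) (by linarith)]
        refine h.trans ?_
        have : (k + 1 : ℕ) + 1 ≤ 2 ^ (k + 1) := Nat.lt_two_pow_self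
        have : ((k + 1 : ℕ) : ℝ) + 1 ≤ 2 ^ (k + 1) := by exact_mod_cast this
        refine this.trans (le_of_eq ?_)
        rw [← Real.rpow_natCast]
        push_cast
        rfl
  exact key k k (by linarith)

/-- The tangent inequality `log u ≤ u - 1` at `u = x / 4` reduces the claim to `log 2 ≥ 1/2`;
equality holds at `x = 4`. -/
theorem two_mul_logb_le {x : ℝ} (hx : 4 ≤ x) : 2 * Real.logb 2 x ≤ x := by
  have h0 : 0 < x := by linarith
  have h1 : Real.log (x / 4) ≤ x / 4 - 1 := Real.log_le_sub_one_of_pos (by positivity)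
  rw [Real.log_div h0.ne' (by norm_num), show (4 : ℝ) = 2 ^ 2 by norm_num, Real.log_pow] at h1
  have h2 := Real.log_two_gt_d9
  rw [Real.logb, ← mul_div_assoc, div_le_iff₀ (by linarith)]
  push_cast at h1
  nlinarith

theorem realLogStar_sq_le {x : ℝ} (hx : 4 ≤ x) : realLogStar (x ^ 2) ≤ realLogStar x + 1 := by
  rw [realLogStar_of_one_lt (y := x ^ 2) (by nlinarith), Real.logb_pow]
  exact Nat.succ_le_succ (realLogStar_mono (by exact_mod_cast two_mul_logb_le hx))

/-- The iterated logarithm of a polynomial in `n`. -/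
theorem logStar_pow_le (a n i : ℕ) (hn : 1 ≤ n) :
    logStar ((a * n ^ a + 1) ^ (2 * i)) ≤ logStar n + (4 * i * a + 6) := by
  change realLogStar _ ≤ realLogStar _ + _
  have hn0 : (0 : ℝ) < n := by exact_mod_cast hn
  have hbase : a * n ^ a + 1 ≤ 2 ^ (2 * a * n) := by
    have h1 : a * n ^ a + 1 ≤ (a + 1) * n ^ a := by
      have : 1 ≤ n ^ a := Nat.one_le_pow _ _ hn
      nlinarith
    have h2 : a + 1 ≤ 2 ^ a := Nat.lt_two_pow_self
    have h3 : n ^ a ≤ (2 ^ n) ^ a := Nat.pow_le_pow_left Nat.lt_two_pow_self.le a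
    calc a * n ^ a + 1 ≤ 2 ^ a * (2 ^ n) ^ a := h1.trans (Nat.mul_le_mul h2 h3)
      _ = 2 ^ (a + n * a) := by rw [← pow_mul, ← pow_add]
      _ ≤ 2 ^ (2 * a * n) := Nat.pow_le_pow_right (by norm_num) (by nlinarith)
  have hpow : (a * n ^ a + 1) ^ (2 * i) ≤ 2 ^ (4 * i * a * n) := by
    refine (Nat.pow_le_pow_left hbase _).trans (le_of_eq ?_)
    rw [← pow_mul]
    congr 1
    ring
  rcases le_or_gt (((a * n ^ a + 1) ^ (2 * i) : ℕ) : ℝ) 1 with h1 | h1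
  · rw [realLogStar_of_le_one h1]
    exact Nat.zero_le _
  rw [realLogStar_of_one_lt h1]
  have hlog : Real.logb 2 (((a * n ^ a + 1) ^ (2 * i) : ℕ) : ℝ) ≤ ((4 * i * a * n : ℕ) : ℝ) := by
    rw [Real.logb_le_iff_le_rpow (by norm_num) (by linarith), Real.rpow_natCast]
    exact_mod_cast hpow
  -- After one logarithm the bound is `4ia · n`, a product of two numbers that are at most `z`,
  -- hence at most `z²`. The square costs one more iteration, and the summand 4 secures `z ≥ 4` for
  -- this. In total `1 + 1 + (4ia + 4)` is added to `log* n`.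
  set z := max (n : ℝ) ((4 * i * a + 4 : ℕ) : ℝ) with hz
  have hz4 : 4 ≤ z := le_trans (by push_cast; nlinarith [Nat.cast_nonneg (α := ℝ) (4 * i * a),
    (by positivity : (0 : ℝ) ≤ 4 * i * a)]) (le_max_right _ _)
  have hzz : ((4 * i * a * n : ℕ) : ℝ) ≤ z ^ 2 := by
    have e1 : (n : ℝ) ≤ z := le_max_left _ _
    have e2 : ((4 * i * a + 4 : ℕ) : ℝ) ≤ z := le_max_right _ _
    push_cast at e2 ⊢
    have e3 : (4 * i * a : ℝ) ≤ z := by linarith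
    rw [sq]
    exact mul_le_mul e3 e1 hn0.le (by linarith)
  have hfin : realLogStar z ≤ realLogStar (n : ℝ) + (4 * i * a + 4) := by
    rcases max_choice (n : ℝ) ((4 * i * a + 4 : ℕ) : ℝ) with h | h
    · rw [hz, h]
      omega
    · rw [hz, h]
      have := realLogStar_natCast_le (4 * i * a + 4)
      omega
  have := (realLogStar_mono (hlog.trans hzz)).trans (realLogStar_sq_le hz4)
  omega

/-! ### Color reduction by polynomials over a prime field -/

/-- Numbers are determined by their digits. -/
theorem eq_of_digits_eq {B : ℕ} : ∀ {L x y : ℕ}, x < B ^ L → y < B ^ L →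
    (∀ j < L, x / B ^ j % B = y / B ^ j % B) → x = y
  | 0, x, y, hx, hy, _ => by
    rw [pow_zero] at hx hy
    omega
  | L + 1, x, y, hx, hy, h => by
    have h0 := h 0 (Nat.succ_pos L)
    rw [pow_zero, Nat.div_one, Nat.div_one] at h0
    have h1 : x / B = y / B := by
      refine eq_of_digits_eq (B := B) (L := L) ?_ ?_ fun j hj => ?_
      · rw [pow_succ] at hx
        exact Nat.div_lt_of_lt_mul (by rwa [mul_comm])
      · rw [pow_succ] at hy
        exact Nat.div_lt_of_lt_mul (by rwa [mul_comm])
      · have := h (j + 1) (Nat.succ_lt_succ hj)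
        rwa [pow_succ', ← Nat.div_div_eq_div_mul, ← Nat.div_div_eq_div_mul] at this
    rw [← Nat.div_add_mod x B, ← Nat.div_add_mod y B, h0, h1]

open Polynomial in
/-- The polynomial whose coefficients are the digits of `c` to the base `q`. -/
noncomputable def digitPolynomial (q d c : ℕ) : (ZMod q)[X] :=
  ∑ j ∈ Finset.range (d + 1), C ((c / q ^ j % q : ℕ) : ZMod q) * X ^ j

theorem coeff_digitPolynomial {q d c j : ℕ} (hj : j < d + 1) :
    (digitPolynomial q d c).coeff j = ((c / q ^ j % q : ℕ) : ZMod q) := by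
  simp only [digitPolynomial, Polynomial.finsetSum_coeff, Polynomial.coeff_C_mul_X_pow,
    Finset.sum_ite_eq, Finset.mem_range, if_pos hj]

theorem natDegree_digitPolynomial (q d c : ℕ) : (digitPolynomial q d c).natDegree ≤ d := by
  refine Polynomial.natDegree_sum_le_of_forall_le _ _ fun j hj => ?_
  exact (Polynomial.natDegree_C_mul_X_pow_le _ _).trans (Nat.lt_succ_iff.1 (Finset.mem_range.1 hj))

theorem digitPolynomial_injective {q d c c' : ℕ} (hq : 0 < q) (hc : c < q ^ (d + 1))
    (hc' : c' < q ^ (d + 1)) (h : digitPolynomial q d c = digitPolynomial q d c') : c = c' := by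
  refine eq_of_digits_eq hc hc' fun j hj => ?_
  have h1 := congrArg (fun p => Polynomial.coeff p j) h
  simp only [coeff_digitPolynomial hj] at h1
  have h2 := (ZMod.natCast_eq_natCast_iff _ _ _).1 h1
  exact h2.eq_of_lt_of_lt (Nat.mod_lt _ hq) (Nat.mod_lt _ hq)

/-- The value of the digit polynomial at `x`, as a number less than `q`. -/
noncomputable def digitValue (q d c x : ℕ) : ℕ := ((digitPolynomial q d c).eval (x : ZMod q)).val

theorem digitValue_lt {q : ℕ} (hq : 0 < q) (d c x : ℕ) : digitValue q d c x < q :=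
  have : NeZero q := ⟨hq.ne'⟩
  ZMod.val_lt _

/-- Different colors have different polynomials, and their difference, of degree at most `d` over a
field, has at most `d` roots. -/
theorem card_digitValue_eq_le {q d c c' : ℕ} (hq : q.Prime) (hc : c < q ^ (d + 1))
    (hc' : c' < q ^ (d + 1)) (hne : c ≠ c') :
    ((Finset.range q).filter fun x => digitValue q d c' x = digitValue q d c x).card ≤ d := by
  have : Fact q.Prime := ⟨hq⟩
  set P := digitPolynomial q d c' - digitPolynomial q d c with hP
  have hP0 : P ≠ 0 := by
    rw [hP, sub_ne_zero]
    exact fun h => hne (digitPolynomial_injective hq.pos hc' hc h).symm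
  have hsub : ((Finset.range q).filter fun x => digitValue q d c' x = digitValue q d c x).card ≤
      P.roots.toFinset.card := by
    refine Finset.card_le_card_of_injOn (fun x => (x : ZMod q)) ?_ ?_
    · intro x hx
      have hx := (Finset.mem_filter.1 hx).2
      rw [Finset.mem_coe, Multiset.mem_toFinset, Polynomial.mem_roots hP0, Polynomial.IsRoot,
        hP, Polynomial.eval_sub, sub_eq_zero]
      exact ZMod.val_injective q hx
    · intro x hx y hy hxy
      have hx := Finset.mem_range.1 (Finset.mem_filter.1 hx).1
      have hy := Finset.mem_range.1 (Finset.mem_filter.1 hy).1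
      exact ((ZMod.natCast_eq_natCast_iff _ _ _).1 hxy).eq_of_lt_of_lt hx hy
  refine hsub.trans ((Multiset.toFinset_card_le _).trans ((Polynomial.card_roots' P).trans ?_))
  exact (Polynomial.natDegree_sub_le _ _).trans
    (max_le (natDegree_digitPolynomial _ _ _) (natDegree_digitPolynomial _ _ _))

/-- The prime that is used to reduce `m` colors in a graph with degrees at most `D`. -/
noncomputable def linialModulus (D m : ℕ) : ℕ :=
  (Nat.exists_prime_lt_and_le_two_mul (D * Nat.log 2 m + 1) (Nat.succ_ne_zero _)).choose

/-- From Bertrand's postulate. The lower bound leaves a point of the field at which no neighbor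
agrees; the upper bound keeps the number `q²` of new colors small. -/
theorem linialModulus_spec (D m : ℕ) : (linialModulus D m).Prime ∧
    D * Nat.log 2 m + 1 < linialModulus D m ∧
    linialModulus D m ≤ 2 * (D * Nat.log 2 m + 1) :=
  (Nat.exists_prime_lt_and_le_two_mul (D * Nat.log 2 m + 1) (Nat.succ_ne_zero _)).choose_spec

open Classical in
/-- A point in which the polynomial of the color `c` differs from those of the colors `cs`. -/
noncomputable def linialPoint (D m c : ℕ) (cs : List ℕ) : ℕ :=
  if h : ∃ x < linialModulus D m, ∀ c' ∈ cs, digitValue (linialModulus D m) (Nat.log 2 m) c' x ≠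
    digitValue (linialModulus D m) (Nat.log 2 m) c x then h.choose else 0

/-- The new color of a vertex of color `c` whose neighbors have the colors `cs`. -/
noncomputable def linialStep (D m c : ℕ) (cs : List ℕ) : ℕ :=
  linialPoint D m c cs * linialModulus D m +
    digitValue (linialModulus D m) (Nat.log 2 m) c (linialPoint D m c cs)

theorem linialPoint_lt (D m c : ℕ) (cs : List ℕ) :
    linialPoint D m c cs < linialModulus D m := by
  rw [linialPoint]
  split_ifs with h
  · exact h.choose_spec.1
  · exact (linialModulus_spec D m).1.pos

/-- The new color encodes the pair of a point and a value, both less than the modulus; the default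
point 0 obeys the bound too. -/
theorem linialStep_lt (D m c : ℕ) (cs : List ℕ) : linialStep D m c cs < linialModulus D m ^ 2 := by
  have h1 := linialPoint_lt D m c cs
  have h2 := digitValue_lt (linialModulus_spec D m).1.pos (Nat.log 2 m) c (linialPoint D m c cs)
  rw [linialStep, sq]
  nlinarith

/-- Each of the at most `D` neighboring colors agrees with `c` in at most `log m` points, and `D log
m` is less than the size of the field. -/
theorem linialPoint_spec {D m c : ℕ} {cs : List ℕ} (hc : c < m) (hcs : ∀ c' ∈ cs, c' < m)
    (hne : c ∉ cs) (hD : cs.length ≤ D) {c' : ℕ} (hc' : c' ∈ cs) :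
    digitValue (linialModulus D m) (Nat.log 2 m) c' (linialPoint D m c cs) ≠
      digitValue (linialModulus D m) (Nat.log 2 m) c (linialPoint D m c cs) := by
  obtain ⟨hq, hlt, -⟩ := linialModulus_spec D m
  set q := linialModulus D m with hqdef
  set d := Nat.log 2 m with hd
  -- As `q ≥ 2`, the `log₂ m + 1` digits to the base `q` determine a color below `m`.
  have hm : m ≤ q ^ (d + 1) :=
    (Nat.lt_pow_succ_log_self (by norm_num) m).le.trans (Nat.pow_le_pow_left hq.two_le _)
  have hex : ∃ x < q, ∀ c' ∈ cs, digitValue q d c' x ≠ digitValue q d c x := by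
    by_contra! h
    have hsub : Finset.range q ⊆ cs.toFinset.biUnion fun c' =>
        (Finset.range q).filter fun x => digitValue q d c' x = digitValue q d c x := by
      intro x hx
      obtain ⟨c', h1, h2⟩ := h x (Finset.mem_range.1 hx)
      exact Finset.mem_biUnion.2 ⟨c', List.mem_toFinset.2 h1, Finset.mem_filter.2 ⟨hx, h2⟩⟩
    have h1 := (Finset.card_le_card hsub).trans
      (Finset.card_biUnion_le_card_mul _ _ d fun c' hc' => by
        rw [List.mem_toFinset] at hc'
        exact card_digitValue_eq_le hq (hc.trans_le hm) ((hcs c' hc').trans_le hm)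
          fun h => hne (h ▸ hc'))
    rw [Finset.card_range] at h1
    have h2 := Nat.mul_le_mul_right d ((List.toFinset_card_le cs).trans hD)
    omega
  have : linialPoint D m c cs = hex.choose := dif_pos hex
  rw [this]
  exact hex.choose_spec.2 c' hc'

/-- Equal new colors would have the same point and the same value there, but the point chosen for
`c` separates it from `c'`. How `c'` chose its point is irrelevant. -/
theorem linialStep_ne {D m c c' : ℕ} {cs cs' : List ℕ} (hc : c < m) (hcs : ∀ c' ∈ cs, c' < m)
    (hne : c ∉ cs) (hD : cs.length ≤ D) (hc' : c' ∈ cs) :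
    linialStep D m c cs ≠ linialStep D m c' cs' := by
  intro h
  have hq := (linialModulus_spec D m).1.pos
  have h1 := digitValue_lt hq (Nat.log 2 m) c (linialPoint D m c cs)
  have h2 := digitValue_lt hq (Nat.log 2 m) c' (linialPoint D m c' cs')
  have e1 := congrArg (· / linialModulus D m) h
  have e2 := congrArg (· % linialModulus D m) h
  simp only [linialStep, mul_comm _ (linialModulus D m),
    Nat.mul_add_div hq, Nat.mul_add_mod, Nat.div_eq_of_lt h1, Nat.div_eq_of_lt h2,
    Nat.mod_eq_of_lt h1, Nat.mod_eq_of_lt h2, add_zero] at e1 e2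
  rw [← e1] at e2
  exact linialPoint_spec hc hcs hne hD hc' e2.symm

/-- The number of colors after `t` rounds. -/
noncomputable def linialBound (D N : ℕ) : ℕ → ℕ
  | 0 => N
  | t + 1 => linialModulus D (linialBound D N t) ^ 2

/-- The color of the vertex `x` after `t` rounds. -/
noncomputable def linialColor (N D : ℕ) : ℕ → ℕ → ProbeTree ℕ
  | 0, x => pure x
  | t + 1, x => do
      let c ← linialColor N D t x
      let ys ← neighbors D x
      let cs ← ProbeTree.forEach (linialColor N D t) ys
      pure (linialStep D (linialBound D N t) c cs)

/-- Linial's coloring algorithm. -/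
noncomputable def linialColoring : ColoringAlgorithm := fun N D => linialColor N D (logStar N)

/-! ### Properness and probe radius of Linial's coloring -/

section Linial

variable {N D : ℕ} {G : LabeledGraph}

theorem linialColor_probesWithin (hD : ∀ v, G.graph.degree v ≤ D) (t : ℕ) (v : G.V) :
    (linialColor N D t (G.id v)).ProbesWithin G (G.vertexBall v t) := by
  induction t generalizing v with
  | zero => exact ProbeTree.probesWithin_pure _
  | succ t ih =>
    refine .bind ((ih v).mono (LabeledGraph.vertexBall_mono (Nat.le_succ t)))
      (.bind (LabeledGraph.neighbors_probesWithin (LabeledGraph.mem_vertexBall_self _ _))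
        (.bind (.forEach fun y hy => ?_) (ProbeTree.probesWithin_pure _)))
    obtain ⟨u, hu, rfl⟩ := (LabeledGraph.mem_eval_neighbors (hD v)).1 hy
    exact (ih u).mono (LabeledGraph.vertexBall_subset (LabeledGraph.mem_vertexBall_of_adj hu)
      (by omega))

theorem eval_linialColor_succ (t x : ℕ) : (linialColor N D (t + 1) x).eval G.answer =
    linialStep D (linialBound D N t) ((linialColor N D t x).eval G.answer)
      (((neighbors D x).eval G.answer).map fun y => (linialColor N D t y).eval G.answer) := by
  simp [linialColor]

theorem linialColor_proper (hN : ∀ v, G.id v < N) (hD : ∀ v, G.graph.degree v ≤ D) (t : ℕ) :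
    (∀ v, (linialColor N D t (G.id v)).eval G.answer < linialBound D N t) ∧
    ∀ u v, G.graph.Adj u v → (linialColor N D t (G.id u)).eval G.answer ≠
      (linialColor N D t (G.id v)).eval G.answer := by
  induction t with
  | zero => exact ⟨hN, fun u v h h' => h.ne (G.id_injective h')⟩
  | succ t ih =>
    constructor
    · intro v
      rw [eval_linialColor_succ]
      exact linialStep_lt _ _ _ _
    · intro u v h
      rw [eval_linialColor_succ, eval_linialColor_succ]
      refine linialStep_ne (ih.1 u) ?_ ?_ ?_ ?_
      · intro c hc
        obtain ⟨y, hy, rfl⟩ := List.mem_map.1 hc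
        obtain ⟨w, -, rfl⟩ := (LabeledGraph.mem_eval_neighbors (hD u)).1 hy
        exact ih.1 w
      · intro hc
        obtain ⟨y, hy, hyc⟩ := List.mem_map.1 hc
        obtain ⟨w, hw, rfl⟩ := (LabeledGraph.mem_eval_neighbors (hD u)).1 hy
        exact ih.2 u w hw hyc.symm
      · rw [List.length_map, LabeledGraph.eval_neighbors u D (hD u), List.length_ofFn]
        exact hD u
      · exact List.mem_map.2 ⟨_, (LabeledGraph.mem_eval_neighbors (hD u)).2 ⟨v, h, rfl⟩, rfl⟩

end Linial

/-! ### The number of colors after `log* N` rounds -/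

/-- The form of the bound is chosen so that one round reproduces it with `log y` in place of `y`.
With `A = D + 1` and `L = log y`, one gets `log m ≤ 12 + 4 log A + 2 (1 + L)`, so the modulus is at
most `64 A² (L + 1)`, whose square is the bound. -/
theorem linialModulus_sq_le {D m : ℕ} {y : ℝ} (hy : 1 < y)
    (hm : (m : ℝ) ≤ 2 ^ 12 * (D + 1) ^ 4 * (y + 1) ^ 2) :
    ((linialModulus D m ^ 2 : ℕ) : ℝ) ≤ 2 ^ 12 * (D + 1) ^ 4 * (Real.logb 2 y + 1) ^ 2 := by
  obtain ⟨-, -, hq⟩ := linialModulus_spec D m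
  set L := Real.logb 2 y with hL
  have hL0 : 0 < L := Real.logb_pos (by norm_num) hy
  set A : ℝ := D + 1 with hA
  have hA1 : 1 ≤ A := by
    have : (0 : ℝ) ≤ D := Nat.cast_nonneg D
    linarith
  have hl : (Nat.log 2 m : ℝ) ≤ 14 + 4 * A + 2 * L := by
    rcases Nat.eq_zero_or_pos m with rfl | hm0
    · rw [Nat.log_zero_right, Nat.cast_zero]
      positivity
    refine (Real.natLog_le_logb m 2).trans ?_
    rw [Nat.cast_ofNat]
    have hm0' : (0 : ℝ) < m := by exact_mod_cast hm0
    refine (Real.logb_le_logb_of_le (by norm_num) hm0' hm).trans ?_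
    have hA2 : Real.logb 2 A ≤ A := by
      rw [Real.logb_le_iff_le_rpow (by norm_num) (by linarith)]
      have : (D + 1 : ℕ) ≤ 2 ^ (D + 1) := Nat.lt_two_pow_self.le
      have h' : ((D + 1 : ℕ) : ℝ) ≤ (2 : ℝ) ^ (((D + 1 : ℕ) : ℝ)) := by
        rw [Real.rpow_natCast]
        exact_mod_cast this
      push_cast at h'
      exact h'
    have hy2 : Real.logb 2 (y + 1) ≤ 1 + L := by
      have : Real.logb 2 (y + 1) ≤ Real.logb 2 (2 * y) :=
        Real.logb_le_logb_of_le (by norm_num) (by linarith) (by linarith)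
      rwa [Real.logb_mul (by norm_num) (by linarith), Real.logb_self_eq_one (by norm_num)] at this
    rw [Real.logb_mul (by positivity) (by positivity), Real.logb_mul (by norm_num) (by positivity),
      Real.logb_pow, Real.logb_pow, Real.logb_pow, Real.logb_self_eq_one (by norm_num)]
    push_cast
    linarith
  have hq' : (linialModulus D m : ℝ) ≤ 64 * A ^ 2 * (L + 1) := by
    have h1 : (linialModulus D m : ℝ) ≤ 2 * (D * Nat.log 2 m + 1) := by exact_mod_cast hq
    have h2 : (D : ℝ) * Nat.log 2 m ≤ A * (14 + 4 * A + 2 * L) :=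
      mul_le_mul (by rw [hA]; linarith) hl (Nat.cast_nonneg _) (by linarith)
    have h3 : A ≤ A ^ 2 := by nlinarith
    have h4 : A * L ≤ A ^ 2 * L := mul_le_mul_of_nonneg_right h3 hL0.le
    nlinarith
  push_cast
  calc (linialModulus D m : ℝ) ^ 2 ≤ (64 * A ^ 2 * (L + 1)) ^ 2 :=
        pow_le_pow_left₀ (Nat.cast_nonneg _) hq' 2
    _ = 2 ^ 12 * A ^ 4 * (L + 1) ^ 2 := by ring

/-- Before round `log* N` all iterates exceed 1, so `linialModulus_sq_le` applies in every round.
Nonnegativity is needed at the end, where the last iterate lies in `[0, 1]` and the squared factor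
is at most 4. -/
theorem linialBound_le {D N t : ℕ} (ht : t ≤ logStar N) :
    (linialBound D N t : ℝ) ≤ 2 ^ 12 * (D + 1) ^ 4 * ((Real.logb 2)^[t] (N : ℝ) + 1) ^ 2 ∧
      0 ≤ (Real.logb 2)^[t] (N : ℝ) := by
  induction t with
  | zero =>
    have h0 : (0 : ℝ) ≤ N := Nat.cast_nonneg N
    refine ⟨?_, h0⟩
    change (N : ℝ) ≤ 2 ^ 12 * (D + 1) ^ 4 * ((N : ℝ) + 1) ^ 2
    have h1 : (1 : ℝ) ≤ 2 ^ 12 * (D + 1) ^ 4 := by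
      have : (1 : ℝ) ≤ (D + 1) ^ 4 := one_le_pow₀ (by linarith [Nat.cast_nonneg (α := ℝ) D])
      linarith
    nlinarith
  | succ t ih =>
    have h1 : 1 < (Real.logb 2)^[t] (N : ℝ) := one_lt_iterate_of_lt_realLogStar ht
    rw [Function.iterate_succ_apply']
    exact ⟨linialModulus_sq_le h1 (ih (by omega)).1, (Real.logb_pos (by norm_num) h1).le⟩

theorem linialColoring_isPolyColoring : linialColoring.IsPolyColoring (2 ^ 14) := by
  intro N D G hN hD
  obtain ⟨h1, h2⟩ := linialColor_proper hN hD (logStar N)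
  refine ⟨fun v => (h1 v).trans_le ?_, h2, fun v => ?_⟩
  · obtain ⟨h3, h4⟩ := linialBound_le (D := D) (le_refl (logStar N))
    have h5 : (Real.logb 2)^[logStar N] (N : ℝ) ≤ 1 := iterate_realLogStar_le _
    have h6 : (linialBound D N (logStar N) : ℝ) ≤ ((2 ^ 14 * (D + 1) ^ 4 : ℕ) : ℝ) := by
      refine h3.trans ?_
      have : ((Real.logb 2)^[logStar N] (N : ℝ) + 1) ^ 2 ≤ 4 := by nlinarith
      push_cast
      have h7 : (0 : ℝ) ≤ (D + 1) ^ 4 := by positivity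
      nlinarith
    -- The value `2 ^ 14` comes from the leading constant; as an exponent, anything from `4 = 2 ^ 2`
    -- on would do.
    exact (Nat.cast_le.1 h6).trans
      (Nat.mul_le_mul_left _ (Nat.pow_le_pow_right (Nat.succ_pos D)
        ((Nat.pow_le_pow_right (n := 2) (by norm_num) (by norm_num : 2 ≤ 14)))))
  · refine (linialColor_probesWithin hD _ v).mono (LabeledGraph.vertexBall_mono ?_)
    exact (Nat.le_add_right _ _).trans (Nat.le_mul_of_pos_left _ (Nat.pow_pos (by norm_num)))

/-! ### Local views -/

theorem isAugmenting_iff {E M : Finset (Sym2 ℕ)} {p : List ℕ} (hp : 2 ≤ p.length) :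
    IsAugmenting E M p ↔
      IsAugPath E M p ∧ ∀ x ∈ p.head?, ∀ y ∈ p.getLast?, x < y := by
  constructor
  · rintro ⟨h1, h2, h3, h4, h5, h6⟩
    simp only [Option.mem_toList] at h4 h5 h6
    exact ⟨⟨hp, h1, h2, h3, h4, h5⟩, h6⟩
  · rintro ⟨⟨-, h1, h2, h3, h4, h5⟩, h6⟩
    refine ⟨h1, h2, h3, ?_, ?_, ?_⟩ <;> simpa only [Option.mem_toList]

theorem IsAugPath.isAugmenting_or_reverse {E M : Finset (Sym2 ℕ)} {p : List ℕ}
    (h : IsAugPath E M p) : IsAugmenting E M p ∨ IsAugmenting E M p.reverse := by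
  have h2 := h.two_le
  rw [isAugmenting_iff h2, isAugmenting_iff (by simpa using h2)]
  obtain ⟨x, l, rfl⟩ := List.exists_cons_of_ne_nil (l := p) (by rintro rfl; simp at h2)
  obtain ⟨y, hy⟩ : ∃ y, (x :: l).getLast? = some y := ⟨_, List.getLast?_eq_some_getLast (by simp)⟩
  have hyl : y ∈ l := by
    obtain ⟨z, l, rfl⟩ := List.exists_cons_of_ne_nil (l := l) (by rintro rfl; simp at h2)
    rw [List.getLast?_cons_cons] at hy
    exact List.mem_of_getLast? hy
  have hxy : x ≠ y := by
    rintro rfl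
    exact (List.nodup_cons.1 h.nodup).1 hyl
  rcases Nat.lt_or_gt_of_ne hxy with hlt | hlt
  · refine .inl ⟨h, fun a ha b hb => ?_⟩
    rw [hy] at hb
    rw [← Option.mem_some_iff.1 hb, ← Option.mem_some_iff.1 (show a ∈ some x from ha)]
    exact hlt
  · refine .inr ⟨h.reverse, fun a ha b hb => ?_⟩
    rw [List.head?_reverse, hy] at ha
    rw [List.getLast?_reverse] at hb
    rw [← Option.mem_some_iff.1 ha, ← Option.mem_some_iff.1 (show b ∈ some x from hb)]
    exact hlt

/-- Whether a path is augmenting can be decided from the edges at its vertices. -/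
theorem isAugmenting_congr {E E' M M' : Finset (Sym2 ℕ)} {p : List ℕ} (hp : 2 ≤ p.length)
    (hE : E' ⊆ E) (hM : ∀ e, e ∈ M' ↔ e ∈ M ∧ e ∈ E') (hME : M ⊆ E)
    (h : (∀ e ∈ pathEdges p, e ∈ E) → ∀ e ∈ E, ∀ x ∈ p, x ∈ e → e ∈ E') :
    IsAugmenting E' M' p ↔ IsAugmenting E M p := by
  have hMM' : (∀ e ∈ pathEdges p, e ∈ E) → ∀ v ∈ p, ∀ e, v ∈ e → (e ∈ M' ↔ e ∈ M) := by
    intro hpE v hv e hve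
    rw [hM]
    exact ⟨fun h' => h'.1, fun h' => ⟨h', h hpE e (hME h') v hv hve⟩⟩
  rw [isAugmenting_iff hp, isAugmenting_iff hp]
  refine and_congr_left fun _ => ⟨fun h' => ?_, fun h' => ?_⟩
  · have hpE : ∀ e ∈ pathEdges p, e ∈ E := fun e he => hE (h'.edges e he)
    have h'' := h'.congr (hMM' hpE)
    exact ⟨hp, h''.nodup, hpE, h''.alternates, h''.head, h''.last⟩
  · have h'' := h'.congr fun v hv e hve => (hMM' h'.edges v hv e hve).symm
    refine ⟨hp, h''.nodup, fun e he => ?_, h''.alternates, h''.head, h''.last⟩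
    induction e with
    | h x y => exact h h'.edges _ (h'.edges _ he) x
                (mem_of_mem_pathEdges he (Sym2.mem_mk_left _ _)) (Sym2.mem_mk_left _ _)

namespace LabeledGraph

variable (G : LabeledGraph)

/-- The edges, as pairs of identifiers. -/
def idEdges : Finset (Sym2 ℕ) := G.graph.edgeFinset.image (Sym2.map G.id)

/-- The edges for which the program `prev` answers "yes". -/
noncomputable def decidedEdges (prev : Sym2 ℕ → ProbeTree Bool) : Finset (Sym2 ℕ) :=
  G.idEdges.filter fun e => (prev e).eval G.answer = true

variable {G}

theorem isEdgeQuery_iff {e : Sym2 ℕ} : G.IsEdgeQuery e ↔ e ∈ G.idEdges := by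
  simp [IsEdgeQuery, idEdges]

theorem mem_idEdges {e : Sym2 ℕ} :
    e ∈ G.idEdges ↔ ∃ u v, G.graph.Adj u v ∧ e = s(G.id u, G.id v) := by
  rw [← isEdgeQuery_iff]
  constructor
  · rintro ⟨f, hf, rfl⟩
    induction f with
    | h u v => exact ⟨u, v, hf, rfl⟩
  · rintro ⟨u, v, h, rfl⟩
    exact ⟨s(u, v), h, rfl⟩

theorem mk_mem_idEdges {u v : G.V} : s(G.id u, G.id v) ∈ G.idEdges ↔ G.graph.Adj u v := by
  rw [mem_idEdges]
  constructor
  · rintro ⟨a, b, hab, h⟩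
    rw [Sym2.eq_iff] at h
    rcases h with ⟨h1, h2⟩ | ⟨h1, h2⟩
    · rwa [G.id_injective h1, G.id_injective h2]
    · rw [G.id_injective h1, G.id_injective h2]
      exact hab.symm
  · exact fun h => ⟨u, v, h, rfl⟩

theorem exists_id_of_mem {e : Sym2 ℕ} (he : e ∈ G.idEdges) {x : ℕ} (hx : x ∈ e) :
    ∃ v, G.id v = x := by
  obtain ⟨u, v, -, rfl⟩ := mem_idEdges.1 he
  rcases Sym2.mem_iff.1 hx with rfl | rfl
  exacts [⟨u, rfl⟩, ⟨v, rfl⟩]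

theorem decidedEdges_subset (prev : Sym2 ℕ → ProbeTree Bool) :
    G.decidedEdges prev ⊆ G.idEdges := Finset.filter_subset _ _

/-! #### Paths in a labeled graph -/

/-- With at least two entries every entry lies on an edge, hence is an identifier of `G`. A single
entry could be any number. -/
theorem exists_vertex_list {p : List ℕ} (hp : 2 ≤ p.length)
    (h : ∀ e ∈ pathEdges p, e ∈ G.idEdges) :
    ∃ l : List G.V, l.map G.id = p ∧ l.IsChain G.graph.Adj := by
  induction p with
  | nil => simp at hp
  | cons x p ih =>
    cases p with
    | nil => simp at hp
    | cons y p =>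
      have hxy := h s(x, y) (by simp [pathEdges_cons_cons])
      obtain ⟨u, rfl⟩ := exists_id_of_mem hxy (Sym2.mem_mk_left _ _)
      obtain ⟨v, rfl⟩ := exists_id_of_mem hxy (Sym2.mem_mk_right _ _)
      rw [mk_mem_idEdges] at hxy
      cases p with
      | nil => exact ⟨[u, v], rfl, by simpa using hxy⟩
      | cons z p =>
        obtain ⟨l, hl, hc⟩ := ih (by simp) fun e he =>
          h e (by rw [pathEdges_cons_cons]; exact List.mem_cons_of_mem _ he)
        cases l with
        | nil => simp at hl
        | cons w l =>
          rw [List.map_cons, List.cons.injEq] at hl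
          obtain rfl := G.id_injective hl.1
          exact ⟨u :: w :: l, by rw [List.map_cons, List.map_cons, hl.2],
            List.isChain_cons_cons.2 ⟨hxy, hc⟩⟩

theorem mem_vertexBall_of_chain {l : List G.V} (h : l.IsChain G.graph.Adj) {u v : G.V}
    (hu : u ∈ l) (hv : v ∈ l) : v ∈ G.vertexBall u (l.length - 1) := by
  have key : ∀ (l : List G.V) (a b : G.V), (a :: l).IsChain G.graph.Adj → b ∈ a :: l →
      b ∈ G.vertexBall a l.length := by
    intro l
    induction l with
    | nil =>
      intro a b _ hb
      rw [List.mem_singleton.1 hb]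
      exact mem_vertexBall_self _ _
    | cons c l ih =>
      intro a b hc hb
      rw [List.isChain_cons_cons] at hc
      rcases List.mem_cons.1 hb with rfl | hb
      · exact mem_vertexBall_self _ _
      · exact mem_vertexBall_trans (mem_vertexBall_of_adj hc.1) (ih c b hc.2 hb)
          (by rw [List.length_cons]; omega)
  induction l with
  | nil => simp at hu
  | cons a l ih =>
    rcases List.mem_cons.1 hu with rfl | hu'
    · exact key l u v h hv
    · rcases List.mem_cons.1 hv with rfl | hv'
      · exact mem_vertexBall_comm.1 (key l v u h hu)
      · exact vertexBall_mono (by simp) (ih h.tail hu' hv')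

theorem mem_vertexBall_of_path {p : List ℕ} (hp : 2 ≤ p.length)
    (h : ∀ e ∈ pathEdges p, e ∈ G.idEdges) {u v : G.V} (hu : G.id u ∈ p) (hv : G.id v ∈ p) :
    v ∈ G.vertexBall u (p.length - 1) := by
  obtain ⟨l, rfl, hl⟩ := exists_vertex_list hp h
  rw [List.length_map]
  rw [List.mem_map_of_injective G.id_injective] at hu hv
  exact mem_vertexBall_of_chain hl hu hv

theorem exists_id_of_mem_path {p : List ℕ} (hp : 2 ≤ p.length)
    (h : ∀ e ∈ pathEdges p, e ∈ G.idEdges) {x : ℕ} (hx : x ∈ p) : ∃ v, G.id v = x := by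
  obtain ⟨l, rfl, -⟩ := exists_vertex_list hp h
  obtain ⟨v, -, hv⟩ := List.mem_map.1 hx
  exact ⟨v, hv⟩

/-! #### Evaluation of the local view -/

section LocalView

variable {Δ : ℕ} (prev : Sym2 ℕ → ProbeTree Bool) (d : ℕ)
  (v : G.V)

/-- The edges that are incident to vertices of a ball, in the order of the search. -/
def viewEdges (Δ d x : ℕ) : ProbeTree (List (Sym2 ℕ)) := do
  let S ← bfs Δ d x
  let es ← ProbeTree.forEach (fun y => do
    let zs ← neighbors Δ y
    pure (zs.map fun z => s(y, z))) (S.sort (· ≤ ·))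
  pure es.flatten

theorem mem_eval_viewEdges (hΔ : ∀ v, G.graph.degree v ≤ Δ) {e : Sym2 ℕ} :
    e ∈ (viewEdges Δ d (G.id v)).eval G.answer ↔
      ∃ u ∈ G.vertexBall v d, ∃ w, G.graph.Adj u w ∧ e = s(G.id u, G.id w) := by
  simp only [viewEdges, ProbeTree.eval_bind, ProbeTree.eval_pure, ProbeTree.eval_forEach,
    List.mem_flatten, List.mem_map, Finset.mem_sort, mem_eval_bfs hΔ]
  constructor
  · rintro ⟨l, ⟨y, ⟨u, hu, rfl⟩, rfl⟩, he⟩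
    obtain ⟨z, hz, rfl⟩ := List.mem_map.1 he
    obtain ⟨w, hw, rfl⟩ := (mem_eval_neighbors (hΔ u)).1 hz
    exact ⟨u, hu, w, hw, rfl⟩
  · rintro ⟨u, hu, w, hw, rfl⟩
    exact ⟨_, ⟨_, ⟨u, hu, rfl⟩, rfl⟩,
      List.mem_map.2 ⟨_, (mem_eval_neighbors (hΔ u)).2 ⟨w, hw, rfl⟩, rfl⟩⟩

theorem mem_eval_localView_fst (hΔ : ∀ v, G.graph.degree v ≤ Δ) {e : Sym2 ℕ} :
    e ∈ ((localView Δ prev d (G.id v)).eval G.answer).1 ↔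
      ∃ u ∈ G.vertexBall v d, ∃ w, G.graph.Adj u w ∧ e = s(G.id u, G.id w) := by
  rw [← mem_eval_viewEdges d v hΔ]
  simp [localView, viewEdges]

theorem eval_localView_fst_subset (hΔ : ∀ v, G.graph.degree v ≤ Δ) :
    ((localView Δ prev d (G.id v)).eval G.answer).1 ⊆ G.idEdges := by
  intro e he
  obtain ⟨u, -, w, hw, rfl⟩ := (mem_eval_localView_fst prev d v hΔ).1 he
  exact mk_mem_idEdges.2 hw

theorem mem_eval_localView_snd (hΔ : ∀ v, G.graph.degree v ≤ Δ) {e : Sym2 ℕ} :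
    e ∈ ((localView Δ prev d (G.id v)).eval G.answer).2 ↔
      e ∈ G.decidedEdges prev ∧ e ∈ ((localView Δ prev d (G.id v)).eval G.answer).1 := by
  have h1 : e ∈ ((localView Δ prev d (G.id v)).eval G.answer).2 ↔
      (prev e).eval G.answer = true ∧
        e ∈ ((localView Δ prev d (G.id v)).eval G.answer).1 := by
    simp only [localView, ProbeTree.eval_bind, ProbeTree.eval_pure, ProbeTree.eval_forEach,
      List.mem_toFinset, List.mem_map, List.mem_filter]
    constructor
    · rintro ⟨_, ⟨⟨f, hf, rfl⟩, h⟩, rfl⟩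
      exact ⟨h, hf⟩
    · rintro ⟨h, he⟩
      exact ⟨_, ⟨⟨e, he, rfl⟩, h⟩, rfl⟩
  rw [h1, decidedEdges, Finset.mem_filter]
  constructor
  · rintro ⟨h, h'⟩
    exact ⟨⟨eval_localView_fst_subset prev d v hΔ h', h⟩, h'⟩
  · rintro ⟨⟨-, h⟩, h'⟩
    exact ⟨h, h'⟩

/-- The search reaches distance `d`, an incident edge may end one step further out, and the call of
`prev` on it adds `r`. -/
theorem localView_probesWithin (hΔ : ∀ v, G.graph.degree v ≤ Δ) {r : ℕ}
    (hprev : ∀ e ∈ G.idEdges, (prev e).ProbesWithin G (G.edgeBall e r)) :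
    (localView Δ prev d (G.id v)).ProbesWithin G (G.vertexBall v (d + 1 + r)) := by
  refine .bind ((bfs_probesWithin hΔ v d).mono (vertexBall_mono (by omega)))
    (.bind (.forEach fun x hx => ?_) (.bind (.forEach fun e he => ?_)
      (ProbeTree.probesWithin_pure _)))
  · rw [Finset.mem_sort, mem_eval_bfs hΔ] at hx
    obtain ⟨u, hu, rfl⟩ := hx
    exact .bind (neighbors_probesWithin (vertexBall_mono (by omega) hu))
      (ProbeTree.probesWithin_pure _)
  · have he' : e ∈ (viewEdges Δ d (G.id v)).eval G.answer := by
      simpa [viewEdges] using he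
    obtain ⟨u, hu, w, hw, rfl⟩ := (mem_eval_viewEdges d v hΔ).1 he'
    refine .bind ((hprev _ (mk_mem_idEdges.2 hw)).mono ?_) (ProbeTree.probesWithin_pure _)
    rintro z ⟨y, hy, hz⟩
    rcases Sym2.mem_iff.1 hy with h | h <;> obtain rfl := G.id_injective h
    · exact mem_vertexBall_trans hu hz (by omega)
    · exact mem_vertexBall_trans (mem_vertexBall_trans hu (mem_vertexBall_of_adj hw) le_rfl) hz
        le_rfl

/-- A local view around a vertex of a path contains all edges at the vertices of the path. -/
theorem mem_eval_localView_of_path (hΔ : ∀ v, G.graph.degree v ≤ Δ) {p : List ℕ}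
    (hp : 2 ≤ p.length) (hpd : p.length - 1 ≤ d) (h : ∀ e ∈ pathEdges p, e ∈ G.idEdges)
    (hv : G.id v ∈ p) {e : Sym2 ℕ} (he : e ∈ G.idEdges) {x : ℕ} (hx : x ∈ p) (hxe : x ∈ e) :
    e ∈ ((localView Δ prev d (G.id v)).eval G.answer).1 := by
  obtain ⟨u, rfl⟩ := exists_id_of_mem he hxe
  obtain ⟨y, rfl⟩ := hxe
  obtain ⟨w, rfl⟩ := exists_id_of_mem he (Sym2.mem_mk_right _ _)
  exact (mem_eval_localView_fst prev d v hΔ).2 ⟨u, vertexBall_mono hpd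
    (mem_vertexBall_of_path hp h hv hx), w, mk_mem_idEdges.1 he, rfl⟩

end LocalView

end LabeledGraph

/-! ### The intersection graph -/

theorem length_decodePath (B L x : ℕ) : (decodePath B L x).length = L := by
  simp [decodePath]

theorem decodePath_injOn {B L x y : ℕ} (hx : x < B ^ L) (hy : y < B ^ L)
    (h : decodePath B L x = decodePath B L y) : x = y := by
  refine eq_of_digits_eq hx hy fun j hj => ?_
  exact List.map_inj_left.1 h j (List.mem_range.2 hj)

theorem exists_decodePath {B : ℕ} (p : List ℕ) (hp : ∀ x ∈ p, x < B) :
    ∃ x < B ^ p.length, decodePath B p.length x = p := by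
  induction p with
  | nil => exact ⟨0, by simp, rfl⟩
  | cons a p ih =>
    obtain ⟨x, hx, hxp⟩ := ih fun y hy => hp y (List.mem_cons_of_mem _ hy)
    have ha := hp a (by simp)
    refine ⟨a + B * x, ?_, ?_⟩
    · rw [List.length_cons, pow_succ]
      nlinarith
    · rw [List.length_cons, decodePath, List.range_succ_eq_map, List.map_cons, List.map_map]
      congr 1
      · rw [pow_zero, Nat.div_one, Nat.add_mul_mod_self_left, Nat.mod_eq_of_lt ha]
      · conv_rhs => rw [← hxp]
        refine List.map_congr_left fun j _ => ?_
        rw [Function.comp_apply, pow_succ', ← Nat.div_div_eq_div_mul,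
          Nat.add_mul_div_left _ _ (by omega), Nat.div_eq_of_lt ha, zero_add]

theorem mem_augmentingCodes {B L x : ℕ} {E M : Finset (Sym2 ℕ)} :
    x ∈ augmentingCodes B L E M ↔ x < B ^ L ∧ IsAugmenting E M (decodePath B L x) := by
  simp [augmentingCodes]

section IntersectionGraph

variable (B L : ℕ) (E M : Finset (Sym2 ℕ))

/-- The intersection graph of the augmenting paths with `L` vertices. -/
def pathGraph : SimpleGraph {x // x ∈ augmentingCodes B L E M} where
  Adj x y := x ≠ y ∧ ∃ v ∈ decodePath B L x, v ∈ decodePath B L y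
  symm := ⟨fun _ _ h => ⟨h.1.symm, let ⟨v, h1, h2⟩ := h.2; ⟨v, h2, h1⟩⟩⟩
  loopless := ⟨fun _ h => h.1 rfl⟩

instance : DecidableRel (pathGraph B L E M).Adj := fun x y =>
  inferInstanceAs (Decidable (x ≠ y ∧ ∃ v ∈ decodePath B L x, v ∈ decodePath B L y))

/-- The set of the codes of the neighbors of a path. -/
def pathNeighborSet (x : {x // x ∈ augmentingCodes B L E M}) : Finset ℕ :=
  ((pathGraph B L E M).neighborFinset x).image Subtype.val

/-- The sorted list of the codes of the neighbors of a path. -/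
def pathNeighbors (x : {x // x ∈ augmentingCodes B L E M}) : List ℕ :=
  (pathNeighborSet B L E M x).sort (· ≤ ·)

variable {B L E M}

theorem mem_pathNeighborSet {x : {x // x ∈ augmentingCodes B L E M}} {y : ℕ} :
    y ∈ pathNeighborSet B L E M x ↔ ∃ h : y ∈ augmentingCodes B L E M,
      (pathGraph B L E M).Adj x ⟨y, h⟩ := by
  simp [pathNeighborSet]

theorem mem_pathNeighbors {x : {x // x ∈ augmentingCodes B L E M}} {y : ℕ} :
    y ∈ pathNeighbors B L E M x ↔ ∃ h : y ∈ augmentingCodes B L E M,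
      (pathGraph B L E M).Adj x ⟨y, h⟩ := by
  rw [pathNeighbors, Finset.mem_sort, mem_pathNeighborSet]

theorem nodup_pathNeighbors (x : {x // x ∈ augmentingCodes B L E M}) :
    (pathNeighbors B L E M x).Nodup := Finset.sort_nodup _ _

theorem length_pathNeighbors (x : {x // x ∈ augmentingCodes B L E M}) :
    (pathGraph B L E M).degree x = (pathNeighbors B L E M x).length := by
  rw [pathNeighbors, Finset.length_sort, pathNeighborSet, Finset.card_image_of_injective _ Subtype.val_injective,
    SimpleGraph.card_neighborFinset_eq_degree]

/-- The ports of the intersection graph are ordered by the identifiers. -/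
def pathPort (x : {x // x ∈ augmentingCodes B L E M}) :
    Fin ((pathGraph B L E M).degree x) ≃ (pathGraph B L E M).neighborSet x :=
  (finCongr (length_pathNeighbors x)).trans
    (((nodup_pathNeighbors x).getEquiv _).trans
      { toFun := fun y => ⟨⟨y.1, (mem_pathNeighbors.1 y.2).1⟩, (mem_pathNeighbors.1 y.2).2⟩
        invFun := fun u => ⟨u.1.1, mem_pathNeighbors.2 ⟨u.1.2, u.2⟩⟩
        left_inv := fun _ => rfl
        right_inv := fun _ => rfl })

variable (B L E M) in
/-- The intersection graph as a labeled graph. -/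
def intersectionGraph : LabeledGraph where
  V := {x // x ∈ augmentingCodes B L E M}
  graph := pathGraph B L E M
  id := Subtype.val
  id_injective := Subtype.val_injective
  port := pathPort

theorem intersectionGraph_adj {x y : (intersectionGraph B L E M).V} :
    (intersectionGraph B L E M).graph.Adj x y ↔
      x ≠ y ∧ ∃ v ∈ decodePath B L x.1, v ∈ decodePath B L y.1 := Iff.rfl

/-- Since ports follow the sorted list of neighbors, the port leading back is an `idxOf`, just as
`intersectionProbe` computes it. -/
theorem intersectionGraph_answer (x : (intersectionGraph B L E M).V) (j : ℕ) :
    (intersectionGraph B L E M).answer x.1 j =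
      if h : j < (pathNeighbors B L E M x).length then
        some ((pathNeighbors B L E M x)[j],
          (pathNeighbors B L E M ⟨(pathNeighbors B L E M x)[j],
            (mem_pathNeighbors.1 (List.getElem_mem h)).1⟩).idxOf x.1)
      else none := by
  have h0 := LabeledGraph.answer_id (G := intersectionGraph B L E M) x j
  refine h0.trans ?_
  have hlen : (intersectionGraph B L E M).graph.degree x = (pathNeighbors B L E M x).length :=
    length_pathNeighbors x
  rw [LabeledGraph.answerAt]
  by_cases h : j < (pathNeighbors B L E M x).length
  · rw [dif_pos h, dif_pos (h.trans_eq hlen.symm)]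
    rfl
  · rw [dif_neg h, dif_neg (fun h' => h (h'.trans_eq hlen))]

end IntersectionGraph

section Simulation

variable {G : LabeledGraph} {B Δ i : ℕ} {prev : Sym2 ℕ → ProbeTree Bool}

/-- The intersection graph of the augmenting paths with respect to the matching decided
by `prev`. -/
noncomputable abbrev decidedGraph (G : LabeledGraph) (B i : ℕ) (prev : Sym2 ℕ → ProbeTree Bool) :
    LabeledGraph :=
  intersectionGraph B (2 * i) G.idEdges (G.decidedEdges prev)

theorem decidedGraph_isAugPath (hi : 1 ≤ i) (x : (decidedGraph G B i prev).V) :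
    IsAugPath G.idEdges (G.decidedEdges prev) (decodePath B (2 * i) x.1) :=
  ((isAugmenting_iff (by rw [length_decodePath]; omega)).1 (mem_augmentingCodes.1 x.2).2).1

/-- A path with `2i` vertices through `v` stays within distance `2i - 1` of `v`, so the view
contains all edges at its vertices, and these decide whether it is augmenting. -/
theorem mem_augmentingCodes_localView (hi : 1 ≤ i) (hΔ : ∀ v, G.graph.degree v ≤ Δ) {y : ℕ}
    {v : G.V} (hv : G.id v ∈ decodePath B (2 * i) y) :
    y ∈ augmentingCodes B (2 * i)
        ((localView Δ prev (2 * i - 1) (G.id v)).eval G.answer).1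
        ((localView Δ prev (2 * i - 1) (G.id v)).eval G.answer).2 ↔
      y ∈ augmentingCodes B (2 * i) G.idEdges (G.decidedEdges prev) := by
  have hlen := length_decodePath B (2 * i) y
  rw [mem_augmentingCodes, mem_augmentingCodes, isAugmenting_congr (by omega)
    (LabeledGraph.eval_localView_fst_subset prev _ v hΔ)
    (fun e => LabeledGraph.mem_eval_localView_snd prev _ v hΔ)
    (LabeledGraph.decidedEdges_subset prev)]
  intro hpE e he x hx hxe
  exact LabeledGraph.mem_eval_localView_of_path prev _ v hΔ (by omega) (by rw [hlen]) hpE hv he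
    hx hxe

/-- A neighbor of `x` shares a vertex with `x` and is seen in the view around that vertex. Both
lists are sorted, so comparing them as sets suffices. -/
theorem eval_intersectionNeighbors (hi : 1 ≤ i) (hΔ : ∀ v, G.graph.degree v ≤ Δ)
    (x : (decidedGraph G B i prev).V) :
    (intersectionNeighbors B Δ i prev x.1).eval G.answer =
      pathNeighbors B (2 * i) G.idEdges (G.decidedEdges prev) x := by
  have hlen := length_decodePath B (2 * i) x.1
  have hx := decidedGraph_isAugPath hi x
  have hval : ∀ v ∈ decodePath B (2 * i) x.1, ∃ u, G.id u = v := fun v hv =>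
    LabeledGraph.exists_id_of_mem_path hx.two_le hx.edges hv
  simp only [intersectionNeighbors, ProbeTree.eval_bind, ProbeTree.eval_pure,
    ProbeTree.eval_forEach, pathNeighbors]
  congr 1
  ext y
  rw [Finset.mem_erase, List.mem_toFinset, List.mem_flatten]
  constructor
  · rintro ⟨hyx, l, hl, hy⟩
    obtain ⟨v, hv, rfl⟩ := List.mem_map.1 hl
    obtain ⟨u, rfl⟩ := hval v hv
    rw [Finset.mem_sort, Finset.mem_filter] at hy
    have hyc := (mem_augmentingCodes_localView hi hΔ hy.2).1 hy.1
    exact mem_pathNeighborSet.2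
      ⟨hyc, fun h => hyx (congrArg Subtype.val h).symm, _, hv, hy.2⟩
  · intro hy
    obtain ⟨hyc, hne, v, hv, hvy⟩ := mem_pathNeighborSet.1 hy
    refine ⟨fun h => hne (Subtype.ext h.symm), _, List.mem_map.2 ⟨v, hv, rfl⟩, ?_⟩
    obtain ⟨u, rfl⟩ := hval v hv
    rw [Finset.mem_sort, Finset.mem_filter]
    exact ⟨(mem_augmentingCodes_localView hi hΔ hvy).2 hyc, hvy⟩

theorem eval_intersectionProbe (hi : 1 ≤ i) (hΔ : ∀ v, G.graph.degree v ≤ Δ)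
    (x : (decidedGraph G B i prev).V) (j : ℕ) :
    (intersectionProbe B Δ i prev x.1 j).eval G.answer =
      (decidedGraph G B i prev).answer x.1 j := by
  rw [intersectionGraph_answer, intersectionProbe, ProbeTree.eval_bind,
    eval_intersectionNeighbors hi hΔ x]
  split_ifs with h
  · rw [List.getElem?_eq_getElem h]
    dsimp only
    rw [ProbeTree.eval_bind]
    have := eval_intersectionNeighbors hi hΔ
      (⟨_, (mem_pathNeighbors.1 (List.getElem_mem h)).1⟩ : (decidedGraph G B i prev).V)
    rw [this]
    rfl
  · rw [List.getElem?_eq_none (not_lt.1 h)]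
    rfl

/-- A program that probes the intersection graph may be simulated. -/
theorem simulate_intersectionProbe {α : Type} (hi : 1 ≤ i) (hΔ : ∀ v, G.graph.degree v ≤ Δ)
    {p : ProbeTree α} {S : Set (decidedGraph G B i prev).V}
    (hp : p.ProbesWithin (decidedGraph G B i prev) S) :
    (p.simulate (intersectionProbe B Δ i prev)).eval G.answer =
        p.eval (decidedGraph G B i prev).answer ∧
      (p.probes fun x j => (intersectionProbe B Δ i prev x j).eval G.answer) =
        p.probes (decidedGraph G B i prev).answer := by
  rw [ProbeTree.eval_simulate]
  -- Simulated answers are known to be correct only at nodes of the intersection graph. This is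
  -- enough, because by `hp` no other identifiers are probed.
  refine ProbeTree.eval_probes_congr p fun y hy => ?_
  obtain ⟨x, -, hx⟩ := hp y hy
  rw [← hx]
  exact (eval_intersectionProbe hi hΔ x y.2).symm

/-! #### Distances -/

/-- A walk of length `h` in the intersection graph visits `h + 1` paths, and each is traversed along
at most `2i - 1` edges of `G`. -/
theorem mem_vertexBall_of_intersecting (hi : 1 ≤ i) {x y : (decidedGraph G B i prev).V} {h : ℕ}
    (hxy : y ∈ (decidedGraph G B i prev).vertexBall x h) {u w : G.V}
    (hu : G.id u ∈ decodePath B (2 * i) x.1) (hw : G.id w ∈ decodePath B (2 * i) y.1) :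
    w ∈ G.vertexBall u ((h + 1) * (2 * i - 1)) := by
  have hin : ∀ (z : (decidedGraph G B i prev).V) (a b : G.V),
      G.id a ∈ decodePath B (2 * i) z.1 → G.id b ∈ decodePath B (2 * i) z.1 →
      b ∈ G.vertexBall a (2 * i - 1) := fun z a b ha hb => by
    have hz := decidedGraph_isAugPath hi z
    have := LabeledGraph.mem_vertexBall_of_path hz.two_le hz.edges ha hb
    rwa [length_decodePath] at this
  induction h generalizing y w with
  | zero =>
    rw [LabeledGraph.mem_vertexBall_zero.1 hxy] at hw
    rw [zero_add, one_mul]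
    exact hin x u w hu hw
  | succ h ih =>
    rcases LabeledGraph.mem_vertexBall_succ.1 hxy with hxy | ⟨z, hz, hadj⟩
    · exact LabeledGraph.vertexBall_mono (Nat.mul_le_mul_right _ (by omega)) (ih hxy hw)
    · obtain ⟨-, v, hvz, hvy⟩ := hadj
      have hz' := decidedGraph_isAugPath hi z
      obtain ⟨v, rfl⟩ := LabeledGraph.exists_id_of_mem_path hz'.two_le hz'.edges hvz
      exact LabeledGraph.mem_vertexBall_trans (ih hz hvz) (hin y v w hvy hw)
        (le_of_eq (Nat.succ_mul _ _).symm)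

theorem intersectionNeighbors_probesWithin (hi : 1 ≤ i) (hΔ : ∀ v, G.graph.degree v ≤ Δ) {r : ℕ}
    (hprev : ∀ e ∈ G.idEdges, (prev e).ProbesWithin G (G.edgeBall e r))
    (x : (decidedGraph G B i prev).V) {S : Set G.V}
    (hS : ∀ v, G.id v ∈ decodePath B (2 * i) x.1 → G.vertexBall v (2 * i + r) ⊆ S) :
    (intersectionNeighbors B Δ i prev x.1).ProbesWithin G S := by
  refine .bind (.forEach fun v hv => ?_) (ProbeTree.probesWithin_pure _)
  have hx := decidedGraph_isAugPath hi x
  obtain ⟨v, rfl⟩ := LabeledGraph.exists_id_of_mem_path hx.two_le hx.edges hv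
  refine .bind ((LabeledGraph.localView_probesWithin prev _ v hΔ hprev).mono ?_)
    (ProbeTree.probesWithin_pure _)
  rw [show 2 * i - 1 + 1 + r = 2 * i + r by omega]
  exact hS v hv

/-- The back port requires the neighbors of the neighbor `y`, whose vertices may be `2i - 1` away
from the shared vertex; exploring around them reaches `2i + r` further. -/
theorem intersectionProbe_probesWithin (hi : 1 ≤ i) (hΔ : ∀ v, G.graph.degree v ≤ Δ) {r : ℕ}
    (hprev : ∀ e ∈ G.idEdges, (prev e).ProbesWithin G (G.edgeBall e r))
    (x : (decidedGraph G B i prev).V) (j : ℕ) {S : Set G.V}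
    (hS : ∀ v, G.id v ∈ decodePath B (2 * i) x.1 → G.vertexBall v (4 * i + r) ⊆ S) :
    (intersectionProbe B Δ i prev x.1 j).ProbesWithin G S := by
  refine .bind (intersectionNeighbors_probesWithin hi hΔ hprev x fun v hv =>
    (LabeledGraph.vertexBall_mono (by omega)).trans (hS v hv)) ?_
  rw [eval_intersectionNeighbors hi hΔ x]
  rcases lt_or_ge j (pathNeighbors B (2 * i) G.idEdges (G.decidedEdges prev) x).length with h | h
  swap
  · rw [List.getElem?_eq_none h]
    exact ProbeTree.probesWithin_pure _
  rw [List.getElem?_eq_getElem h]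
  obtain ⟨hy, -, v, hvx, hvy⟩ := mem_pathNeighbors.1 (List.getElem_mem h)
  set y : (decidedGraph G B i prev).V := ⟨_, hy⟩ with hydef
  have hx := decidedGraph_isAugPath hi x
  obtain ⟨v, rfl⟩ := LabeledGraph.exists_id_of_mem_path hx.two_le hx.edges hvx
  refine .bind (intersectionNeighbors_probesWithin hi hΔ hprev y fun w hw => ?_)
    (ProbeTree.probesWithin_pure _)
  refine (LabeledGraph.vertexBall_subset ?_ (by omega : 2 * i - 1 + (2 * i + r) ≤ _)).trans
    (hS v hvx)
  have := mem_vertexBall_of_intersecting hi (LabeledGraph.mem_vertexBall_self y 0) hvy hw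
  rwa [zero_add, one_mul] at this

end Simulation

/-! ### The degrees of the intersection graph -/

section Degree

variable {G : LabeledGraph}

/-- The vertex sequences of the walks with `k` edges that start in `v`. -/
def walksFrom (G : LabeledGraph) : ℕ → G.V → Finset (List G.V)
  | 0, v => {[v]}
  | k + 1, v => (G.graph.neighborFinset v).biUnion fun u => (walksFrom G k u).image (v :: ·)

theorem mem_walksFrom {l : List G.V} {v : G.V} (h : (v :: l).IsChain G.graph.Adj) :
    v :: l ∈ walksFrom G l.length v := by
  induction l generalizing v with
  | nil => simp [walksFrom]
  | cons u l ih =>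
    rw [List.isChain_cons_cons] at h
    exact Finset.mem_biUnion.2 ⟨u, (SimpleGraph.mem_neighborFinset _ _ _).2 h.1,
      Finset.mem_image.2 ⟨_, ih h.2, rfl⟩⟩

theorem card_walksFrom_le {Δ : ℕ} (hΔ : ∀ v, G.graph.degree v ≤ Δ) (k : ℕ) (v : G.V) :
    (walksFrom G k v).card ≤ Δ ^ k := by
  induction k generalizing v with
  | zero => simp [walksFrom]
  | succ k ih =>
    refine (Finset.card_biUnion_le_card_mul _ _ (Δ ^ k) fun u _ =>
      Finset.card_image_le.trans (ih u)).trans ?_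
    rw [SimpleGraph.card_neighborFinset_eq_degree, pow_succ']
    exact Nat.mul_le_mul_right _ (hΔ v)

/-- The vertex sequences of the walks with `j` edges before and `k` edges after a visit of `v`. -/
def walksThrough (G : LabeledGraph) (j k : ℕ) (v : G.V) : Finset (List G.V) :=
  (walksFrom G j v ×ˢ walksFrom G k v).image fun ab => ab.1.tail.reverse ++ ab.2

theorem card_walksThrough_le {Δ : ℕ} (hΔ : ∀ v, G.graph.degree v ≤ Δ) (j k : ℕ) (v : G.V) :
    (walksThrough G j k v).card ≤ Δ ^ (j + k) := by
  refine Finset.card_image_le.trans ?_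
  rw [Finset.card_product, pow_add]
  exact Nat.mul_le_mul (card_walksFrom_le hΔ j v) (card_walksFrom_le hΔ k v)

theorem mem_walksThrough {l₁ l₂ : List G.V} {v : G.V}
    (h : (l₁ ++ v :: l₂).IsChain G.graph.Adj) :
    l₁ ++ v :: l₂ ∈ walksThrough G l₁.length l₂.length v := by
  refine Finset.mem_image.2 ⟨(v :: l₁.reverse, v :: l₂), Finset.mem_product.2 ⟨?_, ?_⟩, by simp⟩
  · have h1 : (l₁ ++ [v]).IsChain G.graph.Adj := by
      have : l₁ ++ v :: l₂ = (l₁ ++ [v]) ++ l₂ := by simp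
      rw [this] at h
      exact h.left_of_append
    have h2 : (v :: l₁.reverse).IsChain G.graph.Adj := by
      rw [← List.isChain_reverse] at h1
      rw [List.reverse_append, List.reverse_singleton, List.singleton_append] at h1
      exact h1.imp fun a b hab => hab.symm
    have := mem_walksFrom h2
    rwa [List.length_reverse] at this
  · exact mem_walksFrom h.right_of_append

/-- A neighbor is determined by a shared vertex (`L` choices), its position on the neighbor (`L`
choices), and the walks leaving it in both directions, which have `L - 1` edges altogether. -/
theorem degree_intersectionGraph_le {B L Δ : ℕ} {M : Finset (Sym2 ℕ)} (hL : 2 ≤ L)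
    (hΔ : ∀ v, G.graph.degree v ≤ Δ) (x : (intersectionGraph B L G.idEdges M).V) :
    (intersectionGraph B L G.idEdges M).graph.degree x ≤ L ^ 2 * Δ ^ (L - 1) := by
  let X : Finset G.V := Finset.univ.filter fun v => G.id v ∈ decodePath B L x.1
  have hX : X.card ≤ L := by
    have h1 : X.card ≤ (decodePath B L x.1).toFinset.card :=
      Finset.card_le_card_of_injOn G.id
        (fun v hv => List.mem_toFinset.2 (Finset.mem_filter.1 hv).2) G.id_injective.injOn
    exact h1.trans ((List.toFinset_card_le _).trans_eq (length_decodePath B L x.1))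
  let T : Finset (List G.V) :=
    X.biUnion fun v => (Finset.range L).biUnion fun j => walksThrough G j (L - 1 - j) v
  have hT : T.card ≤ L ^ 2 * Δ ^ (L - 1) := by
    have h1 : T.card ≤ X.card * (L * Δ ^ (L - 1)) := by
      refine Finset.card_biUnion_le_card_mul _ _ _ fun v _ => ?_
      have := Finset.card_biUnion_le_card_mul (Finset.range L)
        (fun j => walksThrough G j (L - 1 - j) v) (Δ ^ (L - 1)) fun j hj => by
          rw [Finset.mem_range] at hj
          have := card_walksThrough_le hΔ j (L - 1 - j) v
          rwa [show j + (L - 1 - j) = L - 1 by omega] at this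
      rwa [Finset.card_range] at this
    refine h1.trans ((Nat.mul_le_mul_right _ hX).trans_eq ?_)
    ring
  refine le_trans ?_ hT
  rw [← SimpleGraph.card_neighborFinset_eq_degree]
  have hinj : Set.InjOn (fun y : (intersectionGraph B L G.idEdges M).V => decodePath B L y.1)
      ((intersectionGraph B L G.idEdges M).graph.neighborFinset x) := fun y _ z _ h =>
    Subtype.ext (decodePath_injOn (mem_augmentingCodes.1 y.2).1 (mem_augmentingCodes.1 z.2).1 h)
  rw [← Finset.card_image_of_injOn hinj]
  refine (Finset.card_le_card (t := T.image (List.map G.id)) ?_).trans Finset.card_image_le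
  intro p hp
  obtain ⟨y, hy, rfl⟩ := Finset.mem_image.1 hp
  rw [SimpleGraph.mem_neighborFinset, intersectionGraph_adj] at hy
  obtain ⟨-, v, hvx, hvy⟩ := hy
  have hlen := length_decodePath B L y.1
  have hyp := ((isAugmenting_iff (by omega)).1 (mem_augmentingCodes.1 y.2).2).1
  obtain ⟨l, hl, hc⟩ := LabeledGraph.exists_vertex_list (by omega) hyp.edges
  change decodePath B L y.1 ∈ _
  rw [← hl] at hvy hlen ⊢
  obtain ⟨u, hu, rfl⟩ := List.mem_map.1 hvy
  obtain ⟨l₁, l₂, rfl⟩ := List.append_of_mem hu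
  refine Finset.mem_image_of_mem _ (Finset.mem_biUnion.2 ⟨u, ?_, Finset.mem_biUnion.2
    ⟨l₁.length, ?_, ?_⟩⟩)
  · exact Finset.mem_filter.2 ⟨Finset.mem_univ _, hvx⟩
  · simp at hlen
    rw [Finset.mem_range]
    omega
  · have : L - 1 - l₁.length = l₂.length := by
      simp at hlen
      omega
    rw [this]
    exact mem_walksThrough hc

end Degree

/-! ### The greedy maximal independent set -/

section GreedyMIS

variable {H : LabeledGraph} {color : ℕ → ProbeTree ℕ} {D : ℕ}

theorem eval_greedyMIS_succ (ans : ℕ → ℕ → Option (ℕ × ℕ)) (t x : ℕ) :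
    (greedyMIS color D (t + 1) x).eval ans =
      ((neighbors D x).eval ans).all fun y =>
        !(if (color y).eval ans < (color x).eval ans then (greedyMIS color D t y).eval ans
          else false) := by
  simp only [greedyMIS, ProbeTree.eval_bind, ProbeTree.eval_pure, ProbeTree.eval_forEach,
    List.all_map]
  congr 1
  funext y
  simp only [Function.comp_apply]
  split_ifs <;> rfl

/-- Colors strictly decrease along the recursion, so any depth bound that is at least the color
gives the same answer. The resulting fixed point equation yields both independence and maximality.
-/
theorem eval_greedyMIS (hD : ∀ v, H.graph.degree v ≤ D) (t : ℕ) (v : H.V)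
    (ht : (color (H.id v)).eval H.answer ≤ t) :
    (greedyMIS color D t (H.id v)).eval H.answer = true ↔
      ∀ u, H.graph.Adj v u → (color (H.id u)).eval H.answer < (color (H.id v)).eval H.answer →
        ¬ (greedyMIS color D ((color (H.id u)).eval H.answer) (H.id u)).eval H.answer = true := by
  induction t using Nat.strong_induction_on generalizing v with
  | h t ih =>
    cases t with
    | zero =>
      refine ⟨fun _ u _ h => ?_, fun _ => rfl⟩
      omega
    | succ t =>
      rw [eval_greedyMIS_succ, List.all_eq_true]
      -- By induction the runs with depth `t` and with depth equal to the color of `u` satisfy the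
      -- same characterization, so they agree.
      have key : ∀ u, (color (H.id u)).eval H.answer < (color (H.id v)).eval H.answer →
          ((greedyMIS color D t (H.id u)).eval H.answer = true ↔
            (greedyMIS color D ((color (H.id u)).eval H.answer) (H.id u)).eval H.answer =
              true) := fun u hu =>
        (ih t (Nat.lt_succ_self t) u (by omega)).trans (ih _ (by omega) u le_rfl).symm
      constructor
      · intro h u hu hlt h'
        have h1 := h _ ((LabeledGraph.mem_eval_neighbors (hD v)).2 ⟨u, hu, rfl⟩)
        rw [if_pos hlt, (key u hlt).2 h'] at h1
        exact Bool.false_ne_true h1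
      · intro h y hy
        obtain ⟨u, hu, rfl⟩ := (LabeledGraph.mem_eval_neighbors (hD v)).1 hy
        split_ifs with hlt
        · have h1 := h u hu hlt
          rw [← key u hlt] at h1
          simpa using h1
        · rfl

theorem greedyMIS_probesWithin {R : ℕ} (hD : ∀ v, H.graph.degree v ≤ D)
    (hR : ∀ v, (color (H.id v)).ProbesWithin H (H.vertexBall v R)) (t : ℕ) (v : H.V) :
    (greedyMIS color D t (H.id v)).ProbesWithin H (H.vertexBall v (t + R)) := by
  induction t generalizing v with
  | zero => exact ProbeTree.probesWithin_pure _
  | succ t ih =>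
    refine .bind ((hR v).mono (LabeledGraph.vertexBall_mono (by omega)))
      (.bind (LabeledGraph.neighbors_probesWithin (LabeledGraph.mem_vertexBall_self _ _))
        (.bind (.forEach fun y hy => ?_) (ProbeTree.probesWithin_pure _)))
    obtain ⟨u, hu, rfl⟩ := (LabeledGraph.mem_eval_neighbors (hD v)).1 hy
    have hsub : ∀ s ≤ t + R, H.vertexBall u s ⊆ H.vertexBall v (t + 1 + R) := fun s hs =>
      LabeledGraph.vertexBall_subset (LabeledGraph.mem_vertexBall_of_adj hu) (by omega)
    refine .bind ((hR u).mono (hsub R (by omega))) ?_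
    split_ifs
    · exact (ih u).mono (hsub _ le_rfl)
    · exact ProbeTree.probesWithin_pure _

variable {C : ColoringAlgorithm} {κ N : ℕ}

theorem eval_lmis (hD : ∀ v, H.graph.degree v ≤ D) (v : H.V) :
    (lmis C N D (H.id v)).eval H.answer = true ↔
      ∀ u, H.graph.Adj v u → (C N D (H.id u)).eval H.answer < (C N D (H.id v)).eval H.answer →
        ¬ (lmis C N D (H.id u)).eval H.answer = true := by
  simp only [lmis, ProbeTree.eval_bind]
  exact eval_greedyMIS hD _ v le_rfl

/-- Of two adjacent nodes, the one with the higher color is kept out by the other; a tie is excluded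
by properness. -/
theorem lmis_independent (hC : C.IsPolyColoring κ) (hN : ∀ v, H.id v < N)
    (hD : ∀ v, H.graph.degree v ≤ D) {u v : H.V} (huv : H.graph.Adj u v)
    (hu : (lmis C N D (H.id u)).eval H.answer = true) :
    ¬ (lmis C N D (H.id v)).eval H.answer = true := by
  intro hv
  rcases Nat.lt_or_gt_of_ne ((hC N D H hN hD).2.1 u v huv) with h | h
  · exact (eval_lmis hD v).1 hv u huv.symm h hu
  · exact (eval_lmis hD u).1 hu v huv h hv

theorem lmis_maximal (hD : ∀ v, H.graph.degree v ≤ D) (v : H.V) :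
    (lmis C N D (H.id v)).eval H.answer = true ∨
      ∃ u, H.graph.Adj v u ∧ (lmis C N D (H.id u)).eval H.answer = true := by
  by_contra! h
  exact h.1 ((eval_lmis hD v).2 fun u hu _ => h.2 u hu)

/-- The probe radius of the maximal independent set algorithm. -/
noncomputable def misRadius (κ N D : ℕ) : ℕ :=
  κ * (D + 1) ^ κ + κ * (logStar N + (D + 1) ^ κ)

/-- The search descends at most as many levels as the color of its start, which is less than `κ (D +
1) ^ κ`, and runs the coloring algorithm at the nodes it meets. -/
theorem lmis_probesWithin (hC : C.IsPolyColoring κ) (hN : ∀ v, H.id v < N)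
    (hD : ∀ v, H.graph.degree v ≤ D) (v : H.V) :
    (lmis C N D (H.id v)).ProbesWithin H (H.vertexBall v (misRadius κ N D)) := by
  obtain ⟨h1, -, h2⟩ := hC N D H hN hD
  refine .bind ((h2 v).mono (LabeledGraph.vertexBall_mono (Nat.le_add_left _ _)))
    ((greedyMIS_probesWithin hD h2 _ v).mono (LabeledGraph.vertexBall_mono ?_))
  exact Nat.add_le_add_right (h1 v).le _

end GreedyMIS

/-! ### The oracle -/

section Oracle

variable {G : LabeledGraph} {C : ColoringAlgorithm} {κ B Δ i : ℕ}
  {prev : Sym2 ℕ → ProbeTree Bool}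

/-- The bound on the degrees in the intersection graph. -/
def pathDegree (Δ i : ℕ) : ℕ := (2 * i) ^ 2 * Δ ^ (2 * i - 1)

theorem degree_decidedGraph_le (hi : 1 ≤ i) (hΔ : ∀ v, G.graph.degree v ≤ Δ)
    (x : (decidedGraph G B i prev).V) :
    (decidedGraph G B i prev).graph.degree x ≤ pathDegree Δ i :=
  degree_intersectionGraph_le (by omega) hΔ x

theorem id_decidedGraph_lt (x : (decidedGraph G B i prev).V) :
    (decidedGraph G B i prev).id x < B ^ (2 * i) := (mem_augmentingCodes.1 x.2).1

/-- The paths in the maximal independent set. -/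
def InMIS (C : ColoringAlgorithm) (Δ : ℕ) (x : (decidedGraph G B i prev).V) : Prop :=
  (lmis C (B ^ (2 * i)) (pathDegree Δ i) ((decidedGraph G B i prev).id x)).eval
    (decidedGraph G B i prev).answer = true

theorem exists_inf_sup {e : Sym2 ℕ} (he : e ∈ G.idEdges) :
    ∃ u v, G.graph.Adj u v ∧ e = s(G.id u, G.id v) ∧ e.inf = G.id u ∧ e.sup = G.id v := by
  obtain ⟨u, v, h, rfl⟩ := LabeledGraph.mem_idEdges.1 he
  rcases le_total (G.id u) (G.id v) with h1 | h1
  · exact ⟨u, v, h, rfl, by simp [h1], by simp [h1]⟩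
  · exact ⟨v, u, h.symm, Sym2.eq_swap, by simp [h1], by simp [h1]⟩

variable (B Δ i prev) in
/-- The list of the augmenting paths through an edge. -/
def pathsThrough (e : Sym2 ℕ) : ProbeTree (List ℕ) := do
  let w₁ ← localView Δ prev (2 * i - 1) e.inf
  let w₂ ← localView Δ prev (2 * i - 1) e.sup
  let P := (augmentingCodes B (2 * i) (w₁.1 ∪ w₂.1) (w₁.2 ∪ w₂.2)).filter fun x =>
    e ∈ pathEdges (decodePath B (2 * i) x)
  pure (P.sort (· ≤ ·))

theorem mem_eval_pathsThrough (hi : 1 ≤ i) (hΔ : ∀ v, G.graph.degree v ≤ Δ) {e : Sym2 ℕ}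
    (he : e ∈ G.idEdges) {x : ℕ} :
    x ∈ (pathsThrough B Δ i prev e).eval G.answer ↔
      x ∈ augmentingCodes B (2 * i) G.idEdges (G.decidedEdges prev) ∧
        e ∈ pathEdges (decodePath B (2 * i) x) := by
  obtain ⟨u, v, -, rfl, h1, h2⟩ := exists_inf_sup he
  simp only [pathsThrough, ProbeTree.eval_bind, ProbeTree.eval_pure, Finset.mem_sort,
    Finset.mem_filter, h1, h2]
  refine and_congr_left fun hex => ?_
  have hlen := length_decodePath B (2 * i) x
  have hu := mem_of_mem_pathEdges hex (Sym2.mem_mk_left _ _)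
  rw [mem_augmentingCodes, mem_augmentingCodes, isAugmenting_congr (by omega)
    (Finset.union_subset (LabeledGraph.eval_localView_fst_subset prev _ u hΔ)
      (LabeledGraph.eval_localView_fst_subset prev _ v hΔ))
    (fun f => ?_) (LabeledGraph.decidedEdges_subset prev)]
  -- The path runs through both endpoints of the edge, so the view around one of them already
  -- contains all edges at its vertices.
  · intro hpE f hf y hy hyf
    exact Finset.mem_union_left _ (LabeledGraph.mem_eval_localView_of_path prev _ u hΔ (by omega)
      (by rw [hlen]) hpE hu hf hy hyf)
  · rw [Finset.mem_union, Finset.mem_union, LabeledGraph.mem_eval_localView_snd prev _ u hΔ,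
      LabeledGraph.mem_eval_localView_snd prev _ v hΔ]
    tauto

theorem eval_procA_eq (e : Sym2 ℕ) (ans : ℕ → ℕ → Option (ℕ × ℕ)) :
    (procA C B Δ i prev e).eval ans =
      (((pathsThrough B Δ i prev e).eval ans).map fun x =>
        ((lmis C (B ^ (2 * i)) (pathDegree Δ i) x).simulate
          (intersectionProbe B Δ i prev)).eval ans).any fun b => b := by
  simp [procA, pathsThrough, pathDegree]

theorem eval_procA (hC : C.IsPolyColoring κ) (hi : 1 ≤ i) (hΔ : ∀ v, G.graph.degree v ≤ Δ)
    {e : Sym2 ℕ} (he : e ∈ G.idEdges) :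
    (procA C B Δ i prev e).eval G.answer = true ↔
      ∃ x : (decidedGraph G B i prev).V, e ∈ pathEdges (decodePath B (2 * i) x.1) ∧
        InMIS C Δ x := by
  have hsim : ∀ x : (decidedGraph G B i prev).V,
      ((lmis C (B ^ (2 * i)) (pathDegree Δ i) x.1).simulate
        (intersectionProbe B Δ i prev)).eval G.answer = true ↔ InMIS C Δ x := fun x => by
    have h := (simulate_intersectionProbe hi hΔ (lmis_probesWithin hC id_decidedGraph_lt
      (degree_decidedGraph_le hi hΔ) x)).1
    exact Iff.of_eq (congrArg (fun b => b = true) h)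
  rw [eval_procA_eq, List.any_map, List.any_eq_true]
  constructor
  · rintro ⟨x, hx, h⟩
    obtain ⟨hxc, hex⟩ := (mem_eval_pathsThrough hi hΔ he).1 hx
    exact ⟨⟨x, hxc⟩, hex, (hsim ⟨x, hxc⟩).1 h⟩
  · rintro ⟨x, hex, h⟩
    exact ⟨x.1, (mem_eval_pathsThrough hi hΔ he).2 ⟨x.2, hex⟩, (hsim x).2 h⟩

/-- Probed nodes have distance at most `ρ` from a path through `e`, hence their vertices are within
`(ρ + 1)(2i - 1)` of `e`, and answering a probe adds `4i + r`. The radius `r` of the previous oracle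
enters only additively. -/
theorem procA_probesWithin (hC : C.IsPolyColoring κ) (hi : 1 ≤ i)
    (hΔ : ∀ v, G.graph.degree v ≤ Δ) {r : ℕ}
    (hprev : ∀ e ∈ G.idEdges, (prev e).ProbesWithin G (G.edgeBall e r)) {e : Sym2 ℕ}
    (he : e ∈ G.idEdges) :
    (procA C B Δ i prev e).ProbesWithin G
      (G.edgeBall e (r + 2 * i * (misRadius κ (B ^ (2 * i)) (pathDegree Δ i) + 3))) := by
  obtain ⟨u, v, -, heq, h1, h2⟩ := exists_inf_sup he
  have hue : G.id u ∈ e := heq ▸ Sym2.mem_mk_left _ _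
  have hve : G.id v ∈ e := heq ▸ Sym2.mem_mk_right _ _
  set ρ := misRadius κ (B ^ (2 * i)) (pathDegree Δ i) with hρ
  have hview : ∀ w, G.id w ∈ e →
      (localView Δ prev (2 * i - 1) (G.id w)).ProbesWithin G
        (G.edgeBall e (r + 2 * i * (ρ + 3))) := fun w hw =>
    (LabeledGraph.localView_probesWithin prev _ w hΔ hprev).mono
      (LabeledGraph.vertexBall_subset_edgeBall (r := 0)
        ⟨w, hw, LabeledGraph.mem_vertexBall_self _ _⟩ (by
          have : 2 * i * 3 ≤ 2 * i * (ρ + 3) := Nat.mul_le_mul_left _ (by omega)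
          omega))
  refine .bind (by rw [h1]; exact hview u hue)
    (.bind (by rw [h2]; exact hview v hve) (.bind (.forEach fun x hx => ?_)
      (ProbeTree.probesWithin_pure _)))
  have hx' : x ∈ (pathsThrough B Δ i prev e).eval G.answer := by
    simpa only [pathsThrough, ProbeTree.eval_bind, ProbeTree.eval_pure] using hx
  obtain ⟨hxc, hex⟩ := (mem_eval_pathsThrough hi hΔ he).1 hx'
  have hwithin := lmis_probesWithin hC id_decidedGraph_lt
    (degree_decidedGraph_le hi hΔ) (⟨x, hxc⟩ : (decidedGraph G B i prev).V)
  intro z hz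
  change z ∈ ((lmis C (B ^ (2 * i)) (pathDegree Δ i)
    ((decidedGraph G B i prev).id ⟨x, hxc⟩)).simulate _).probes _ at hz
  rw [ProbeTree.probes_simulate, (simulate_intersectionProbe hi hΔ hwithin).2,
    List.mem_flatMap] at hz
  obtain ⟨y, hy, hz⟩ := hz
  obtain ⟨x', hx', hxy⟩ := hwithin y hy
  rw [← hxy] at hz
  refine intersectionProbe_probesWithin hi hΔ hprev x' y.2 (fun w hw => ?_) z hz
  have hu : G.id u ∈ decodePath B (2 * i) x := mem_of_mem_pathEdges hex hue
  have hball := mem_vertexBall_of_intersecting hi hx' hu hw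
  refine LabeledGraph.vertexBall_subset_edgeBall ⟨u, hue, hball⟩ ?_
  have h3 : (ρ + 1) * (2 * i - 1) ≤ (ρ + 1) * (2 * i) := Nat.mul_le_mul_left _ (by omega)
  calc (ρ + 1) * (2 * i - 1) + (4 * i + r) ≤ (ρ + 1) * (2 * i) + (4 * i + r) := by omega
    _ = r + 2 * i * (ρ + 3) := by ring

/-- One round of the oracle: the matching is augmented along a maximal set of vertex-disjoint
shortest augmenting paths. -/
theorem decidedEdges_succ (hC : C.IsPolyColoring κ) (hi : 1 ≤ i)
    (hΔ : ∀ v, G.graph.degree v ≤ Δ) (hB : ∀ v, G.id v < B)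
    (hM : IsEdgeMatching (G.decidedEdges prev))
    (hmin : ∀ p, IsAugPath G.idEdges (G.decidedEdges prev) p → 2 * i ≤ p.length)
    {M' : Finset (Sym2 ℕ)}
    (hM' : ∀ e, e ∈ M' ↔ e ∈ G.idEdges ∧
      xor ((prev e).eval G.answer) ((procA C B Δ i prev e).eval G.answer) = true) :
    IsEdgeMatching M' ∧ ∀ p, IsAugPath G.idEdges M' p → 2 * (i + 1) ≤ p.length := by
  classical
  let S : Finset (List ℕ) := ((Finset.univ : Finset (decidedGraph G B i prev).V).filter
    fun x => InMIS C Δ x).image fun x => decodePath B (2 * i) x.1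
  have hmemS : ∀ p, p ∈ S ↔ ∃ x : (decidedGraph G B i prev).V, InMIS C Δ x ∧
      decodePath B (2 * i) x.1 = p := fun p => by simp [S]
  have hMS : M' = symmDiff (G.decidedEdges prev)
      (S.biUnion fun p => (pathEdges p).toFinset) := by
    ext e
    rw [hM', Finset.mem_symmDiff, Finset.mem_biUnion, LabeledGraph.decidedEdges,
      Finset.mem_filter]
    have hS : (∃ p ∈ S, e ∈ (pathEdges p).toFinset) ↔
        e ∈ G.idEdges ∧ (procA C B Δ i prev e).eval G.answer = true := by
      constructor
      · rintro ⟨p, hp, hep⟩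
        obtain ⟨x, hx, rfl⟩ := (hmemS p).1 hp
        rw [List.mem_toFinset] at hep
        have he := (decidedGraph_isAugPath hi x).edges e hep
        exact ⟨he, (eval_procA hC hi hΔ he).2 ⟨x, hep, hx⟩⟩
      · rintro ⟨he, h⟩
        obtain ⟨x, hex, hx⟩ := (eval_procA hC hi hΔ he).1 h
        exact ⟨_, (hmemS _).2 ⟨x, hx, rfl⟩, List.mem_toFinset.2 hex⟩
    rw [hS]
    cases (prev e).eval G.answer <;> cases (procA C B Δ i prev e).eval G.answer <;> simp
  have hSaug : ∀ p ∈ S, IsAugPath G.idEdges (G.decidedEdges prev) p ∧ p.length = 2 * i := by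
    intro p hp
    obtain ⟨x, -, rfl⟩ := (hmemS p).1 hp
    exact ⟨decidedGraph_isAugPath hi x, length_decodePath _ _ _⟩
  have hSdisj : ∀ p ∈ S, ∀ q ∈ S, p ≠ q → ∀ v ∈ p, v ∉ q := by
    intro p hp q hq hpq v hvp hvq
    obtain ⟨x, hx, rfl⟩ := (hmemS p).1 hp
    obtain ⟨y, hy, rfl⟩ := (hmemS q).1 hq
    exact lmis_independent hC id_decidedGraph_lt (degree_decidedGraph_le hi hΔ)
      (intersectionGraph_adj.2 ⟨fun h => hpq (by rw [h]), v, hvp, hvq⟩) hx hy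
  have hSmax : ∀ p, IsAugmenting G.idEdges (G.decidedEdges prev) p → p.length = 2 * i →
      ∃ q ∈ S, ∃ v ∈ p, v ∈ q := by
    intro p hp hlen
    have hp' := ((isAugmenting_iff (by omega)).1 hp).1
    obtain ⟨x, hxB, hxp⟩ := exists_decodePath (B := B) p fun y hy => by
      obtain ⟨w, rfl⟩ := LabeledGraph.exists_id_of_mem_path hp'.two_le hp'.edges hy
      exact hB w
    rw [hlen] at hxB hxp
    have hxc : x ∈ augmentingCodes B (2 * i) G.idEdges (G.decidedEdges prev) :=
      mem_augmentingCodes.2 ⟨hxB, by rwa [hxp]⟩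
    rcases lmis_maximal (C := C) (N := B ^ (2 * i)) (degree_decidedGraph_le hi hΔ)
      (⟨x, hxc⟩ : (decidedGraph G B i prev).V) with h | ⟨y, hadj, hy⟩
    · obtain ⟨w, l, rfl⟩ := List.exists_cons_of_ne_nil (l := p)
        (by rintro rfl; simp at hlen; omega)
      exact ⟨_, (hmemS _).2 ⟨⟨x, hxc⟩, h, hxp⟩, w, List.mem_cons_self, List.mem_cons_self⟩
    · obtain ⟨-, w, hwx, hwy⟩ := intersectionGraph_adj.1 hadj
      exact ⟨_, (hmemS _).2 ⟨y, hy, rfl⟩, w, hxp ▸ hwx, hwy⟩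
  rw [hMS]
  have hME := LabeledGraph.decidedEdges_subset (G := G) prev
  refine ⟨(augment_disjoint hM hME S (fun p hp => (hSaug p hp).1) hSdisj).1, fun p hp => ?_⟩
  refine hopcroft_karp hM hME hmin S hSaug hSdisj (fun q hq hlen => ?_) hp
  -- Nodes of `H_i` list a path in one direction only; the reverse has the same vertices, so
  -- maximality covers both.
  rcases hq.isAugmenting_or_reverse with h | h
  · exact hSmax q h hlen
  · obtain ⟨q', hq', v, hv, hvq'⟩ := hSmax q.reverse h (by rw [List.length_reverse, hlen])
    exact ⟨q', hq', v, List.mem_reverse.1 hv, hvq'⟩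

/-- The invariant of the algorithm of Hopcroft and Karp. For the empty matching it only says that an
augmenting path has at least two vertices. -/
theorem oracle_matching (hC : C.IsPolyColoring κ) (hΔ : ∀ v, G.graph.degree v ≤ Δ)
    (hB : ∀ v, G.id v < B) (i : ℕ) :
    IsEdgeMatching (G.decidedEdges (oracle C B Δ i)) ∧
      ∀ p, IsAugPath G.idEdges (G.decidedEdges (oracle C B Δ i)) p → 2 * (i + 1) ≤ p.length := by
  induction i with
  | zero =>
    have : G.decidedEdges (oracle C B Δ 0) = ∅ := by
      simp [LabeledGraph.decidedEdges, oracle]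
    rw [this]
    exact ⟨⟨by simp, by simp⟩, fun p hp => hp.two_le⟩
  | succ i ih =>
    refine decidedEdges_succ hC (Nat.succ_pos i) hΔ hB ih.1 ih.2 fun e => ?_
    simp [LabeledGraph.decidedEdges, oracle]

/-- The probe radius of the oracle. -/
noncomputable def oracleRadius (κ B Δ : ℕ) : ℕ → ℕ
  | 0 => 0
  | i + 1 => oracleRadius κ B Δ i +
      2 * (i + 1) * (misRadius κ (B ^ (2 * (i + 1))) (pathDegree Δ (i + 1)) + 3)

theorem oracle_probesWithin (hC : C.IsPolyColoring κ) (hΔ : ∀ v, G.graph.degree v ≤ Δ) (i : ℕ) :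
    ∀ e ∈ G.idEdges,
      (oracle C B Δ i e).ProbesWithin G (G.edgeBall e (oracleRadius κ B Δ i)) := by
  induction i with
  | zero => exact fun e _ => ProbeTree.probesWithin_pure _
  | succ i ih =>
    intro e he
    refine .bind ((ih e he).mono ?_) (.bind (procA_probesWithin hC (Nat.succ_pos i) hΔ ih he)
      (ProbeTree.probesWithin_pure _))
    rintro w ⟨v, hv, hw⟩
    exact ⟨v, hv, LabeledGraph.vertexBall_mono (Nat.le_add_right _ _) hw⟩

end Oracle

/-! ### The main theorem -/

/-! ### Closed form of the probe radius -/

section Radius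

variable {κ a n Δ k : ℕ}

theorem pathDegree_le (hΔ : 1 ≤ Δ) {i : ℕ} (hik : i ≤ k) :
    pathDegree Δ i ≤ (2 * k) ^ 2 * Δ ^ (2 * k) :=
  Nat.mul_le_mul (Nat.pow_le_pow_left (by omega) 2) (Nat.pow_le_pow_right hΔ (by omega))

theorem misRadius_le (hn : 1 ≤ n) (hΔ : 1 ≤ Δ) {i : ℕ} (hik : i ≤ k) :
    misRadius κ ((a * n ^ a + 1) ^ (2 * i)) (pathDegree Δ i) ≤
      2 * κ * ((2 * k) ^ 2 * Δ ^ (2 * k) + 1) ^ κ + κ * (logStar n + (4 * k * a + 6)) := by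
  have h1 := Nat.pow_le_pow_left (Nat.succ_le_succ (pathDegree_le hΔ hik)) κ
  have h2 : logStar ((a * n ^ a + 1) ^ (2 * i)) ≤ logStar n + (4 * k * a + 6) := by
    refine (logStar_pow_le a n i hn).trans ?_
    have : 4 * i * a ≤ 4 * k * a := Nat.mul_le_mul_right _ (by omega)
    omega
  have h3 := Nat.mul_le_mul_left κ h1
  have h4 := Nat.mul_le_mul_left κ h2
  simp only [Nat.succ_eq_add_one] at h3
  rw [misRadius, mul_add κ (logStar _)]
  nlinarith

/-- Each of the `k` rounds is bounded by the worst case at `i = k`. -/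
theorem oracleRadius_le (hn : 1 ≤ n) (hΔ : 1 ≤ Δ) :
    oracleRadius κ (a * n ^ a + 1) Δ k ≤ k * (2 * k *
      (2 * κ * ((2 * k) ^ 2 * Δ ^ (2 * k) + 1) ^ κ + κ * (logStar n + (4 * k * a + 6)) + 3)) := by
  obtain ⟨Y, hY⟩ : ∃ Y, 2 * κ * ((2 * k) ^ 2 * Δ ^ (2 * k) + 1) ^ κ +
    κ * (logStar n + (4 * k * a + 6)) + 3 = Y := ⟨_, rfl⟩
  rw [hY]
  have key : ∀ j ≤ k, oracleRadius κ (a * n ^ a + 1) Δ j ≤ j * (2 * k * Y) := by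
    intro j
    induction j with
    | zero => intro _; exact Nat.zero_le _
    | succ j ih =>
      intro hj
      rw [oracleRadius, Nat.succ_mul j]
      have hstep : misRadius κ ((a * n ^ a + 1) ^ (2 * (j + 1))) (pathDegree Δ (j + 1)) + 3 ≤ Y :=
        hY ▸ Nat.add_le_add_right (misRadius_le hn hΔ hj) 3
      exact Nat.add_le_add (ih (by omega)) (Nat.mul_le_mul (by omega) hstep)
  exact key k le_rfl

/-- For `Δ ≥ 2`, factors such as `k ≤ 2 ^ k ≤ Δ ^ k` and all constants fit into a power of `Δ` whose
exponent is a multiple of `k`. The `log*` term is split off beforehand. -/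
theorem oracleRadius_le_pow (hn : 1 ≤ n) (hΔ : 2 ≤ Δ) (hk : 1 ≤ k) :
    oracleRadius κ (a * n ^ a + 1) Δ k ≤
      Δ ^ (k * (13 * κ + 4 * κ * a + 6)) + 2 * k ^ 2 * κ * logStar n := by
  refine (oracleRadius_le hn (by omega)).trans ?_
  have hpow2 : ∀ m, 2 ^ m ≤ Δ ^ m := fun m => Nat.pow_le_pow_left hΔ m
  have hk2 : k ≤ Δ ^ k := Nat.lt_two_pow_self.le.trans (hpow2 k)
  have h2k : 2 * k ≤ Δ ^ k := by
    refine le_trans ?_ (hpow2 k)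
    obtain ⟨m, rfl⟩ : ∃ m, k = m + 1 := ⟨k - 1, by omega⟩
    have : m + 1 ≤ 2 ^ m := Nat.lt_two_pow_self
    rw [pow_succ]
    omega
  -- This collects the coefficients in `hsum`: `2κ` from the coloring, `4κa` and `6κ` from the bound
  -- on `log*`, and the summand 3.
  set s := 8 * κ + 4 * κ * a + 3 with hs
  have hsΔ : s ≤ Δ ^ (k * s) := by
    refine Nat.lt_two_pow_self.le.trans ((hpow2 s).trans ?_)
    exact Nat.pow_le_pow_right (by omega) (Nat.le_mul_of_pos_left _ hk)
  -- The factors `(2k)²` and `Δ ^ (2k)` account for `4k`; one more factor `Δ ≥ 2` absorbs the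
  -- summand 1.
  have hD : (2 * k) ^ 2 * Δ ^ (2 * k) + 1 ≤ Δ ^ (5 * k) := by
    have h1 : (2 * k) ^ 2 * Δ ^ (2 * k) ≤ Δ ^ (4 * k) := by
      calc (2 * k) ^ 2 * Δ ^ (2 * k) ≤ (Δ ^ k) ^ 2 * Δ ^ (2 * k) :=
            Nat.mul_le_mul_right _ (Nat.pow_le_pow_left h2k 2)
        _ = Δ ^ (4 * k) := by rw [← pow_mul, ← pow_add]; congr 1; ring
    have h2 : 1 ≤ Δ ^ (4 * k) := Nat.one_le_pow _ _ (by omega)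
    calc (2 * k) ^ 2 * Δ ^ (2 * k) + 1 ≤ Δ ^ (4 * k) * 2 := by omega
      _ ≤ Δ ^ (4 * k) * Δ := Nat.mul_le_mul_left _ hΔ
      _ = Δ ^ (4 * k + 1) := (pow_succ _ _).symm
      _ ≤ Δ ^ (5 * k) := Nat.pow_le_pow_right (by omega) (by omega)
  set X := Δ ^ (5 * k * κ) with hX
  have hX1 : 1 ≤ X := Nat.one_le_pow _ _ (by omega)
  have hDκ : ((2 * k) ^ 2 * Δ ^ (2 * k) + 1) ^ κ ≤ X := by
    exact (Nat.pow_le_pow_left hD κ).trans_eq (pow_mul _ _ _).symm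
  have hsum : 2 * κ * ((2 * k) ^ 2 * Δ ^ (2 * k) + 1) ^ κ + κ * (4 * k * a + 6) + 3 ≤
      k * s * X := by
    have hkX : 1 ≤ k * X := Nat.mul_pos hk hX1
    have e1 : 2 * κ * ((2 * k) ^ 2 * Δ ^ (2 * k) + 1) ^ κ ≤ 2 * κ * (k * X) :=
      Nat.mul_le_mul_left _ (hDκ.trans (Nat.le_mul_of_pos_left _ hk))
    have e2 : κ * (4 * k * a) ≤ 4 * κ * a * (k * X) := by
      calc κ * (4 * k * a) = 4 * κ * a * (k * 1) := by ring
        _ ≤ 4 * κ * a * (k * X) := Nat.mul_le_mul_left _ (Nat.mul_le_mul_left _ hX1)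
    have e3 : (6 * κ + 3) * 1 ≤ (6 * κ + 3) * (k * X) := Nat.mul_le_mul_left _ hkX
    calc 2 * κ * ((2 * k) ^ 2 * Δ ^ (2 * k) + 1) ^ κ + κ * (4 * k * a + 6) + 3
        = 2 * κ * ((2 * k) ^ 2 * Δ ^ (2 * k) + 1) ^ κ + κ * (4 * k * a) + (6 * κ + 3) * 1 := by
          ring
      _ ≤ 2 * κ * (k * X) + 4 * κ * a * (k * X) + (6 * κ + 3) * (k * X) :=
          Nat.add_le_add (Nat.add_le_add e1 e2) e3
      _ = k * s * X := by rw [hs]; ring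
  have hmain : k * (2 * k * (k * s * X)) ≤ Δ ^ (k * (13 * κ + 4 * κ * a + 6)) := by
    calc k * (2 * k * (k * s * X)) ≤ Δ ^ k * (Δ ^ k * (Δ ^ k * Δ ^ (k * s) * X)) :=
          Nat.mul_le_mul hk2 (Nat.mul_le_mul h2k (Nat.mul_le_mul_right _
            (Nat.mul_le_mul hk2 hsΔ)))
      _ = Δ ^ (k * (13 * κ + 4 * κ * a + 6)) := by
          rw [hX, ← pow_add, ← pow_add, ← pow_add, ← pow_add]
          congr 1
          rw [hs]
          ring
  have hsplit : k * (2 * k * (2 * κ * ((2 * k) ^ 2 * Δ ^ (2 * k) + 1) ^ κ +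
      κ * (logStar n + (4 * k * a + 6)) + 3)) =
      k * (2 * k * (2 * κ * ((2 * k) ^ 2 * Δ ^ (2 * k) + 1) ^ κ + κ * (4 * k * a + 6) + 3)) +
        2 * k ^ 2 * κ * logStar n := by ring
  rw [hsplit]
  exact Nat.add_le_add_right ((Nat.mul_le_mul_left _ (Nat.mul_le_mul_left _ hsum)).trans hmain) _

theorem ceil_inv_le {ε : ℝ} (h0 : 0 < ε) (h1 : ε < 1) :
    ((1 + ⌈1 / ε⌉₊ : ℕ) : ℝ) ≤ 3 / ε := by
  have h2 : 1 < 1 / ε := by rwa [lt_div_iff₀ h0, one_mul]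
  have h3 := Nat.ceil_lt_add_one (show 0 ≤ 1 / ε by linarith)
  have h4 : 3 / ε = 3 * (1 / ε) := by ring
  push_cast
  linarith

/-- From `k ≤ 3 / ε` come the factor 3 in the exponent of `Δ` and `18 = 2 · 3²` in front of `log*`;
their sum serves as a common constant. -/
theorem oracleRadius_real_le {ε : ℝ} (h0 : 0 < ε) (h1 : ε < 1) (hn : 1 ≤ n) (hΔ : 2 ≤ Δ) {c : ℝ}
    (hc : c = 3 * (13 * κ + 4 * κ * a + 6 : ℕ) + 18 * κ) :
    (oracleRadius κ (a * n ^ a + 1) Δ (1 + ⌈1 / ε⌉₊) : ℝ) ≤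
      (Δ : ℝ) ^ (c / ε) + c / ε ^ 2 * (logStar n : ℝ) := by
  set k := 1 + ⌈1 / ε⌉₊ with hk
  have hk3 : (k : ℝ) ≤ 3 / ε := ceil_inv_le h0 h1
  have hk0 : (0 : ℝ) ≤ k := Nat.cast_nonneg k
  have hΔ1 : (1 : ℝ) ≤ Δ := by exact_mod_cast (by omega : 1 ≤ Δ)
  have hκ0 : (0 : ℝ) ≤ κ := Nat.cast_nonneg κ
  have hle : (oracleRadius κ (a * n ^ a + 1) Δ k : ℝ) ≤
      (Δ : ℝ) ^ (k * (13 * κ + 4 * κ * a + 6)) + 2 * (k : ℝ) ^ 2 * κ * logStar n := by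
    exact_mod_cast oracleRadius_le_pow hn hΔ (by omega : 1 ≤ k)
  refine hle.trans (add_le_add ?_ ?_)
  · rw [← Real.rpow_natCast]
    refine Real.rpow_le_rpow_of_exponent_le hΔ1 ?_
    rw [Nat.cast_mul, hc]
    set c₁ : ℝ := ((13 * κ + 4 * κ * a + 6 : ℕ) : ℝ)
    have hc1 : 0 ≤ c₁ := Nat.cast_nonneg _
    calc (k : ℝ) * c₁ ≤ 3 / ε * c₁ := mul_le_mul_of_nonneg_right hk3 hc1
      _ = (3 * c₁) / ε := by ring
      _ ≤ (3 * c₁ + 18 * κ) / ε := by gcongr; linarith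
  · refine mul_le_mul_of_nonneg_right ?_ (Nat.cast_nonneg _)
    have hsq : (k : ℝ) ^ 2 ≤ (3 / ε) ^ 2 := pow_le_pow_left₀ hk0 hk3 2
    calc 2 * (k : ℝ) ^ 2 * κ ≤ 2 * (3 / ε) ^ 2 * κ := by gcongr
      _ = (18 * κ) / ε ^ 2 := by ring
      _ ≤ c / ε ^ 2 := by
        gcongr
        rw [hc]
        have : (0 : ℝ) ≤ ((13 * κ + 4 * κ * a + 6 : ℕ) : ℝ) := Nat.cast_nonneg _
        linarith

end Radius

/-! ### Graphs of maximum degree at most one, and matchings in terms of identifiers -/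

namespace LabeledGraph

variable {G : LabeledGraph}

/-- In a graph with maximum degree at most one, an edge is a connected component. -/
theorem edgeBall_subset_of_maxDeg_le_one (h : G.maxDeg ≤ 1) {q : Sym2 ℕ} (hq : q ∈ G.idEdges)
    (r : ℕ) : G.edgeBall q r ⊆ G.edgeBall q 0 := by
  obtain ⟨u, v, huv, rfl⟩ := mem_idEdges.1 hq
  have huniq : ∀ x y z, G.graph.Adj x y → G.graph.Adj x z → y = z := by
    intro x y z hy hz
    have h1 : (G.graph.neighborFinset x).card ≤ 1 := by
      rw [SimpleGraph.card_neighborFinset_eq_degree]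
      exact (G.graph.degree_le_maxDegree x).trans h
    exact Finset.card_le_one.1 h1 y ((SimpleGraph.mem_neighborFinset _ _ _).2 hy) z
      ((SimpleGraph.mem_neighborFinset _ _ _).2 hz)
  have hmem : ∀ w, G.id w ∈ s(G.id u, G.id v) ↔ w = u ∨ w = v := fun w => by
    rw [Sym2.mem_iff, G.id_injective.eq_iff, G.id_injective.eq_iff]
  rintro w ⟨x, hx, hw⟩
  refine ⟨w, ?_, mem_vertexBall_self _ _⟩
  rw [hmem] at hx ⊢
  induction r generalizing w with
  | zero => rwa [mem_vertexBall_zero.1 hw]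
  | succ r ih =>
    rcases mem_vertexBall_succ.1 hw with hw | ⟨y, hy, hyw⟩
    · exact ih hw
    · rcases ih hy with rfl | rfl
      · exact .inr (huniq _ _ _ hyw huv)
      · exact .inl (huniq _ _ _ hyw huv.symm)

/-- A matching, as a set of pairs of identifiers. -/
theorem IsMatching.isEdgeMatching {M : Finset (Sym2 G.V)} (h : G.IsMatching M) :
    IsEdgeMatching (M.image (Sym2.map G.id)) ∧ M.image (Sym2.map G.id) ⊆ G.idEdges ∧
      (M.image (Sym2.map G.id)).card = M.card := by
  refine ⟨⟨?_, ?_⟩, Finset.image_subset_image h.1,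
    Finset.card_image_of_injective _ (Sym2.map.injective G.id_injective)⟩
  · intro e he
    obtain ⟨f, hf, rfl⟩ := Finset.mem_image.1 he
    have := SimpleGraph.mem_edgeFinset.1 (h.1 hf)
    induction f with
    | h u v => exact fun h' => SimpleGraph.Adj.ne this (G.id_injective h')
  · intro e he f hf x hxe hxf
    obtain ⟨e, he', rfl⟩ := Finset.mem_image.1 he
    obtain ⟨f, hf', rfl⟩ := Finset.mem_image.1 hf
    obtain ⟨u, hu, rfl⟩ := Sym2.mem_map.1 hxe
    obtain ⟨v, hv, huv⟩ := Sym2.mem_map.1 hxf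
    obtain rfl := G.id_injective huv
    rw [h.2 e he' f hf' v hu hv]

end LabeledGraph

/-! ### The oracle as a centralized local algorithm -/

section OracleAlgorithm

variable {G : LabeledGraph} {C : ColoringAlgorithm} {κ a : ℕ}

theorem oracleAlgorithm_stateless (C : ColoringAlgorithm) (a k : ℕ) :
    (oracleAlgorithm C a k).Stateless :=
  inferInstanceAs (Subsingleton Unit)

theorem oracleAlgorithm_run (k : ℕ) (s : (oracleAlgorithm C a k).State) (l : List (Sym2 ℕ)) :
    ((oracleAlgorithm C a k).run G s l).1 =
      l.map fun q => (oracle C (a * G.n ^ a + 1) G.maxDeg k q).eval G.answer := by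
  induction l generalizing s with
  | nil => rfl
  | cons q l ih =>
    have hstep : ((oracleAlgorithm C a k).step G.n G.maxDeg s q).eval G.answer =
        ((oracle C (a * G.n ^ a + 1) G.maxDeg k q).eval G.answer, ()) := by
      simp [oracleAlgorithm, CentLocalAlgorithm.ofStateless]
    rw [CentLocalAlgorithm.run, List.map_cons, hstep]
    exact congrArg _ (ih _)

theorem oracleAlgorithm_hasProbeRadius (hC : C.IsPolyColoring κ) (k : ℕ) :
    (oracleAlgorithm C a k).HasProbeRadius G
      (oracleRadius κ (a * G.n ^ a + 1) G.maxDeg k) := by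
  intro l _ q hq
  exact .bind (oracle_probesWithin hC (fun v => G.graph.degree_le_maxDegree v) k q
    (LabeledGraph.isEdgeQuery_iff.1 hq)) (ProbeTree.probesWithin_pure _)

theorem oracleAlgorithm_solves (hC : C.IsPolyColoring κ) (hid : ∀ v, G.id v ≤ a * G.n ^ a)
    {ε : ℝ} (hε : 0 < ε) :
    (oracleAlgorithm C a (1 + ⌈1 / ε⌉₊)).Solves G (G.approxMCM ε) := by
  set k := 1 + ⌈1 / ε⌉₊ with hk
  set O := oracle C (a * G.n ^ a + 1) G.maxDeg k with hO
  refine ⟨fun q => (O q).eval G.answer, ?_, fun l _ => oracleAlgorithm_run k _ l⟩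
  obtain ⟨hM, hmin⟩ := oracle_matching (G := G) (B := a * G.n ^ a + 1) (Δ := G.maxDeg) hC
    (fun v => G.graph.degree_le_maxDegree v) (fun v => Nat.lt_succ_of_le (hid v)) k
  rw [← hO] at hM hmin
  let M : Finset (Sym2 G.V) :=
    G.graph.edgeFinset.filter fun e => (O (Sym2.map G.id e)).eval G.answer = true
  have himage : M.image (Sym2.map G.id) = G.decidedEdges O := by
    ext e
    simp only [M, LabeledGraph.decidedEdges, LabeledGraph.idEdges, Finset.mem_image,
      Finset.mem_filter]
    constructor
    · rintro ⟨f, ⟨hf, h⟩, rfl⟩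
      exact ⟨⟨f, hf, rfl⟩, h⟩
    · rintro ⟨⟨f, hf, rfl⟩, h⟩
      exact ⟨f, ⟨hf, h⟩, rfl⟩
  refine ⟨M, ⟨Finset.filter_subset _ _, ?_⟩, ?_, ?_⟩
  · intro e he f hf v hve hvf
    refine Sym2.map.injective G.id_injective (hM.2 _ ?_ _ ?_ (G.id v)
      (Sym2.mem_map.2 ⟨v, hve, rfl⟩) (Sym2.mem_map.2 ⟨v, hvf, rfl⟩))
    · exact himage ▸ Finset.mem_image_of_mem _ he
    · exact himage ▸ Finset.mem_image_of_mem _ hf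
  · intro M' hM'
    obtain ⟨h1, h2, h3⟩ := hM'.isEdgeMatching
    have h4 := card_le_of_no_short_augPath hM h1 (LabeledGraph.decidedEdges_subset O) h2 hmin
    rw [h3, ← himage,
      Finset.card_image_of_injective _ (Sym2.map.injective G.id_injective)] at h4
    have h5 : (k : ℝ) * M'.card ≤ (k + 1) * M.card := by exact_mod_cast h4
    -- This says `1 - ε ≤ k / (k + 1)`, the ratio guaranteed after `k` rounds.
    have h6 : 1 ≤ ε * (k + 1) := by
      have := Nat.le_ceil (1 / ε)
      have h7 : 1 / ε ≤ (k : ℝ) + 1 := by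
        rw [hk]
        push_cast
        linarith
      rw [div_le_iff₀ hε] at h7
      linarith
    have h8 : (0 : ℝ) ≤ M'.card := Nat.cast_nonneg _
    have h9 : (0 : ℝ) < k + 1 := by positivity
    refine le_of_mul_le_mul_left ?_ h9
    nlinarith
  · intro e he
    simp only [M, Finset.mem_filter, SimpleGraph.mem_edgeFinset]
    exact ⟨fun h => ⟨he, h⟩, fun h => h.2⟩

end OracleAlgorithm

theorem mainTheorem3 :
    (∃ (C : ColoringAlgorithm) (κ : ℕ), C.IsPolyColoring κ) ∧
    ∀ κ a : ℕ, ∃ c : ℝ, 0 < c ∧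
      ∀ C : ColoringAlgorithm, C.IsPolyColoring κ →
      ∀ ε : ℝ, 0 < ε → ε < 1 →
        (oracleAlgorithm C a (1 + ⌈1 / ε⌉₊)).Stateless ∧
        ∀ G : LabeledGraph, (∀ v, G.id v ≤ a * G.n ^ a) →
          (oracleAlgorithm C a (1 + ⌈1 / ε⌉₊)).Solves G (G.approxMCM ε) ∧
          ∃ r : ℕ, (oracleAlgorithm C a (1 + ⌈1 / ε⌉₊)).HasProbeRadius G r ∧
            (r : ℝ) ≤ (G.maxDeg : ℝ) ^ (c / ε) + c / ε ^ 2 * (logStar G.n : ℝ) := by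
  refine ⟨⟨linialColoring, 2 ^ 14, linialColoring_isPolyColoring⟩, fun κ a => ?_⟩
  refine ⟨3 * (13 * κ + 4 * κ * a + 6 : ℕ) + 18 * κ, by positivity, fun C hC ε h0 h1 => ?_⟩
  refine ⟨oracleAlgorithm_stateless _ _ _, fun G hid => ⟨oracleAlgorithm_solves hC hid h0, ?_⟩⟩
  have hr := oracleAlgorithm_hasProbeRadius (G := G) (a := a) hC (1 + ⌈1 / ε⌉₊)
  -- A power of `Δ ≤ 1` cannot absorb the constants, but then the endpoints of the queried edge are
  -- all that can be reached, and radius 0 suffices.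
  rcases Nat.lt_or_ge G.maxDeg 2 with hΔ | hΔ
  · refine ⟨0, fun l hl q hq => (hr l hl q hq).mono ?_, ?_⟩
    · exact LabeledGraph.edgeBall_subset_of_maxDeg_le_one (by omega)
        (LabeledGraph.isEdgeQuery_iff.1 hq) _
    · rw [Nat.cast_zero]
      positivity
  · refine ⟨_, hr, oracleRadius_real_le h0 h1 ?_ hΔ rfl⟩
    -- The bound on `log*` needs `n ≥ 1`; an empty graph would have maximum degree 0.
    refine Nat.one_le_iff_ne_zero.2 fun hn => ?_
    have hempty : IsEmpty G.V := Fintype.card_eq_zero_iff.1 hn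
    have : G.maxDeg = 0 := by
      rw [LabeledGraph.maxDeg]
      exact Nat.le_zero.1 (G.graph.maxDegree_le_of_forall_degree_le 0 fun v => hempty.elim v)
    omega
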